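/- **Setting.** Let $r\in(0,1)$ and let $X,X_1,X_2,\dots$ be i.i.d. real random variables, $S_n=X_1+\dots+X_n$, such that $\mathbb E[X]=0$, $\mathbb E[X^2]=1$, $\mathbb E[|X|^k]<\infty$ for all integers $k\le\kappa:=\lfloor (2-r)/(1-r)\rfloor$, and, for some $x_0>0$, $$\mathbb P[X>x]=a(x)e^{-R(x)},\qquad x>x_0,$$ where $a,R:(x_0,\infty)\to[0,\infty)$, $a(x)\to a>0$ as $x\to\infty$, and $R$ is $\mathcal C^2$ on $(x_0,\infty)$ with $R'$ regularly varying at infinity with index $r-1$ and $R''(x)=O(x^{r-2+\varepsilon})$ for every $\varepsilon>0$. Assume that $R(x)x^{-b}$ is eventually decreasing for some $b\in(0,1)$ and, if $r>2/3$, that for some $\varepsilon>0$ the function $R(x)x^{-1/2-\varepsilon}$ is eventually increasing and $R(x)x^{-1+\varepsilon}$ is eventually decreasing (monotonicity in the weak sense). A function $f$ is regularly varying with index $\rho$ if it is measurable, eventually positive and $f(cx)/f(x)\to c^{\rho}$ as $x\to\infty$ for each $c>0$; a sequence is regularly varying if for large $n$ it is the restriction to the integers of such a function. Let $(d_n)$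 be either any sequence that is regularly varying with index $1/r$, or $d_n=\inf\{x>x_0: R(x)>n\log m\}$ for some $m>1$ (in which case $R$ is also assumed to be bounded on $(x_0,x_0+1]$). Let $(z_n^*)$ be a sequence of real numbers that is regularly varying with index strictly less than $2-1/r$ if $r>2/3$ and strictly less than $1/r-1/2$ if $r\le 2/3$, and put $$H_n=\left[d_n+\tfrac12 nR'(d_n)-z_n^*,\ d_n+\tfrac12 nR'(d_n)+z_n^*\right].$$ Let $(j_n^*)$ be a sequence of natural numbers that is regularly varying with index strictly less than $\min\{1,3/r-3\}$, and let $J_n=\{0,1,\dots,j_n^*\}$. Define $k_1,\dots,k_\kappa$ by $k_j=\mathbb E[X^j]-\sum_{i=1}^{j-1}\binom{j-1}{i}k_{j-i}\mathbb E[X^i]$ and the truncated cumulant generating function by $K(s)=\sum_{j=2}^{\kappa}\frac{k_j}{j!}s^j$. For $s_0\in(0,1]$ put $$I_{s_0}(x)=I_{n,s_0}(x)=\inf_{s\in[0,s_0]}\left\{R(x-nK'(s))+n\bigl(sK'(s)-K(s)\bigr)\right\}.$$ **Theorem.** There is $s_0\in(0,1]$ such that $sK'(s)-K(s)>0$ for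 all $s\in(0,s_0]$; and for every such $s_0$, uniformly in $x\in H_n$ and $j\in J_n$, as $n\to\infty$, $$\mathbb P[S_{n-j}>x]\sim a\,n\,e^{-I_{s_0}(x)+O\left(j_n^*R'(x)^2\right)} .$$ That is, there are a constant $C$ and numbers $\theta_n(j,x)$ with $|\theta_n(j,x)|\le C\,j_n^*R'(x)^2$ for all large $n$, all $j\in J_n$ and all $x\in H_n$, such that $$\lim_{n\to\infty}\ \sup_{j\in J_n}\ \sup_{x\in H_n}\left|\frac{\mathbb P[S_{n-j}>x]}{a\,n\,e^{-I_{s_0}(x)+\theta_n(j,x)}}-1\right|=0 .$$ -/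

import Mathlib

open MeasureTheory ProbabilityTheory Filter Set Asymptotics
open scoped Topology

/-- `f` is regularly varying at infinity with index `ρ`: it is measurable, eventually positive and
`f (c x) / f x → c ^ ρ` for every `c > 0`; that is, `f x = x ^ ρ * ℓ x` for large `x`, where `ℓ` is
slowly varying. -/
def IsRegularlyVarying (f : ℝ → ℝ) (ρ : ℝ) : Prop :=
  Measurable f ∧ (∀ᶠ x in atTop, 0 < f x) ∧
    ∀ c : ℝ, 0 < c → Tendsto (fun x => f (c * x) / f x) atTop (𝓝 (c ^ ρ))

/-- A real sequence is regularly varying with index `ρ` if, for large `n`, it is the restriction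
to the integers of a regularly varying function with index `ρ`, that is `u n = n ^ ρ * ℓ n` with
`ℓ` slowly varying. -/
def IsRegularlyVaryingSeq (u : ℕ → ℝ) (ρ : ℝ) : Prop :=
  ∃ f : ℝ → ℝ, IsRegularlyVarying f ρ ∧ ∀ᶠ n : ℕ in atTop, u n = f n

/-- The number of moments that are used, `⌊(2 - r) / (1 - r)⌋`. -/
noncomputable def truncationOrder (r : ℝ) : ℕ := ⌊(2 - r) / (1 - r)⌋₊

/-- The cumulants attached to a sequence of moments `M 1, M 2, …`, through the recursion
`k j = M j - ∑ i = 1, …, j - 1, (j - 1).choose i * k (j - i) * M i` for `j ≥ 1` (written below for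
`j = n + 1` and with `i + 1` in place of `i`). The value at `0` is not used. -/
noncomputable def cumulant (M : ℕ → ℝ) : ℕ → ℝ
  | 0 => 0
  | n + 1 => M (n + 1) -
      ∑ i : Fin n, (n.choose (i + 1) : ℝ) * cumulant M (n - i) * M (i + 1)
  decreasing_by omega

/-- The truncated cumulant generating function
`K s = ∑ j = 2, …, ⌊(2 - r) / (1 - r)⌋, k j / j! * s ^ j` of the random variable `X`. -/
noncomputable def truncatedCGF {Ω : Type*} [MeasurableSpace Ω] (μ : Measure Ω) (X : Ω → ℝ)
    (r : ℝ) (s : ℝ) : ℝ :=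
  ∑ j ∈ Finset.Icc 2 (truncationOrder r),
    cumulant (fun i => ∫ ω, X ω ^ i ∂μ) j / (j.factorial : ℝ) * s ^ j

/-- `X` is centred with variance one and has the stretched exponential upper tail
`P[X > x] = α x * exp (- R x)`, `x > x₀`, with index `r ∈ (0, 1)` and `α x → a > 0`.
The values of `α` and `R` on `(-∞, x₀]` are irrelevant. -/
structure HasStretchedExpTail {Ω : Type*} [MeasurableSpace Ω] (μ : Measure Ω) (X : Ω → ℝ)
    (r x₀ a : ℝ) (α R : ℝ → ℝ) : Prop where
  r_pos : 0 < r
  r_lt_one : r < 1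
  x₀_pos : 0 < x₀
  a_pos : 0 < a
  α_nonneg : ∀ x, x₀ < x → 0 ≤ α x
  R_nonneg : ∀ x, x₀ < x → 0 ≤ R x
  integrable_pow : ∀ k : ℕ, k ≤ truncationOrder r → Integrable (fun ω => |X ω| ^ k) μ
  mean_eq : ∫ ω, X ω ∂μ = 0
  second_moment_eq : ∫ ω, X ω ^ 2 ∂μ = 1
  tail_eq : ∀ x, x₀ < x → μ.real {ω | x < X ω} = α x * Real.exp (-R x)
  α_tendsto : Tendsto α atTop (𝓝 a)
  contDiffOn : ContDiffOn ℝ 2 R (Ioi x₀)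
  deriv_regularlyVarying : IsRegularlyVarying (deriv R) (r - 1)
  deriv2_isBigO : ∀ ε : ℝ, 0 < ε →
    (fun x => deriv (deriv R) x) =O[atTop] fun x : ℝ => x ^ (r - 2 + ε)
  eventually_antitone : ∃ b ∈ Ioo (0 : ℝ) 1, ∃ A : ℝ,
    AntitoneOn (fun x : ℝ => R x * x ^ (-b)) (Ici A)
  eventually_monotone : 2 / 3 < r → ∃ ε : ℝ, 0 < ε ∧ ∃ A : ℝ,
    MonotoneOn (fun x : ℝ => R x * x ^ (-1 / 2 - ε)) (Ici A) ∧
    AntitoneOn (fun x : ℝ => R x * x ^ (-1 + ε)) (Ici A)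

/-- The admissible scales `d`: every sequence that is regularly varying with index `1 / r`, and the
sequence `d n = inf {x > x₀ : R x > n log m}` for any `m > 1`. In the second case `R` is asked not
to blow up at the left end point of its domain, so that `d n` is the solution of `R x = n log m`
for large `n`. -/
def IsDeviationScale (R : ℝ → ℝ) (r x₀ : ℝ) (d : ℕ → ℝ) : Prop :=
  IsRegularlyVaryingSeq d (1 / r) ∨
    (BddAbove (R '' Ioc x₀ (x₀ + 1)) ∧
      ∃ m : ℝ, 1 < m ∧ ∀ n : ℕ, d n = sInf {x : ℝ | x₀ < x ∧ n * Real.log m < R x})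

/-- The window `[d n + n R' (d n) / 2 - z n, d n + n R' (d n) / 2 + z n]`. -/
noncomputable def deviationWindow (R : ℝ → ℝ) (d z : ℕ → ℝ) (n : ℕ) : Set ℝ :=
  Icc (d n + n * deriv R (d n) / 2 - z n) (d n + n * deriv R (d n) / 2 + z n)

/-- The rate `inf {R (x - n K' s) + n (s K' s - K s) : s ∈ [0, s₀]}`. -/
noncomputable def rate (R K : ℝ → ℝ) (s₀ : ℝ) (n : ℕ) (x : ℝ) : ℝ :=
  sInf ((fun s : ℝ => R (x - n * deriv K s) + n * (s * deriv K s - K s)) '' Icc 0 s₀)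

/-- `[0, s₀]`, `0 < s₀ ≤ 1`, is an interval on which the Legendre-type cost `s K' s - K s` of the
tilt `s` is positive away from `s = 0`. -/
def IsTiltRange (K : ℝ → ℝ) (s₀ : ℝ) : Prop :=
  0 < s₀ ∧ s₀ ≤ 1 ∧ ∀ s ∈ Ioc (0 : ℝ) s₀, 0 < s * deriv K s - K s

/-- `p n j x ∼ g n * exp (- I n x + O (e n x))` uniformly in `x ∈ H n` and `0 ≤ j ≤ J n`, as
`n → ∞`: there are a constant `C` and an error term `θ` bounded by `C * e n x` such that the
quotient of the two sides, with `θ` in place of the `O`, tends to one uniformly. -/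
def UniformExpEquiv (p : ℕ → ℕ → ℝ → ℝ) (g : ℕ → ℝ) (I e : ℕ → ℝ → ℝ) (J : ℕ → ℕ)
    (H : ℕ → Set ℝ) : Prop :=
  ∃ (C : ℝ) (θ : ℕ → ℕ → ℝ → ℝ),
    (∀ᶠ n : ℕ in atTop, ∀ j ≤ J n, ∀ x ∈ H n, |θ n j x| ≤ C * e n x) ∧
    ∀ ε : ℝ, 0 < ε → ∀ᶠ n : ℕ in atTop, ∀ j ≤ J n, ∀ x ∈ H n,
      |p n j x / (g n * Real.exp (-I n x + θ n j x)) - 1| ≤ ε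

/-! The principle is that of one big jump. Cut the law of a summand at `x / 2` and expand the
convolution power by the number of summands above the cut (`convPow_Ioi_bounds`). Two large summands
cost `2 R(x/2) ≥ (1 + η) R(x)`. No large summand costs about `(1 + η) R(x)`, by an exponential
Markov inequality with tilt `(1 + η) R(x) / x`. Both are negligible against `exp (-R x)`, hence
against `exp (-I x)`, because `I ≤ R` (take `s = 0`). What remains is the number of summands times
`∫ P[X > max (x/2) (x - t)]`, where `t` is distributed as the sum of the other, truncated summands.

In this integral the tail is about `a exp (-R (x - t))`. Let `s` solve `s = R' (x - n K' s)` and put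
`y = n K' s`. Expanding `R` at `x - y` turns the integrand into `a exp (-R (x - y) + s (t - y))`,
and the Laplace transform of `M` truncated summands gives `exp (M K s - s y)`. For `M = n` the total
exponent is `-R (x - y) - n (s K' s - K s)`, and the equation for `s` is the stationarity condition
of the infimum defining the rate; `rate_eq_of_critical` shows that the infimum is attained there.
Fewer summands change the exponent by `(n - M) K s`, which is of order `j* R'(x)²`: this is the
error term of the theorem.

Two points need work. First, the Laplace transform (`HasStretchedExpTail.truncated_mgf`): the
decrease of `R x * x ^ (-b)` gives `θ t ≤ ϑ R t` with some `ϑ < 1` on the truncated range, for all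
tilts up to `(1 + η) R(x) / x`. There `exp (θ t)` is dominated by the integrable `exp (ϑ R t)`, and
Taylor expansion to order `κ` leaves an error `O(θ ^ κ + 1 / x) = O(1 / x)`, since `κ (1 - r) > 1`.
The errors of `n` factors are harmless as `n ≤ x ^ (r + τ)` with `r + τ < 1`. Second, the quadratic
error of the expansion of `R`: with `q` a bound for `|R''|` it is `q (t - y)²`. Under the tilt the
sum deviates from `y` by little more than `√n + j* s`, as tilts `s ± l` show, and `q n → 0`
(`TiltedSum.le_integral`, `TiltedSum.integral_le`).

`LevelEstimates` lists the inequalities needed at one level `x`; `lower_bound` and `upper_bound`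
draw the conclusion from them, and `eventually_levelEstimates` obtains them for large `x` by
comparing powers of `x`. -/

/-! ### Power bounds for regularly varying functions -/

/-- Uniform convergence theorem for measurable additive-slowly varying functions. -/
theorem uniform_of_tendsto_translate {g : ℝ → ℝ} (hg : Measurable g)
    (h : ∀ v : ℝ, Tendsto (fun t => g (t + v) - g t) atTop (𝓝 0)) {ε : ℝ} (hε : 0 < ε) :
    ∀ᶠ t in atTop, ∀ u ∈ Icc (0 : ℝ) 1, |g (t + u) - g t| < 2 * ε := by
  by_contra hcon
  have hex : ∀ n : ℕ, ∃ t : ℝ, (n : ℝ) ≤ t ∧ ∃ u ∈ Icc (0 : ℝ) 1, 2 * ε ≤ |g (t + u) - g t| := by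
    intro n
    by_contra hn
    push Not at hn
    exact hcon (eventually_atTop.2 ⟨n, fun t ht u hu => hn t ht u hu⟩)
  choose t ht u hu hbad using hex
  have htop : Tendsto t atTop atTop := tendsto_atTop_mono ht tendsto_natCast_atTop_atTop
  -- sets of shifts for which the increments are eventually small
  have key : ∀ s : ℕ → ℝ, Tendsto s atTop atTop →
      Tendsto (fun n => volume (Icc (0 : ℝ) 2 ∩ {v | ∀ m, n ≤ m → |g (s m + v) - g (s m)| < ε}))
        atTop (𝓝 2) := by
    intro s hs
    have hmono : Monotone
        (fun n : ℕ => Icc (0 : ℝ) 2 ∩ {v | ∀ m, n ≤ m → |g (s m + v) - g (s m)| < ε}) := by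
      intro n n' hnn' v hv
      exact ⟨hv.1, fun m hm => hv.2 m (hnn'.trans hm)⟩
    have := tendsto_measure_iUnion_atTop (μ := (volume : Measure ℝ)) hmono
    have huniv : (⋃ n : ℕ, Icc (0 : ℝ) 2 ∩ {v | ∀ m, n ≤ m → |g (s m + v) - g (s m)| < ε})
        = Icc 0 2 := by
      ext v
      simp only [mem_iUnion, mem_inter_iff, mem_ofPred_eq, exists_and_left, and_iff_left_iff_imp]
      intro _
      have h1 := ((h v).comp hs).eventually (Metric.ball_mem_nhds 0 hε)
      obtain ⟨n, hn⟩ := eventually_atTop.1 h1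
      refine ⟨n, fun m hm => ?_⟩
      simpa [Real.dist_eq] using hn m hm
    rw [huniv] at this
    simpa [Function.comp_def] using this
  have hV := key t htop
  have hW := key (fun n => t n + u n)
    (tendsto_atTop_mono (fun n => by linarith [(hu n).1, ht n]) tendsto_natCast_atTop_atTop)
  -- The good shifts of `t n`, and those of `t n + u n` translated by `u n`, both lie in `[0, 3]`.
  -- With measures above `3 / 2` they must meet, and a common point compares `g (t n)` with `g (t n
  -- + u n)`.
  have h32 : (3 / 2 : ENNReal) < 2 := by
    rw [ENNReal.div_lt_iff (by simp) (by simp)]; norm_num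
  obtain ⟨n, hn1, hn2⟩ := ((hV.eventually (lt_mem_nhds h32)).and
    (hW.eventually (lt_mem_nhds h32))).exists
  set V := Icc (0 : ℝ) 2 ∩ {v | ∀ m, n ≤ m → |g (t m + v) - g (t m)| < ε} with hVdef
  set W := Icc (0 : ℝ) 2 ∩ {v | ∀ m, n ≤ m → |g (t m + u m + v) - g (t m + u m)| < ε} with hWdef
  have hmeas : ∀ s : ℕ → ℝ,
      MeasurableSet (Icc (0 : ℝ) 2 ∩ {v | ∀ m, n ≤ m → |g (s m + v) - g (s m)| < ε}) := by
    intro s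
    refine measurableSet_Icc.inter ?_
    simp only [ofPred_forall]
    refine MeasurableSet.iInter fun m => MeasurableSet.iInter fun _ => ?_
    exact measurableSet_lt ((hg.comp (measurable_const.add measurable_id)).sub
      measurable_const).norm measurable_const
  -- shift `W` by `u n`
  set W' := (fun v => v - u n) ⁻¹' W with hW'def
  have hW'vol : volume W' = volume W := by
    rw [hW'def]
    simp [sub_eq_add_neg]
  have hdisj : Disjoint V W' := by
    rw [Set.disjoint_left]
    intro v hv hv'
    have h1 := hv.2 n le_rfl
    have h2 := hv'.2 n le_rfl
    have h3 : t n + u n + (v - u n) = t n + v := by ring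
    rw [h3] at h2
    have h4 := hbad n
    rw [abs_lt] at h1 h2
    rcases abs_cases (g (t n + u n) - g (t n)) with ⟨h, _⟩ | ⟨h, _⟩ <;> linarith
  have hsub : V ∪ W' ⊆ Icc 0 3 := by
    rintro v (hv | hv)
    · exact ⟨hv.1.1, by linarith [hv.1.2]⟩
    · have h1 := hv.1
      simp only [mem_Icc] at h1
      have h2 := hu n
      exact ⟨by linarith [h2.1, h1.1], by linarith [h2.2, h1.2]⟩
  have hle : volume V + volume W' ≤ 3 := by
    rw [← measure_union hdisj ((hmeas _).preimage (measurable_id.sub_const _))]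
    calc volume (V ∪ W') ≤ volume (Icc (0 : ℝ) 3) := measure_mono hsub
      _ = 3 := by simp
  rw [hW'vol] at hle
  have : (3 : ENNReal) < volume V + volume W := by
    calc (3 : ENNReal) = 3 / 2 + 3 / 2 := by rw [ENNReal.add_halves]
      _ < _ := ENNReal.add_lt_add hn1 hn2
  exact absurd hle (not_le.2 this)

/-- Increments over unit steps are eventually uniformly small; adding up about `t - t₀` of them
gives sublinear growth. -/
theorem isLittleO_of_tendsto_translate {g : ℝ → ℝ} (hg : Measurable g)
    (h : ∀ v : ℝ, Tendsto (fun t => g (t + v) - g t) atTop (𝓝 0)) {ε : ℝ} (hε : 0 < ε) :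
    ∀ᶠ t in atTop, |g t| ≤ ε * t := by
  obtain ⟨t₀, ht₀⟩ := eventually_atTop.1
    (uniform_of_tendsto_translate hg h (ε := ε / 4) (by positivity))
  have h1 : ∀ k : ℕ, |g (t₀ + k) - g t₀| ≤ k * (ε / 2) := by
    intro k
    induction k with
    | zero => simp
    | succ k ih =>
      have h2 := ht₀ (t₀ + k) (by linarith [(Nat.cast_nonneg k : (0 : ℝ) ≤ k)]) 1 (by simp)
      push_cast
      rw [show t₀ + (k + 1 : ℝ) = t₀ + k + 1 by ring]
      have := abs_sub_le (g (t₀ + k + 1)) (g (t₀ + k)) (g t₀)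
      linarith
  filter_upwards [eventually_ge_atTop t₀,
    eventually_ge_atTop (2 / ε * (|g t₀| + ε / 2 + ε / 2 * |t₀|))] with t ht ht'
  have hk := Nat.floor_le (sub_nonneg.2 ht)
  have hk' := Nat.lt_floor_add_one (t - t₀)
  set k := ⌊t - t₀⌋₊
  have h2 := ht₀ (t₀ + k) (by linarith [(Nat.cast_nonneg k : (0 : ℝ) ≤ k)]) (t - t₀ - k)
    ⟨by linarith, by linarith⟩
  rw [show t₀ + k + (t - t₀ - k) = t by ring] at h2
  have h3 := abs_sub_le (g t) (g (t₀ + k)) (g t₀)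
  have h4 := abs_sub_abs_le_abs_sub (g t) (g t₀)
  have h5 := h1 k
  have h6 : (k : ℝ) * (ε / 2) ≤ (t - t₀) * (ε / 2) := by gcongr
  have h7 : |g t₀| + ε / 2 + ε / 2 * |t₀| ≤ ε / 2 * t := by
    have := mul_le_mul_of_nonneg_left ht' (by positivity : 0 ≤ ε / 2)
    rwa [show ε / 2 * (2 / ε * (|g t₀| + ε / 2 + ε / 2 * |t₀|))
      = |g t₀| + ε / 2 + ε / 2 * |t₀| by field_simp] at this
  have h8 : -(ε / 2 * t₀) ≤ ε / 2 * |t₀| := by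
    have := neg_abs_le t₀
    nlinarith
  linarith

/-- Polynomial (Potter) bounds for regularly varying functions. -/
theorem IsRegularlyVarying.rpow_bounds {f : ℝ → ℝ} {ρ : ℝ} (hf : IsRegularlyVarying f ρ)
    {ε : ℝ} (hε : 0 < ε) :
    ∀ᶠ x in atTop, x ^ (ρ - ε) ≤ f x ∧ f x ≤ x ^ (ρ + ε) := by
  obtain ⟨hm, hpos, hlim⟩ := hf
  -- In logarithmic coordinates slow variation becomes additive, and sublinear growth of `g` becomes
  -- a factor `x ^ (± ε)`.
  set g : ℝ → ℝ := fun t => Real.log (f (Real.exp t)) - ρ * t with hgdef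
  have hg : Measurable g :=
    (Real.measurable_log.comp (hm.comp Real.measurable_exp)).sub (measurable_id.const_mul ρ)
  have hg0 : ∀ v : ℝ, Tendsto (fun t => g (t + v) - g t) atTop (𝓝 0) := by
    intro v
    have h1 := (hlim (Real.exp v) (Real.exp_pos v)).comp Real.tendsto_exp_atTop
    have h2 := h1.log (Real.rpow_pos_of_pos (Real.exp_pos v) ρ).ne'
    rw [Real.log_rpow (Real.exp_pos v), Real.log_exp] at h2
    have h3 := h2.sub_const (ρ * v)
    rw [sub_self] at h3
    refine h3.congr' ?_
    have hp1 := Real.tendsto_exp_atTop.eventually hpos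
    have hp2 := (Real.tendsto_exp_atTop.comp (tendsto_atTop_add_const_right atTop v
      tendsto_id)).eventually hpos
    filter_upwards [hp1, hp2] with t h4 h5
    simp only [Function.comp, id] at h4 h5 ⊢
    rw [show Real.exp v * Real.exp t = Real.exp (t + v) by rw [add_comm, Real.exp_add],
      Real.log_div h5.ne' h4.ne', hgdef]
    ring
  have h := Real.tendsto_log_atTop.eventually (isLittleO_of_tendsto_translate hg hg0 hε)
  filter_upwards [h, hpos, eventually_gt_atTop 0] with x hx hfx hx0
  rw [hgdef] at hx
  simp only [Real.exp_log hx0] at hx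
  rw [abs_le] at hx
  constructor
  · rw [← Real.log_le_log_iff (Real.rpow_pos_of_pos hx0 _) hfx, Real.log_rpow hx0]
    linarith
  · rw [← Real.log_le_log_iff hfx (Real.rpow_pos_of_pos hx0 _), Real.log_rpow hx0]
    linarith

theorem IsRegularlyVaryingSeq.rpow_bounds {u : ℕ → ℝ} {ρ : ℝ} (hu : IsRegularlyVaryingSeq u ρ)
    {ε : ℝ} (hε : 0 < ε) :
    ∀ᶠ n : ℕ in atTop, (n : ℝ) ^ (ρ - ε) ≤ u n ∧ u n ≤ (n : ℝ) ^ (ρ + ε) := by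
  obtain ⟨f, hf, hfu⟩ := hu
  filter_upwards [hfu, tendsto_natCast_atTop_atTop.eventually (hf.rpow_bounds hε)] with n h1 h2
  rwa [h1]

/-! ### Convolution powers and the number of big jumps -/

/-- Convolution powers of a measure. -/
noncomputable def convPow (ν : Measure ℝ) : ℕ → Measure ℝ
  | 0 => Measure.dirac 0
  | n + 1 => convPow ν n ∗ ν

instance convPow_isFiniteMeasure (ν : Measure ℝ) [IsFiniteMeasure ν] (n : ℕ) :
    IsFiniteMeasure (convPow ν n) := by
  induction n with
  | zero => unfold convPow; infer_instance
  | succ n ih => unfold convPow; infer_instance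

theorem conv_univ (μ ν : Measure ℝ) [IsFiniteMeasure μ] [IsFiniteMeasure ν] :
    (μ ∗ ν) univ = μ univ * ν univ := by
  rw [Measure.conv, Measure.map_apply (by fun_prop) .univ, preimage_univ, ← univ_prod_univ,
    Measure.prod_prod]

theorem conv_apply (μ ν : Measure ℝ) [IsFiniteMeasure μ] [IsFiniteMeasure ν] {s : Set ℝ}
    (hs : MeasurableSet s) : (μ ∗ ν) s = ∫⁻ t, ν ((fun v => t + v) ⁻¹' s) ∂μ := by
  rw [Measure.conv, Measure.map_apply (by fun_prop) hs,
    Measure.prod_apply (hs.preimage (by fun_prop))]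
  rfl

theorem convPow_univ (ν : Measure ℝ) [IsFiniteMeasure ν] (n : ℕ) :
    convPow ν n univ = ν univ ^ n := by
  induction n with
  | zero => simp [convPow]
  | succ n ih => rw [convPow, conv_univ, ih, pow_succ]

theorem convPow_map_sum {Ω : Type*} [MeasurableSpace Ω] {μ : Measure Ω} [IsProbabilityMeasure μ]
    {X : ℕ → Ω → ℝ} (h_indep : iIndepFun X μ) (h_ident : ∀ i, IdentDistrib (X i) (X 0) μ μ)
    (n : ℕ) : μ.map (fun ω => ∑ i ∈ Finset.range n, X i ω) = convPow (μ.map (X 0)) n := by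
  have hX : ∀ i, AEMeasurable (X i) μ := fun i => (h_ident i).aemeasurable_fst
  induction n with
  | zero => simp [convPow, Measure.map_const]
  | succ n ih =>
    have hind := h_indep.indepFun_sum_range_succ₀ hX n
    have h1 := hind.map_add_eq_map_conv_map₀
      (Finset.aemeasurable_sum _ fun i _ => hX i) (hX n)
    have h2 : (fun ω => ∑ i ∈ Finset.range (n + 1), X i ω)
        = (∑ i ∈ Finset.range n, X i) + X n := by
      ext ω; simp [Finset.sum_range_succ]
    have h3 : (fun ω => ∑ i ∈ Finset.range n, X i ω) = ∑ i ∈ Finset.range n, X i := by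
      ext ω; simp
    rw [h2, h1, ← h3, ih, convPow, (h_ident n).map_eq]

/-- Decomposition of a convolution power of `ρ + β` according to the number of factors `β`. -/
theorem exists_convPow_add_eq (ρ β : Measure ℝ) [IsFiniteMeasure ρ] [IsFiniteMeasure β]
    (hprob : ρ univ + β univ = 1) (n : ℕ) :
    ∃ E : Measure ℝ, IsFiniteMeasure E ∧
      convPow (ρ + β) (n + 1) = convPow ρ (n + 1) + (n + 1) • (convPow ρ n ∗ β) + E ∧
      E univ ≤ (n + 1 : ENNReal) ^ 2 * β univ ^ 2 := by
  have hρ : ρ univ ≤ 1 := by rw [← hprob]; exact le_self_add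
  induction n with
  | zero =>
    refine ⟨0, inferInstance, ?_, by simp⟩
    simp [convPow]
  | succ n ih =>
    obtain ⟨E, hEfin, hE, hEu⟩ := ih
    -- Two factors `β` occur either among the earlier factors, or when a last factor `β` joins
    -- exactly one earlier `β`. The masses add up because `(n + 1)² + (n + 1) ≤ (n + 2)²`.
    refine ⟨E ∗ (ρ + β) + (n + 1) • ((convPow ρ n ∗ β) ∗ β), ?_, ?_, ?_⟩
    · infer_instance
    · rw [convPow, hE, Measure.add_conv, Measure.add_conv, Measure.conv_add (convPow ρ (n + 1)),
        Measure.conv_add]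
      have h1 : (convPow ρ n ∗ β) ∗ ρ = convPow ρ (n + 1) ∗ β := by
        rw [convPow, Measure.conv_assoc, Measure.conv_comm β ρ, ← Measure.conv_assoc]
      have h2 : ∀ (k : ℕ) (μ ν : Measure ℝ) [IsFiniteMeasure μ] [IsFiniteMeasure ν],
          (k • μ) ∗ ν = k • (μ ∗ ν) := by
        intro k μ ν _ _
        have := Measure.conv_smul_left μ ν (k : ENNReal)
        simpa [Nat.cast_smul_eq_nsmul] using this
      rw [h2, h2, h1, succ_nsmul _ (n + 1)]
      change (convPow ρ (n + 1 + 1) + _ + _ + _) = _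
      abel
    · rw [Measure.add_apply, conv_univ, Measure.add_apply, hprob, mul_one, Measure.smul_apply,
        conv_univ, conv_univ, convPow_univ]
      have h3 : ρ univ ^ n * β univ * β univ ≤ β univ ^ 2 := by
        calc ρ univ ^ n * β univ * β univ ≤ 1 * β univ * β univ := by gcongr; exact pow_le_one₀ (zero_le) hρ
          _ = _ := by ring
      calc E univ + (n + 1) • (ρ univ ^ n * β univ * β univ)
          ≤ (n + 1 : ENNReal) ^ 2 * β univ ^ 2 + (n + 1) • β univ ^ 2 := by gcongr
        _ = ((n + 1 : ENNReal) ^ 2 + (n + 1)) * β univ ^ 2 := by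
          rw [nsmul_eq_mul]; push_cast; ring
        _ ≤ _ := by
          gcongr
          push_cast
          have : ((n : ENNReal) + 1 + 1) ^ 2 = (n + 1) ^ 2 + (n + 1) + (n + 2) := by ring
          rw [this]
          exact le_self_add

/-- The probability that a sum is large, compared with the probability of one big jump. -/
theorem convPow_Ioi_bounds (ν : Measure ℝ) [IsProbabilityMeasure ν] (h x : ℝ) (n : ℕ) :
    (n + 1) * ∫ t, ν.real (Ioi (max h (x - t))) ∂(convPow (ν.restrict (Iic h)) n)
        ≤ (convPow ν (n + 1)).real (Ioi x) ∧
    (convPow ν (n + 1)).real (Ioi x) ≤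
      (n + 1) * ∫ t, ν.real (Ioi (max h (x - t))) ∂(convPow (ν.restrict (Iic h)) n)
        + (convPow (ν.restrict (Iic h)) (n + 1)).real (Ioi x)
        + (n + 1) ^ 2 * ν.real (Ioi h) ^ 2 := by
  set ρ := ν.restrict (Iic h) with hρ
  set β := ν.restrict (Ioi h) with hβ
  have hsum : ρ + β = ν := by
    have := Measure.restrict_add_restrict_compl (μ := ν) (s := Iic h) measurableSet_Iic
    rwa [compl_Iic] at this
  have hprob : ρ univ + β univ = 1 := by
    rw [← Measure.add_apply, hsum, measure_univ]
  obtain ⟨E, hEfin, hE, hEu⟩ := exists_convPow_add_eq ρ β hprob n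
  rw [hsum] at hE
  have hβu : β univ = ν (Ioi h) := by simp [hβ]
  have hQ : (convPow ρ n ∗ β).real (Ioi x)
      = ∫ t, ν.real (Ioi (max h (x - t))) ∂(convPow ρ n) := by
    rw [measureReal_def, conv_apply _ _ measurableSet_Ioi, integral_eq_lintegral_of_nonneg_ae]
    · congr 1
      refine lintegral_congr fun t => ?_
      rw [measureReal_def, ENNReal.ofReal_toReal (measure_ne_top _ _), hβ,
        Measure.restrict_apply (measurableSet_Ioi.preimage (by fun_prop))]
      congr 1
      ext v
      simp only [mem_inter_iff, mem_preimage, mem_Ioi, max_lt_iff]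
      constructor
      · rintro ⟨h1, h2⟩; exact ⟨h2, by linarith⟩
      · rintro ⟨h1, h2⟩; exact ⟨by linarith, h1⟩
    · exact ae_of_all _ fun t => measureReal_nonneg
    · have : Antitone fun v : ℝ => ν.real (Ioi v) := fun a b hab =>
        measureReal_mono (Ioi_subset_Ioi hab)
      exact (this.measurable.comp (measurable_const.max (measurable_const.sub measurable_id))).aestronglyMeasurable
  have hEr : E.real (Ioi x) ≤ (n + 1) ^ 2 * ν.real (Ioi h) ^ 2 := by
    have h1 : E (Ioi x) ≤ (n + 1 : ENNReal) ^ 2 * ν (Ioi h) ^ 2 := by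
      rw [← hβu]; exact (measure_mono (subset_univ _)).trans hEu
    have h2 := ENNReal.toReal_mono (by finiteness) h1
    rw [measureReal_def, measureReal_def]
    convert h2 using 1
    rw [ENNReal.toReal_mul, ENNReal.toReal_pow, ENNReal.toReal_pow]
    norm_cast
  have hmain : (convPow ν (n + 1)).real (Ioi x) = (convPow ρ (n + 1)).real (Ioi x)
      + (n + 1) * (convPow ρ n ∗ β).real (Ioi x) + E.real (Ioi x) := by
    rw [hE]
    simp only [measureReal_def, Measure.add_apply, Measure.smul_apply, nsmul_eq_mul]
    rw [ENNReal.toReal_add (by finiteness) (by finiteness),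
      ENNReal.toReal_add (by finiteness) (by finiteness), ENNReal.toReal_mul]
    norm_cast
  rw [← hQ, hmain]
  have h4 : 0 ≤ (convPow ρ (n + 1)).real (Ioi x) := measureReal_nonneg
  have h5 : 0 ≤ E.real (Ioi x) := measureReal_nonneg
  constructor <;> linarith

theorem integral_exp_convPow (ρ : Measure ℝ) [IsFiniteMeasure ρ] {s : ℝ}
    (hs : Integrable (fun t => Real.exp (s * t)) ρ) (n : ℕ) :
    Integrable (fun t => Real.exp (s * t)) (convPow ρ n) ∧
      ∫ t, Real.exp (s * t) ∂(convPow ρ n) = (∫ t, Real.exp (s * t) ∂ρ) ^ n := by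
  induction n with
  | zero =>
    simp only [convPow]
    refine ⟨?_, by simp⟩
    exact integrable_dirac (by simp)
  | succ n ih =>
    obtain ⟨ih1, ih2⟩ := ih
    have h1 : Integrable (fun p : ℝ × ℝ => Real.exp (s * p.1) * Real.exp (s * p.2))
      ((convPow ρ n).prod ρ) := ih1.mul_prod hs
    have hm : AEStronglyMeasurable (fun t => Real.exp (s * t)) (convPow ρ n ∗ ρ) :=
      (by fun_prop : Measurable fun t => Real.exp (s * t)).aestronglyMeasurable
    have h2 : (fun t => Real.exp (s * t)) ∘ (fun p : ℝ × ℝ => p.1 + p.2)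
        = fun p : ℝ × ℝ => Real.exp (s * p.1) * Real.exp (s * p.2) := by
      ext p; simp [mul_add, Real.exp_add]
    constructor
    · rw [convPow, Measure.conv, integrable_map_measure hm (by fun_prop), h2]
      exact h1
    · rw [convPow, Measure.conv, integral_map (by fun_prop) hm]
      simp only [mul_add, Real.exp_add]
      rw [integral_prod_mul (fun t => Real.exp (s * t)) (fun t => Real.exp (s * t)), ih2, pow_succ]

/-! ### Functions that behave like `s ^ 2 / 2` near zero -/

/-- Values, slopes and tangent parabolas of a function `K` near `0`, as they follow from
`K 0 = K' 0 = 0` and `1 / 2 ≤ K'' ≤ 2` on `[0, δ]`. -/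
structure IsNearSquare (K : ℝ → ℝ) (δ : ℝ) : Prop where
  δ_pos : 0 < δ
  δ_le_one : δ ≤ 1
  contDiff : ContDiff ℝ 2 K
  zero : K 0 = 0
  deriv_zero : deriv K 0 = 0
  deriv2 : ∀ s ∈ Icc 0 δ, 1 / 2 ≤ deriv (deriv K) s ∧ deriv (deriv K) s ≤ 2

namespace IsNearSquare

variable {K : ℝ → ℝ} {δ : ℝ}

theorem mono (hK : IsNearSquare K δ) {δ' : ℝ} (h0 : 0 < δ') (h1 : δ' ≤ δ) : IsNearSquare K δ' where
  δ_pos := h0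
  δ_le_one := h1.trans hK.δ_le_one
  contDiff := hK.contDiff
  zero := hK.zero
  deriv_zero := hK.deriv_zero
  deriv2 := fun s hs => hK.deriv2 s ⟨hs.1, hs.2.trans h1⟩

theorem hasDerivAt (hK : IsNearSquare K δ) (s : ℝ) : HasDerivAt K (deriv K s) s :=
  (hK.contDiff.differentiable (by norm_num) s).hasDerivAt

theorem contDiff_deriv (hK : IsNearSquare K δ) : ContDiff ℝ 1 (deriv K) :=
  ((contDiff_succ_iff_deriv (n := 1)).1 (by simpa [one_add_one_eq_two] using hK.contDiff)).2.2

theorem hasDerivAt_deriv (hK : IsNearSquare K δ) (s : ℝ) :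
    HasDerivAt (deriv K) (deriv (deriv K) s) s :=
  (hK.contDiff_deriv.differentiable (by norm_num) s).hasDerivAt

theorem deriv_sub (hK : IsNearSquare K δ) {s t : ℝ} (hs : 0 ≤ s) (hst : s ≤ t) (ht : t ≤ δ) :
    (t - s) / 2 ≤ deriv K t - deriv K s ∧ deriv K t - deriv K s ≤ 2 * (t - s) := by
  have hd : DifferentiableOn ℝ (deriv K) (interior (Icc s t)) :=
    fun v _ => (hK.hasDerivAt_deriv v).differentiableAt.differentiableWithinAt
  have hc : ContinuousOn (deriv K) (Icc s t) := hK.contDiff_deriv.continuous.continuousOn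
  have h1 := (convex_Icc s t).mul_sub_le_image_sub_of_le_deriv hc hd (C := 1 / 2)
    (fun v hv => (hK.deriv2 v ?_).1) s ⟨le_rfl, hst⟩ t ⟨hst, le_rfl⟩ hst
  have h2 := (convex_Icc s t).image_sub_le_mul_sub_of_deriv_le hc hd (C := 2)
    (fun v hv => (hK.deriv2 v ?_).2) s ⟨le_rfl, hst⟩ t ⟨hst, le_rfl⟩ hst
  · exact ⟨by linarith, h2⟩
  all_goals
    rw [interior_Icc] at hv
    exact ⟨hs.trans hv.1.le, hv.2.le.trans ht⟩

theorem deriv_bounds (hK : IsNearSquare K δ) {s : ℝ} (hs : s ∈ Icc 0 δ) :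
    s / 2 ≤ deriv K s ∧ deriv K s ≤ 2 * s := by
  have := hK.deriv_sub le_rfl hs.1 hs.2
  simpa [hK.deriv_zero] using this

theorem tangent (hK : IsNearSquare K δ) {s t : ℝ} (hs : s ∈ Icc 0 δ) (ht : t ∈ Icc 0 δ) :
    (t - s) ^ 2 / 4 ≤ K t - K s - deriv K s * (t - s) ∧
      K t - K s - deriv K s * (t - s) ≤ (t - s) ^ 2 := by
  have hder : ∀ c v : ℝ, HasDerivAt (fun v => K v - K s - deriv K s * (v - s) - c * (v - s) ^ 2)
      (deriv K v - deriv K s - 2 * c * (v - s)) v := by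
    intro c v
    have h1 := (((hK.hasDerivAt v).sub_const (K s)).sub
      (((hasDerivAt_id v).sub_const s).const_mul (deriv K s))).sub
      ((((hasDerivAt_id v).sub_const s).pow 2).const_mul c)
    refine h1.congr_deriv ?_
    simp; ring
  have hcont : ∀ (c : ℝ) (S : Set ℝ),
      ContinuousOn (fun v => K v - K s - deriv K s * (v - s) - c * (v - s) ^ 2) S :=
    fun c S v _ => (hder c v).continuousAt.continuousWithinAt
  rcases le_total s t with hst | hst
  · have h1 := monotoneOn_of_deriv_nonneg (convex_Icc s t) (hcont (1 / 4) _)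
      (fun v _ => (hder _ v).differentiableAt.differentiableWithinAt) (fun v hv => by
        rw [(hder _ v).deriv]
        rw [interior_Icc] at hv
        have := hK.deriv_sub hs.1 hv.1.le (hv.2.le.trans ht.2)
        linarith) ⟨le_rfl, hst⟩ ⟨hst, le_rfl⟩ hst
    have h2 := antitoneOn_of_deriv_nonpos (convex_Icc s t) (hcont 1 _)
      (fun v _ => (hder _ v).differentiableAt.differentiableWithinAt) (fun v hv => by
        rw [(hder _ v).deriv]
        rw [interior_Icc] at hv
        have := hK.deriv_sub hs.1 hv.1.le (hv.2.le.trans ht.2)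
        linarith) ⟨le_rfl, hst⟩ ⟨hst, le_rfl⟩ hst
    simp only [sub_self] at h1 h2
    constructor <;> linarith
  · have h1 := antitoneOn_of_deriv_nonpos (convex_Icc t s) (hcont (1 / 4) _)
      (fun v _ => (hder _ v).differentiableAt.differentiableWithinAt) (fun v hv => by
        rw [(hder _ v).deriv]
        rw [interior_Icc] at hv
        have := hK.deriv_sub (ht.1.trans hv.1.le) hv.2.le hs.2
        linarith) ⟨le_rfl, hst⟩ ⟨hst, le_rfl⟩ hst
    have h2 := monotoneOn_of_deriv_nonneg (convex_Icc t s) (hcont 1 _)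
      (fun v _ => (hder _ v).differentiableAt.differentiableWithinAt) (fun v hv => by
        rw [(hder _ v).deriv]
        rw [interior_Icc] at hv
        have := hK.deriv_sub (ht.1.trans hv.1.le) hv.2.le hs.2
        linarith) ⟨le_rfl, hst⟩ ⟨hst, le_rfl⟩ hst
    simp only [sub_self] at h1 h2
    constructor <;> linarith

theorem bounds (hK : IsNearSquare K δ) {s : ℝ} (hs : s ∈ Icc 0 δ) :
    s ^ 2 / 4 ≤ K s ∧ K s ≤ s ^ 2 := by
  have := hK.tangent ⟨le_rfl, hK.δ_pos.le⟩ hs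
  simpa [hK.zero, hK.deriv_zero] using this

/-- The Legendre cost is the gap at `0` between `K` and its tangent at `s`. -/
theorem legendre_bounds (hK : IsNearSquare K δ) {s : ℝ} (hs : s ∈ Icc 0 δ) :
    s ^ 2 / 4 ≤ s * deriv K s - K s ∧ s * deriv K s - K s ≤ s ^ 2 := by
  have := hK.tangent hs ⟨le_rfl, hK.δ_pos.le⟩
  rw [hK.zero] at this
  constructor <;> nlinarith [this.1, this.2]

end IsNearSquare

theorem IsNearSquare.of_contDiff {K : ℝ → ℝ} (h : ContDiff ℝ 2 K) (h0 : K 0 = 0)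
    (h1 : deriv K 0 = 0) (h2 : deriv (deriv K) 0 = 1) : ∃ δ, IsNearSquare K δ := by
  have hc1 : ContDiff ℝ 1 (deriv K) :=
    ((contDiff_succ_iff_deriv (n := 1)).1 (by simpa [one_add_one_eq_two] using h)).2.2
  have hc2 : Continuous (deriv (deriv K)) := hc1.continuous_deriv le_rfl
  have hev : ∀ᶠ s in 𝓝 (0 : ℝ), deriv (deriv K) s ∈ Ioo (1 / 2 : ℝ) 2 :=
    hc2.continuousAt.eventually (Ioo_mem_nhds (by rw [h2]; norm_num) (by rw [h2]; norm_num))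
  obtain ⟨e, he, hball⟩ := Metric.eventually_nhds_iff.1 hev
  refine ⟨min (e / 2) 1, by positivity, min_le_right _ _, h, h0, h1, fun s hs => ?_⟩
  have := hball (y := s) (by
    rw [Real.dist_eq, sub_zero, abs_of_nonneg hs.1]
    linarith [hs.2, min_le_left (e / 2) 1])
  exact ⟨this.1.le, this.2.le⟩

/-! ### Cumulants and the logarithm of the moment polynomial -/

/-- Moments through cumulants. -/
theorem moment_eq_sum_cumulant {M : ℕ → ℝ} (hM0 : M 0 = 1) (d : ℕ) :
    M (d + 1) = ∑ q ∈ Finset.range (d + 1), (d.choose q : ℝ) * cumulant M (d + 1 - q) * M q := by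
  rw [Finset.sum_range_succ', Finset.sum_range]
  simp only [Nat.choose_zero_right, Nat.cast_one, Nat.sub_zero, hM0, one_mul, mul_one,
    Nat.add_sub_add_right]
  rw [show cumulant M (d + 1) = M (d + 1) -
      ∑ i : Fin d, (d.choose (i + 1) : ℝ) * cumulant M (d - i) * M (i + 1) from by rw [cumulant]]
  ring

/-- The polynomial with coefficients `u k / k!`, `k ≤ κ`. -/
noncomputable def egfPoly (u : ℕ → ℝ) (κ : ℕ) : Polynomial ℝ :=
  ∑ j ∈ Finset.range (κ + 1), Polynomial.monomial j (u j / j.factorial)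

theorem egfPoly_coeff (u : ℕ → ℝ) (κ j : ℕ) :
    (egfPoly u κ).coeff j = if j ≤ κ then u j / j.factorial else 0 := by
  simp [egfPoly, Polynomial.coeff_monomial]

theorem egfPoly_eval (u : ℕ → ℝ) (κ : ℕ) (s : ℝ) :
    (egfPoly u κ).eval s = ∑ j ∈ Finset.range (κ + 1), u j / j.factorial * s ^ j := by
  simp [egfPoly, Polynomial.eval_finsetSum]

/-- The cumulant recursion is the coefficientwise form of `P' = K' P` for the exponential generating
series. Truncation at degree `κ` spoils only coefficients of degree `κ` and above. -/
theorem X_pow_dvd_derivative_egfPoly {M : ℕ → ℝ} (hM0 : M 0 = 1) (κ : ℕ) :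
    Polynomial.X ^ κ ∣ (egfPoly M κ).derivative
      - (egfPoly (cumulant M) κ).derivative * egfPoly M κ := by
  rw [Polynomial.X_pow_dvd_iff]
  intro d hd
  rw [Polynomial.coeff_sub, Polynomial.coeff_mul, Polynomial.coeff_derivative, egfPoly_coeff,
    if_pos (by omega), Finset.Nat.sum_antidiagonal_eq_sum_range_succ_mk, moment_eq_sum_cumulant hM0,
    ← Finset.sum_range_reflect, Finset.sum_div, Finset.sum_mul, ← Finset.sum_sub_distrib]
  refine Finset.sum_eq_zero fun q hq => ?_
  have hq' : q ≤ d := by simpa [Nat.lt_succ_iff] using hq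
  rw [Polynomial.coeff_derivative, egfPoly_coeff, egfPoly_coeff, if_pos (by omega),
    if_pos (by omega)]
  have e1 : d + 1 - 1 - q = d - q := by omega
  have e2 : d + 1 - (d - q) = q + 1 := by omega
  simp only [e1, e2]
  rw [Nat.cast_choose ℝ (Nat.sub_le d q), show d - (d - q) = q by omega, Nat.factorial_succ d,
    Nat.factorial_succ q]
  have := Nat.factorial_ne_zero d
  have := Nat.factorial_ne_zero q
  have := Nat.factorial_ne_zero (d - q)
  push_cast
  field_simp
  ring

/-- The derivative of `exp (-K) P` is `exp (-K) (P' - K' P)`, which is `O(s ^ κ)` by the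
divisibility above. So `P` agrees with `exp K` up to `O(s ^ κ)`, and the top term of `P` is of that
order as well. -/
theorem exp_cumulant_sub_moments {M : ℕ → ℝ} (hM0 : M 0 = 1) (κ : ℕ) :
    ∃ C : ℝ, 0 ≤ C ∧ ∀ s ∈ Icc (0 : ℝ) 1,
      |Real.exp ((egfPoly (cumulant M) κ).eval s)
        - ∑ k ∈ Finset.range κ, M k / k.factorial * s ^ k| ≤ C * s ^ κ := by
  set P := egfPoly M κ with hP
  set K := egfPoly (cumulant M) κ with hKdef
  obtain ⟨G, hG⟩ := X_pow_dvd_derivative_egfPoly hM0 κ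
  have hK0 : K.eval 0 = 0 := by
    rw [← Polynomial.coeff_zero_eq_eval_zero, hKdef, egfPoly_coeff]; simp [cumulant]
  have hP0 : P.eval 0 = 1 := by
    rw [← Polynomial.coeff_zero_eq_eval_zero, hP, egfPoly_coeff]; simp [hM0]
  have hder : ∀ s : ℝ, HasDerivAt (fun s => Real.exp (-K.eval s) * P.eval s)
      (Real.exp (-K.eval s) * G.eval s * s ^ κ) s := by
    intro s
    have h1 := ((K.hasDerivAt s).neg.exp).mul (P.hasDerivAt s)
    refine h1.congr_deriv ?_
    have h2 := congrArg (Polynomial.eval s) hG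
    simp only [Polynomial.eval_sub, Polynomial.eval_mul, Polynomial.eval_pow,
      Polynomial.eval_X] at h2
    rw [mul_assoc (Real.exp _) (G.eval s), mul_comm (G.eval s), ← h2]
    simp only [Pi.neg_apply]
    ring
  obtain ⟨B, hB⟩ := (isCompact_Icc (a := (0 : ℝ)) (b := 1)).exists_bound_of_continuousOn
    (f := fun s => Real.exp (-K.eval s) * G.eval s) (by fun_prop)
  obtain ⟨B', hB'⟩ := (isCompact_Icc (a := (0 : ℝ)) (b := 1)).exists_bound_of_continuousOn
    (f := fun s => Real.exp (K.eval s)) (by fun_prop)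
  have hB0 : 0 ≤ B := (norm_nonneg _).trans (hB 0 (by simp))
  have hB0' : 0 ≤ B' := (norm_nonneg _).trans (hB' 0 (by simp))
  refine ⟨B' * B + |M κ / κ.factorial|, by positivity, fun s hs => ?_⟩
  have h3 := (convex_Icc 0 s).norm_image_sub_le_of_norm_hasDerivWithin_le
    (f := fun s => Real.exp (-K.eval s) * P.eval s) (C := B * s ^ κ)
    (fun v _ => (hder v).hasDerivWithinAt) (fun v hv => by
      rw [norm_mul, norm_pow, Real.norm_of_nonneg hv.1]
      have := hv.1
      gcongr
      · exact hB v ⟨hv.1, hv.2.trans hs.2⟩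
      · exact hv.2) ⟨le_rfl, hs.1⟩ ⟨hs.1, le_rfl⟩
  simp only [hK0, hP0, neg_zero, Real.exp_zero, mul_one, sub_zero] at h3
  rw [Real.norm_of_nonneg hs.1, Real.norm_eq_abs] at h3
  have h4 : B * s ^ κ * s ≤ B * s ^ κ :=
    mul_le_of_le_one_right (mul_nonneg hB0 (pow_nonneg hs.1 _)) hs.2
  have h5 : P.eval s = ∑ k ∈ Finset.range κ, M k / k.factorial * s ^ k
      + M κ / κ.factorial * s ^ κ := by
    rw [hP, egfPoly_eval, Finset.sum_range_succ]
  have h6 : Real.exp (K.eval s) - P.eval s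
      = - (Real.exp (K.eval s) * (Real.exp (-K.eval s) * P.eval s - 1)) := by
    rw [mul_sub, ← mul_assoc, ← Real.exp_add]; simp
  have h7 : |Real.exp (K.eval s) - P.eval s| ≤ B' * (B * s ^ κ) := by
    rw [h6, abs_neg, abs_mul]
    have := hB' s hs
    rw [Real.norm_eq_abs] at this
    gcongr
    exact h3.trans h4
  calc _ = |(Real.exp (K.eval s) - P.eval s) + M κ / κ.factorial * s ^ κ| := by congr 1; rw [h5]; ring
    _ ≤ _ := (abs_add_le _ _).trans (by
      rw [abs_mul (M κ / _), abs_of_nonneg (pow_nonneg hs.1 κ)]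
      linarith)

theorem egfPoly_cumulant_isNearSquare {M : ℕ → ℝ} (hM1 : M 1 = 0) (hM2 : M 2 = 1) {κ : ℕ}
    (hκ : 2 ≤ κ) : ∃ δ, IsNearSquare (fun s => (egfPoly (cumulant M) κ).eval s) δ := by
  have c1 : cumulant M 1 = 0 := by rw [cumulant]; simp [hM1]
  have c2 : cumulant M 2 = 1 := by rw [cumulant]; simp [hM2, hM1]
  have hd : ∀ p : Polynomial ℝ, deriv (fun s => p.eval s) = fun s => p.derivative.eval s :=
    fun p => funext fun s => p.deriv
  refine IsNearSquare.of_contDiff (by simpa using Polynomial.contDiff_aeval (R := ℝ) (𝕜 := ℝ) (egfPoly (cumulant M) κ) 2) ?_ ?_ ?_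
  · rw [← Polynomial.coeff_zero_eq_eval_zero, egfPoly_coeff]; simp [cumulant]
  · simp only [hd]
    rw [← Polynomial.coeff_zero_eq_eval_zero, Polynomial.coeff_derivative, egfPoly_coeff]
    simp [c1]
  · simp only [hd]
    rw [← Polynomial.coeff_zero_eq_eval_zero, Polynomial.coeff_derivative,
      Polynomial.coeff_derivative, egfPoly_coeff, if_pos (by omega)]
    simp [c2]
    norm_num

theorem truncatedCGF_eq {Ω : Type*} [MeasurableSpace Ω] (μ : Measure Ω) (X : Ω → ℝ) (r : ℝ)
    (hM1 : ∫ ω, X ω ^ 1 ∂μ = 0) :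
    truncatedCGF μ X r
      = fun s => (egfPoly (cumulant fun i => ∫ ω, X ω ^ i ∂μ) (truncationOrder r)).eval s := by
  have c1 : cumulant (fun i => ∫ ω, X ω ^ i ∂μ) 1 = 0 := by rw [cumulant]; simpa using hM1
  ext s
  rw [egfPoly_eval, truncatedCGF]
  refine Finset.sum_subset (fun j hj => ?_) (fun j hj hj' => ?_)
  · simp only [Finset.mem_Icc] at hj
    simp; omega
  · simp only [Finset.mem_Icc, not_and, not_le] at hj'
    simp only [Finset.mem_range] at hj
    have : j = 0 ∨ j = 1 := by
      by_contra hcon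
      have := hj' (by omega)
      omega
    rcases this with rfl | rfl
    · simp [cumulant]
    · simp [c1]

/-- The second bound says that `θ ^ κ` is smaller than `1 / x` by a power of `x` when `θ` is of
order `x ^ (r - 1)`, the order of the tilts used below. -/
theorem truncationOrder_spec {r : ℝ} (h0 : 0 < r) (h1 : r < 1) :
    2 ≤ truncationOrder r ∧ 1 < truncationOrder r * (1 - r) := by
  have h : 0 < 1 - r := by linarith
  constructor
  · refine Nat.le_floor ?_
    rw [le_div_iff₀ h]; push_cast; linarith
  · have := Nat.lt_floor_add_one ((2 - r) / (1 - r))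
    rw [div_lt_iff₀ h] at this
    change 1 < (⌊(2 - r) / (1 - r)⌋₊ : ℝ) * (1 - r)
    linarith

/-! ### Comparison of powers, and the growth of `R` and its derivatives -/

theorem eventually_const_le_rpow (c : ℝ) {ε : ℝ} (hε : 0 < ε) : ∀ᶠ x : ℝ in atTop, c ≤ x ^ ε :=
  (tendsto_rpow_atTop hε).eventually_ge_atTop c

theorem eventually_const_mul_rpow_le (c : ℝ) {p q : ℝ} (h : p < q) :
    ∀ᶠ x : ℝ in atTop, c * x ^ p ≤ x ^ q := by
  filter_upwards [eventually_const_le_rpow c (sub_pos.2 h), eventually_gt_atTop 0] with x hx hx0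
  calc c * x ^ p ≤ x ^ (q - p) * x ^ p := by gcongr
    _ = x ^ q := by rw [← Real.rpow_add hx0]; ring_nf

theorem eventually_rpow_mul_exp_neg_le (p : ℝ) {c ε δ : ℝ} (hc : 0 < c) (hε : 0 < ε)
    (hδ : 0 < δ) : ∀ᶠ x : ℝ in atTop, x ^ p * Real.exp (-c * x ^ ε) ≤ δ := by
  have h1 := (tendsto_rpow_mul_exp_neg_mul_atTop_nhds_zero (p / ε) c hc).comp
    (tendsto_rpow_atTop hε)
  filter_upwards [h1.eventually (ge_mem_nhds hδ), eventually_ge_atTop 0] with x hx hx0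
  simpa [← Real.rpow_mul hx0, mul_div_cancel₀ p hε.ne'] using hx

theorem rpow_bounds_of_mem_Icc (p : ℝ) {ε : ℝ} (hε : 0 < ε) :
    ∀ᶠ x : ℝ in atTop, ∀ u ∈ Icc (x / 2) (2 * x), u ^ p ≤ x ^ (p + ε) ∧ x ^ (p - ε) ≤ u ^ p := by
  filter_upwards [eventually_const_le_rpow (2 ^ |p|) hε, eventually_gt_atTop 0] with x hx hx0 u hu
  have hu0 : 0 < u := lt_of_lt_of_le (by positivity) hu.1
  have h2 : (2 : ℝ) ^ |p| * 2 ^ (-|p|) = 1 := by rw [← Real.rpow_add two_pos]; simp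
  have h3 : 0 < (2 : ℝ) ^ |p| := by positivity
  have key : (u / x) ^ p ≤ 2 ^ |p| ∧ (2 : ℝ) ^ (-|p|) ≤ (u / x) ^ p := by
    have hl : (2 : ℝ)⁻¹ ≤ u / x := by rw [le_div_iff₀ hx0]; linarith [hu.1]
    have hr : u / x ≤ 2 := by rw [div_le_iff₀ hx0]; exact hu.2
    have hux : 0 < u / x := by positivity
    have e1 : (2 : ℝ)⁻¹ ^ p = 2 ^ (-p) := by rw [Real.inv_rpow two_pos.le, Real.rpow_neg two_pos.le]
    rcases le_total 0 p with hp | hp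
    · rw [abs_of_nonneg hp]
      refine ⟨Real.rpow_le_rpow hux.le hr hp, ?_⟩
      rw [← e1]
      exact Real.rpow_le_rpow (by positivity) hl hp
    · rw [abs_of_nonpos hp, neg_neg]
      refine ⟨?_, Real.rpow_le_rpow_of_nonpos hux hr hp⟩
      rw [← e1]
      exact Real.rpow_le_rpow_of_nonpos (by positivity) hl hp
  have e : u ^ p = (u / x) ^ p * x ^ p := by
    rw [← Real.mul_rpow (by positivity) hx0.le, div_mul_cancel₀ _ hx0.ne']
  have hxp : 0 < x ^ p := by positivity
  rw [e, Real.rpow_add hx0, Real.rpow_sub hx0]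
  constructor
  · rw [mul_comm (x ^ p)]
    exact mul_le_mul_of_nonneg_right (key.1.trans hx) hxp.le
  · rw [div_le_iff₀ (by positivity)]
    have : 1 ≤ 2 ^ (-|p|) * x ^ ε := by
      rw [← h2, mul_comm]; gcongr
    calc x ^ p = 1 * x ^ p := (one_mul _).symm
      _ ≤ ((u / x) ^ p * x ^ ε) * x ^ p := by
        gcongr
        exact this.trans (by gcongr; exact key.2)
      _ = _ := by ring

namespace HasStretchedExpTail

variable {Ω : Type*} [MeasurableSpace Ω] {μ : Measure Ω} {X : Ω → ℝ} {r x₀ a : ℝ} {α R : ℝ → ℝ}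

theorem map [IsProbabilityMeasure μ] (h : HasStretchedExpTail μ X r x₀ a α R)
    (hX : AEMeasurable X μ) : HasStretchedExpTail (μ.map X) id r x₀ a α R where
  r_pos := h.r_pos
  r_lt_one := h.r_lt_one
  x₀_pos := h.x₀_pos
  a_pos := h.a_pos
  α_nonneg := h.α_nonneg
  R_nonneg := h.R_nonneg
  integrable_pow := fun k hk => by
    rw [integrable_map_measure (by fun_prop) hX]
    exact h.integrable_pow k hk
  mean_eq := by
    rw [integral_map hX (by fun_prop)]; exact h.mean_eq
  second_moment_eq := by
    rw [integral_map hX (by fun_prop)]; exact h.second_moment_eq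
  tail_eq := fun x hx => by
    rw [← h.tail_eq x hx]
    change (μ.map X).real (Ioi x) = _
    rw [map_measureReal_apply_of_aemeasurable hX measurableSet_Ioi]
    rfl
  α_tendsto := h.α_tendsto
  contDiffOn := h.contDiffOn
  deriv_regularlyVarying := h.deriv_regularlyVarying
  deriv2_isBigO := h.deriv2_isBigO
  eventually_antitone := h.eventually_antitone
  eventually_monotone := h.eventually_monotone

theorem contDiffAt (h : HasStretchedExpTail μ X r x₀ a α R) {x : ℝ} (hx : x₀ < x) :
    ContDiffAt ℝ 2 R x :=
  h.contDiffOn.contDiffAt (Ioi_mem_nhds hx)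

theorem hasDerivAt (h : HasStretchedExpTail μ X r x₀ a α R) {x : ℝ} (hx : x₀ < x) :
    HasDerivAt R (deriv R x) x :=
  ((h.contDiffAt hx).differentiableAt (by norm_num)).hasDerivAt

theorem hasDerivAt_deriv (h : HasStretchedExpTail μ X r x₀ a α R) {x : ℝ} (hx : x₀ < x) :
    HasDerivAt (deriv R) (deriv (deriv R) x) x := by
  have h1 : ContDiffOn ℝ 1 (deriv R) (Ioi x₀) :=
    ((contDiffOn_succ_iff_deriv_of_isOpen (n := 1) isOpen_Ioi).1
      (by simpa [one_add_one_eq_two] using h.contDiffOn)).2.2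
  exact ((h1.contDiffAt (Ioi_mem_nhds hx)).differentiableAt (by norm_num)).hasDerivAt

theorem deriv_bounds (h : HasStretchedExpTail μ X r x₀ a α R) {ε : ℝ} (hε : 0 < ε) :
    ∀ᶠ x in atTop, ∀ u ∈ Icc (x / 2) (2 * x),
      x ^ (r - 1 - ε) ≤ deriv R u ∧ deriv R u ≤ x ^ (r - 1 + ε) := by
  obtain ⟨A, hA⟩ := eventually_atTop.1 (h.deriv_regularlyVarying.rpow_bounds (half_pos hε))
  filter_upwards [rpow_bounds_of_mem_Icc (r - 1 - ε / 2) (half_pos hε),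
    rpow_bounds_of_mem_Icc (r - 1 + ε / 2) (half_pos hε), eventually_ge_atTop (2 * A)]
    with x h1 h2 hx u hu
  have h3 := hA u (by linarith [hu.1])
  have h4 := (h1 u hu).2
  have h5 := (h2 u hu).1
  rw [show r - 1 - ε / 2 - ε / 2 = r - 1 - ε by ring] at h4
  rw [show r - 1 + ε / 2 + ε / 2 = r - 1 + ε by ring] at h5
  exact ⟨h4.trans h3.1, h3.2.trans h5⟩

theorem deriv2_bounds (h : HasStretchedExpTail μ X r x₀ a α R) {ε : ℝ} (hε : 0 < ε) :
    ∀ᶠ x in atTop, ∀ u ∈ Icc (x / 2) (2 * x), |deriv (deriv R) u| ≤ x ^ (r - 2 + ε) := by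
  obtain ⟨c, hc⟩ := (h.deriv2_isBigO (ε / 3) (by positivity)).bound
  obtain ⟨A, hA⟩ := eventually_atTop.1 hc
  filter_upwards [rpow_bounds_of_mem_Icc (r - 2 + ε / 3) (ε := ε / 3) (by positivity),
    eventually_ge_atTop (2 * A), eventually_gt_atTop 0,
    eventually_const_mul_rpow_le |c| (p := r - 2 + ε / 3 + ε / 3) (q := r - 2 + ε) (by linarith)]
    with x h1 hx hx0 h2 u hu
  have hu0 : 0 < u := lt_of_lt_of_le (by positivity) hu.1
  have h3 := hA u (by linarith [hu.1])
  rw [Real.norm_eq_abs, Real.norm_of_nonneg (by positivity)] at h3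
  calc |deriv (deriv R) u| ≤ c * u ^ (r - 2 + ε / 3) := h3
    _ ≤ |c| * u ^ (r - 2 + ε / 3) := by gcongr; exact le_abs_self c
    _ ≤ |c| * x ^ (r - 2 + ε / 3 + ε / 3) := by gcongr; exact (h1 u hu).1
    _ ≤ _ := h2

/-- Both bounds integrate those of `deriv R`. For the lower one the growth over `[x / 2, x]`
suffices, as `R (x / 2) ≥ 0`; for the upper one `x ^ (r + ε / 2) / (r + ε / 2) - R x` is
nondecreasing from some point on. -/
theorem rpow_bounds (h : HasStretchedExpTail μ X r x₀ a α R) {ε : ℝ} (hε : 0 < ε) :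
    ∀ᶠ x in atTop, x ^ (r - ε) ≤ R x ∧ R x ≤ x ^ (r + ε) := by
  have hlow : ∀ᶠ x in atTop, x ^ (r - ε) ≤ R x := by
    filter_upwards [h.deriv_bounds (half_pos hε), eventually_gt_atTop (2 * x₀),
      eventually_gt_atTop 0, eventually_const_mul_rpow_le 2 (p := r - ε) (q := r - ε / 2)
        (by linarith)] with x h1 hx hx0 h2
    have hc : ∀ u ∈ Icc (x / 2) x, HasDerivAt R (deriv R u) u := fun u hu =>
      h.hasDerivAt (by linarith [hu.1])
    have h3 := (convex_Icc (x / 2) x).mul_sub_le_image_sub_of_le_deriv (f := R)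
      (fun u hu => (hc u hu).continuousAt.continuousWithinAt)
      (fun u hu => (hc u (interior_subset hu)).differentiableAt.differentiableWithinAt)
      (C := x ^ (r - 1 - ε / 2))
      (fun u hu => (h1 u ⟨(interior_subset hu).1, by linarith [(interior_subset hu).2]⟩).1)
      (x / 2) ⟨le_rfl, by linarith⟩ x ⟨by linarith, le_rfl⟩ (by linarith)
    have h4 := h.R_nonneg (x / 2) (by linarith)
    have h5 : x ^ (r - ε / 2) = x ^ (r - 1 - ε / 2) * x := by
      rw [← Real.rpow_add_one hx0.ne']; ring_nf
    rw [h5] at h2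
    linarith
  have hup : ∀ᶠ x in atTop, R x ≤ x ^ (r + ε) := by
    obtain ⟨A, hA⟩ := eventually_atTop.1
      ((h.deriv_regularlyVarying.rpow_bounds (half_pos hε)).and
        ((eventually_gt_atTop x₀).and (eventually_gt_atTop 0)))
    have hp : 0 < r + ε / 2 := by linarith [h.r_pos]
    have hder : ∀ x ∈ Ici A, HasDerivAt (fun x => x ^ (r + ε / 2) / (r + ε / 2) - R x)
        (x ^ (r - 1 + ε / 2) - deriv R x) x := by
      intro x hx
      have h1 := ((Real.hasDerivAt_rpow_const (x := x) (p := r + ε / 2)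
        (Or.inl (hA x hx).2.2.ne')).div_const (r + ε / 2)).sub (h.hasDerivAt (hA x hx).2.1)
      refine h1.congr_deriv ?_
      rw [mul_comm, mul_div_assoc, div_self hp.ne', mul_one]
      ring_nf
    have hmono := monotoneOn_of_deriv_nonneg (convex_Ici A)
      (fun x hx => (hder x hx).continuousAt.continuousWithinAt)
      (fun x hx => (hder x (interior_subset hx)).differentiableAt.differentiableWithinAt)
      (fun x hx => by
        rw [(hder x (interior_subset hx)).deriv]
        linarith [(hA x (interior_subset hx)).1.2])
    filter_upwards [eventually_ge_atTop A, eventually_gt_atTop 0,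
      eventually_const_le_rpow (2 * |R A|) (ε := r + ε) (by linarith [h.r_pos]),
      eventually_const_mul_rpow_le (2 / (r + ε / 2)) (p := r + ε / 2) (q := r + ε) (by linarith)]
      with x hx hx0 h2 h3
    have h4 := hmono (mem_Ici.2 le_rfl) (mem_Ici.2 hx) hx
    simp only at h4
    have h5 : 0 ≤ A ^ (r + ε / 2) / (r + ε / 2) := by
      have := (hA A le_rfl).2.2
      positivity
    have h6 := le_abs_self (R A)
    have h7 : 2 / (r + ε / 2) * x ^ (r + ε / 2) = 2 * (x ^ (r + ε / 2) / (r + ε / 2)) := by ring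
    rw [h7] at h3
    linarith
  exact hlow.and hup

/-- Concavity-like comparisons of the values of `R`, valid beyond some point. -/
theorem exists_comparison (h : HasStretchedExpTail μ X r x₀ a α R) :
    ∃ b ∈ Ioo (0 : ℝ) 1, ∃ A, x₀ < A ∧ 1 ≤ A ∧
      (∀ u, A ≤ u → 0 < R u ∧ 0 < deriv R u ∧ deriv R u ≤ R u / u) ∧
      StrictMonoOn R (Ici A) ∧
      ∀ u x, A ≤ u → u ≤ x → (u / x) ^ b * R x ≤ R u := by
  obtain ⟨b, hb, A₁, hA₁⟩ := h.eventually_antitone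
  obtain ⟨A₂, hA₂⟩ := eventually_atTop.1 (h.deriv_regularlyVarying.2.1.and
    (h.rpow_bounds (ε := 1) one_pos))
  set A := max (max (A₁ + 1) A₂) (max (x₀ + 1) 1) with hA
  have hx₀ : x₀ < A := lt_of_lt_of_le (lt_add_one x₀) (by simp [hA])
  have h1A : 1 ≤ A := by simp [hA]
  have hA1 : A₁ < A := lt_of_lt_of_le (lt_add_one _) (by simp [hA])
  have hA2 : A₂ ≤ A := by simp [hA]
  have hcmp : ∀ u x, A₁ ≤ u → 0 < u → u ≤ x → (u / x) ^ b * R x ≤ R u := by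
    intro u x hu hu0 hux
    have h1 := hA₁ hu (hu.trans hux) hux
    simp only at h1
    have hx0 : 0 < x := hu0.trans_le hux
    rw [Real.div_rpow hu0.le hx0.le]
    rw [Real.rpow_neg hu0.le, Real.rpow_neg hx0.le] at h1
    have := mul_le_mul_of_nonneg_right h1 (Real.rpow_nonneg hu0.le b)
    rw [mul_assoc (R u), inv_mul_cancel₀ (by positivity), mul_one] at this
    calc _ = R x * (x ^ b)⁻¹ * u ^ b := by ring
      _ ≤ _ := this
  have hpos : ∀ u, A ≤ u → 0 < R u := fun u hu =>
    lt_of_lt_of_le (Real.rpow_pos_of_pos (by linarith) _) (hA₂ u (hA2.trans hu)).2.1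
  refine ⟨b, hb, A, hx₀, h1A, fun u hu => ⟨hpos u hu, (hA₂ u (hA2.trans hu)).1, ?_⟩, ?_, ?_⟩
  · have hu0 : 0 < u := by linarith
    have hR := h.hasDerivAt (hx₀.trans_le hu)
    -- the difference quotient on the right is at most `R u / u`
    have ht := hR.hasDerivWithinAt (s := Ioi u)
    rw [hasDerivWithinAt_iff_tendsto_slope' (by simp)] at ht
    refine le_of_tendsto ht ?_
    filter_upwards [self_mem_nhdsWithin] with v hv
    have hv' : u < v := hv
    have hv0 : 0 < v := hu0.trans hv'
    have h1 := hcmp u v (hA1.le.trans hu) hu0 hv'.le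
    have h2 : u / v ≤ (u / v) ^ b := by
      have := Real.rpow_le_rpow_of_exponent_ge (x := u / v) (by positivity)
        ((div_le_one hv0).2 hv'.le) hb.2.le
      simpa using this
    have h3 : u / v * R v ≤ R u :=
      (mul_le_mul_of_nonneg_right h2 (hpos v (hu.trans hv'.le)).le).trans h1
    rw [slope_def_field, div_le_div_iff₀ (sub_pos.2 hv') hu0]
    rw [div_mul_eq_mul_div, div_le_iff₀ hv0] at h3
    linarith
  · refine strictMonoOn_of_deriv_pos (convex_Ici A) (fun u hu =>
      (h.hasDerivAt (hx₀.trans_le hu)).continuousAt.continuousWithinAt) fun u hu => ?_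
    exact (hA₂ u (hA2.trans (interior_subset hu))).1
  · intro u x hu hux
    exact hcmp u x (hA1.le.trans hu) (by linarith) hux

end HasStretchedExpTail

/-! ### The Laplace transform of the truncated law -/

/-- Taylor remainder of the exponential, with the growth of the exponential only on the right. -/
theorem abs_exp_sub_sum_le (n : ℕ) (u : ℝ) :
    |Real.exp u - ∑ k ∈ Finset.range n, u ^ k / k.factorial| ≤ |u| ^ n * Real.exp (max u 0) := by
  induction n generalizing u with
  | zero => simp
  | succ n ih =>
    have hder : ∀ v : ℝ, HasDerivAt
        (fun v => Real.exp v - ∑ k ∈ Finset.range (n + 1), v ^ k / k.factorial)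
        (Real.exp v - ∑ k ∈ Finset.range n, v ^ k / k.factorial) v := by
      intro v
      refine (Real.hasDerivAt_exp v).sub ?_
      have h1 : HasDerivAt (fun v : ℝ => ∑ k ∈ Finset.range (n + 1), v ^ k / (k.factorial : ℝ))
          (∑ k ∈ Finset.range (n + 1), (k * v ^ (k - 1)) / (k.factorial : ℝ)) v :=
        HasDerivAt.fun_sum fun k _ => (hasDerivAt_pow k v).div_const _
      refine h1.congr_deriv ?_
      rw [Finset.sum_range_succ']
      simp only [Nat.cast_zero, zero_mul, zero_div, add_zero, Nat.add_sub_cancel]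
      refine Finset.sum_congr rfl fun k _ => ?_
      rw [Nat.factorial_succ]
      have := Nat.factorial_ne_zero k
      push_cast
      field_simp
    have hbound : ∀ v ∈ uIcc 0 u,
        ‖Real.exp v - ∑ k ∈ Finset.range n, v ^ k / k.factorial‖
          ≤ |u| ^ n * Real.exp (max u 0) := by
      intro v hv
      refine (ih v).trans ?_
      have h1 : |v| ≤ |u| := by simpa using abs_sub_left_of_mem_uIcc hv
      have h2 : max v 0 ≤ max u 0 := by
        rcases le_total 0 u with hu | hu
        · rw [uIcc_of_le hu] at hv
          exact max_le_max_right _ hv.2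
        · rw [uIcc_of_ge hu] at hv
          simp [hv.2]
      gcongr
    have := (convex_uIcc 0 u).norm_image_sub_le_of_norm_hasDerivWithin_le
      (fun v _ => (hder v).hasDerivWithinAt) hbound left_mem_uIcc right_mem_uIcc
    simp only [Real.norm_eq_abs, sub_zero, Real.exp_zero] at this
    rw [Finset.sum_range_succ' (fun k => (0 : ℝ) ^ k / (k.factorial : ℝ))] at this
    simp only [ne_eq, Nat.add_eq_zero_iff, one_ne_zero, and_false, not_false_eq_true, zero_pow,
      zero_div, Finset.sum_const_zero, pow_zero, Nat.factorial_zero, Nat.cast_one, div_one,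
      zero_add, sub_self, sub_zero] at this
    rw [pow_succ]
    linarith

theorem measurable_indicator_Ioi_of_continuousOn {f : ℝ → ℝ} {A : ℝ}
    (hf : ContinuousOn f (Ioi A)) : Measurable ((Ioi A).indicator f) := by
  classical
  rw [← piecewise_eq_indicator]
  exact hf.measurable_piecewise continuousOn_const measurableSet_Ioi

namespace HasStretchedExpTail

variable {ν : Measure ℝ} {r x₀ a : ℝ} {α R : ℝ → ℝ}

theorem tail_real (h : HasStretchedExpTail ν id r x₀ a α R) {x : ℝ} (hx : x₀ < x) :
    ν.real (Ioi x) = α x * Real.exp (-R x) := h.tail_eq x hx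

theorem continuousOn {Ω : Type*} [MeasurableSpace Ω] {μ : Measure Ω} {X : Ω → ℝ}
    (h : HasStretchedExpTail μ X r x₀ a α R) {A : ℝ} (hA : x₀ < A) : ContinuousOn R (Ioi A) :=
  fun _ ht => (h.hasDerivAt (hA.trans ht)).continuousAt.continuousWithinAt

theorem R_tendsto {Ω : Type*} [MeasurableSpace Ω] {μ : Measure Ω} {X : Ω → ℝ}
    (h : HasStretchedExpTail μ X r x₀ a α R) : Tendsto R atTop atTop := by
  refine tendsto_atTop_mono' _ ?_ (tendsto_rpow_atTop (half_pos h.r_pos))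
  filter_upwards [h.rpow_bounds (half_pos h.r_pos)] with x hx
  refine le_trans (le_of_eq ?_) hx.1
  ring_nf

/-- The variable `R X` has an exponential tail: the event `v < R X` is `c < X` with `R c = v`, whose
probability is `α c * exp (-v)`. Small `v` are absorbed in the constant. -/
theorem exists_measure_R_gt_le [IsProbabilityMeasure ν]
    (h : HasStretchedExpTail ν id r x₀ a α R) {A : ℝ} (hA : x₀ < A)
    (hmono : StrictMonoOn R (Ici A)) :
    ∃ C : ℝ, 0 ≤ C ∧ ∀ v : ℝ, ν.real {t | A < t ∧ v < R t} ≤ C * Real.exp (-v) := by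
  obtain ⟨B, hB⟩ := eventually_atTop.1
    (h.α_tendsto.eventually (gt_mem_nhds (show a < 2 * a by linarith [h.a_pos])))
  set A' := max A B with hA'
  refine ⟨max (2 * a) (Real.exp (R A')), by positivity, fun v => ?_⟩
  rcases lt_or_ge v (R A') with hv | hv
  · calc ν.real {t | A < t ∧ v < R t} ≤ 1 := measureReal_le_one
      _ ≤ Real.exp (R A') * Real.exp (-v) := by
        rw [← Real.exp_add]; exact Real.one_le_exp (by linarith)
      _ ≤ _ := by gcongr; exact le_max_right _ _
  · obtain ⟨D, hD1, hD2⟩ := ((h.R_tendsto.eventually_ge_atTop v).and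
      (eventually_ge_atTop A')).exists
    have hcont : ContinuousOn R (Icc A' D) := fun t ht =>
      (h.hasDerivAt (hA.trans_le ((le_max_left A B).trans ht.1))).continuousAt.continuousWithinAt
    obtain ⟨c, hc, hcv⟩ := intermediate_value_Icc hD2 hcont ⟨hv, hD1⟩
    have hcA : A ≤ c := (le_max_left A B).trans hc.1
    have hsub : {t | A < t ∧ v < R t} ⊆ Ioi c := by
      rintro t ⟨h1, h2⟩
      rw [← hcv] at h2
      exact (hmono.lt_iff_lt hcA h1.le).1 h2
    calc ν.real {t | A < t ∧ v < R t} ≤ ν.real (Ioi c) := measureReal_mono hsub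
      _ = α c * Real.exp (-v) := by rw [h.tail_real (hA.trans_le hcA), hcv]
      _ ≤ _ := by
        gcongr
        exact (hB c ((le_max_right A B).trans hc.1)).le.trans (le_max_left _ _)

/-- By the preceding bound `exp (ϑ R X)` has tail `O(t ^ (-1 / ϑ))`, which is integrable at infinity
because `1 / ϑ > 1`. -/
theorem integrable_exp_R [IsProbabilityMeasure ν]
    (h : HasStretchedExpTail ν id r x₀ a α R) {A : ℝ} (hA : x₀ < A)
    (hmono : StrictMonoOn R (Ici A)) {ϑ : ℝ} (h0 : 0 < ϑ) (h1 : ϑ < 1) :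
    Integrable ((Ioi A).indicator fun t => Real.exp (ϑ * R t)) ν := by
  obtain ⟨C, hC0, hC⟩ := h.exists_measure_R_gt_le hA hmono
  have hm : Measurable ((Ioi A).indicator fun t => Real.exp (ϑ * R t)) :=
    measurable_indicator_Ioi_of_continuousOn (((h.continuousOn hA).const_mul ϑ).rexp)
  have hnn : ∀ t, 0 ≤ (Ioi A).indicator (fun t => Real.exp (ϑ * R t)) t := fun t =>
    indicator_nonneg (fun _ _ => (Real.exp_pos _).le) t
  refine ⟨hm.aestronglyMeasurable, ?_⟩
  rw [hasFiniteIntegral_iff_ofReal (ae_of_all _ hnn),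
    lintegral_eq_lintegral_meas_lt ν (ae_of_all _ hnn) hm.aemeasurable]
  have hsplit : Ioi (0 : ℝ) = Ioc 0 1 ∪ Ioi 1 := (Ioc_union_Ioi_eq_Ioi zero_le_one).symm
  rw [hsplit]
  refine (lintegral_union_le _ _ _).trans_lt (ENNReal.add_lt_top.2 ⟨?_, ?_⟩)
  · calc _ ≤ ∫⁻ _ in Ioc (0 : ℝ) 1, 1 := lintegral_mono fun _ => prob_le_one
      _ < ⊤ := by simp
  · have hint : IntegrableOn (fun t : ℝ => C * t ^ (-ϑ⁻¹)) (Ioi 1) :=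
      (integrableOn_Ioi_rpow_of_lt (by
        have : 1 < ϑ⁻¹ := (one_lt_inv₀ h0).2 h1
        linarith) one_pos).const_mul C
    refine lt_of_le_of_lt (setLIntegral_mono' measurableSet_Ioi fun t ht => ?_)
      hint.lintegral_lt_top
    have ht0 : (0 : ℝ) < t := one_pos.trans ht
    have hsub : {s | t < (Ioi A).indicator (fun t => Real.exp (ϑ * R t)) s}
        ⊆ {s | A < s ∧ Real.log t / ϑ < R s} := by
      intro s hs
      simp only [mem_ofPred_eq] at hs
      by_cases hsA : s ∈ Ioi A
      · rw [indicator_of_mem hsA] at hs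
        refine ⟨hsA, ?_⟩
        rw [div_lt_iff₀ h0, mul_comm, Real.log_lt_iff_lt_exp ht0]
        exact hs
      · rw [indicator_of_notMem hsA] at hs
        linarith
    calc ν {s | t < (Ioi A).indicator (fun t => Real.exp (ϑ * R t)) s}
        ≤ ν {s | A < s ∧ Real.log t / ϑ < R s} := measure_mono hsub
      _ = ENNReal.ofReal (ν.real {s | A < s ∧ Real.log t / ϑ < R s}) := by
        rw [measureReal_def, ENNReal.ofReal_toReal (measure_ne_top _ _)]
      _ ≤ ENNReal.ofReal (C * t ^ (-ϑ⁻¹)) := by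
        refine ENNReal.ofReal_le_ofReal ((hC _).trans (le_of_eq ?_))
        rw [Real.rpow_def_of_pos ht0]
        congr 2
        field_simp

/-- A majorant of the tilted tail with finite integral. -/
theorem integrable_pow_mul_exp_R [IsProbabilityMeasure ν]
    (h : HasStretchedExpTail ν id r x₀ a α R) {A : ℝ} (hA : x₀ < A) (hA1 : 1 ≤ A)
    (hmono : StrictMonoOn R (Ici A)) {ϑ : ℝ} (h0 : 0 < ϑ) (h1 : ϑ < 1) (k : ℕ) :
    Integrable ((Ioi A).indicator fun t => (1 + t) ^ k * Real.exp (ϑ * R t)) ν := by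
  -- A slightly larger exponent pays for the power of `t`, since `R` grows at least like `t ^ (r /
  -- 2)`.
  obtain ⟨ϑ', h2, h3⟩ := exists_between h1
  have hev : ∀ᶠ t in atTop, (1 + t) ^ k ≤ Real.exp ((ϑ' - ϑ) * R t) := by
    filter_upwards [eventually_rpow_mul_exp_neg_le k (sub_pos.2 h2) (half_pos h.r_pos)
      (δ := 2⁻¹ ^ k) (by positivity), eventually_ge_atTop 1,
      h.rpow_bounds (half_pos h.r_pos)] with t e1 e2 e3
    have e4 : Real.exp ((ϑ' - ϑ) * t ^ (r / 2)) ≤ Real.exp ((ϑ' - ϑ) * R t) := by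
      have := e3.1
      rw [sub_half] at this
      have := sub_pos.2 h2
      gcongr
    refine le_trans ?_ e4
    rw [Real.rpow_natCast, neg_mul, Real.exp_neg, ← div_eq_mul_inv,
      div_le_iff₀ (Real.exp_pos _)] at e1
    calc (1 + t) ^ k ≤ (2 * t) ^ k := by gcongr; linarith
      _ = 2 ^ k * t ^ k := mul_pow _ _ _
      _ ≤ 2 ^ k * (2⁻¹ ^ k * Real.exp ((ϑ' - ϑ) * t ^ (r / 2))) := by gcongr
      _ = _ := by rw [← mul_assoc, ← mul_pow]; norm_num
  obtain ⟨B, hB⟩ := eventually_atTop.1 hev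
  have hI := (h.integrable_exp_R hA hmono (h0.trans h2) h3).const_mul ((1 + |B|) ^ k)
  refine hI.mono' (measurable_indicator_Ioi_of_continuousOn ?_).aestronglyMeasurable
    (ae_of_all _ fun t => ?_)
  · exact ContinuousOn.mul (by fun_prop) (((h.continuousOn hA).const_mul ϑ).rexp)
  · by_cases ht : t ∈ Ioi A
    · have ht' : A < t := ht
      have ht0 : 0 ≤ t := by linarith
      have hR : 0 ≤ R t := h.R_nonneg t (hA.trans ht')
      rw [indicator_of_mem ht, indicator_of_mem ht, Real.norm_of_nonneg (by positivity)]
      rcases le_total t B with htB | htB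
      · gcongr
        exact htB.trans (le_abs_self B)
      · calc (1 + t) ^ k * Real.exp (ϑ * R t)
            ≤ Real.exp ((ϑ' - ϑ) * R t) * Real.exp (ϑ * R t) := by gcongr; exact hB t htB
          _ = 1 * Real.exp (ϑ' * R t) := by rw [← Real.exp_add]; ring_nf
          _ ≤ _ := by
            gcongr
            exact one_le_pow₀ (by linarith [abs_nonneg B])
    · simp [indicator_of_notMem ht]

/-- Compare pointwise with the Taylor polynomial. Below `A` the remainder is a multiple of `θ ^ κ *
|t| ^ κ`; between `A` and `y` the exponential in it is at most `exp (ϑ R t)`; above `y` only the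
polynomial is left, and the tail makes its contribution `O(1 / y)`. -/
theorem abs_truncated_exp_sub_le [IsProbabilityMeasure ν]
    (h : HasStretchedExpTail ν id r x₀ a α R) {A : ℝ} (hA : x₀ < A) (hA1 : 1 ≤ A)
    (hmono : StrictMonoOn R (Ici A)) {ϑ : ℝ} (h0 : 0 < ϑ) (h1 : ϑ < 1) :
    ∃ C : ℝ, 0 ≤ C ∧ ∀ y θ : ℝ, A ≤ y → 0 ≤ θ → θ ≤ 1 →
      (∀ u, A < u → u ≤ y → θ * u ≤ ϑ * R u) →
      IntegrableOn (fun t => Real.exp (θ * t)) (Iic y) ν ∧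
      |∫ t in Iic y, Real.exp (θ * t) ∂ν - ∑ k ∈ Finset.range (truncationOrder r),
        (∫ t, t ^ k ∂ν) / k.factorial * θ ^ k| ≤ C * (θ ^ truncationOrder r + 1 / y) := by
  set κ := truncationOrder r with hκ
  -- The remainder needs `|t| ^ κ`; the spare factor `1 + t` yields `1 / y` on `t > y`.
  set W : ℝ → ℝ := (Ioi A).indicator fun t => (1 + t) ^ (κ + 1) * Real.exp (ϑ * R t) with hW
  have hWint : Integrable W ν := h.integrable_pow_mul_exp_R hA hA1 hmono h0 h1 (κ + 1)
  have hWnn : ∀ t, 0 ≤ W t := fun t => indicator_nonneg (fun s hs => by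
    have hs' : A < s := hs
    have : 0 ≤ s := by linarith
    positivity) t
  have hpow : ∀ k ≤ κ, Integrable (fun t : ℝ => |t| ^ k) ν := fun k hk => h.integrable_pow k hk
  have hpow' : ∀ k < κ, Integrable (fun t : ℝ => t ^ k) ν := fun k hk =>
    (hpow k hk.le).mono (by fun_prop) (ae_of_all _ fun t => by simp)
  set c₁ := ∫ t, |t| ^ κ ∂ν with hc₁
  set c₂ := ∫ t, W t ∂ν with hc₂
  have hc₁0 : 0 ≤ c₁ := integral_nonneg fun t => by positivity
  have hc₂0 : 0 ≤ c₂ := integral_nonneg hWnn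
  refine ⟨Real.exp A * c₁ + c₂ + κ * c₂, by positivity, fun y θ hy hθ0 hθ1 hθR => ?_⟩
  have hy0 : 0 < y := by linarith
  have hexpint : IntegrableOn (fun t => Real.exp (θ * t)) (Iic y) ν := by
    refine Measure.integrableOn_of_bounded (M := Real.exp (θ * y)) (measure_ne_top _ _)
      (by fun_prop) ?_
    filter_upwards [ae_restrict_mem measurableSet_Iic] with t ht
    rw [Real.norm_of_nonneg (Real.exp_pos _).le]
    have : t ≤ y := ht
    gcongr
  refine ⟨hexpint, ?_⟩
  have hsumint : ∀ k ∈ Finset.range κ, Integrable (fun t : ℝ => t ^ k / k.factorial * θ ^ k) ν :=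
    fun k hk => ((hpow' k (Finset.mem_range.1 hk)).div_const _).mul_const _
  have heq : ∫ t in Iic y, Real.exp (θ * t) ∂ν - ∑ k ∈ Finset.range κ,
        (∫ t, t ^ k ∂ν) / k.factorial * θ ^ k
      = ∫ t, ((Iic y).indicator (fun t => Real.exp (θ * t)) t
          - ∑ k ∈ Finset.range κ, t ^ k / k.factorial * θ ^ k) ∂ν := by
    rw [integral_sub ((integrable_indicator_iff measurableSet_Iic).2 hexpint)
      (integrable_finsetSum _ hsumint), integral_indicator measurableSet_Iic,
      integral_finsetSum _ hsumint]
    simp only [integral_mul_const, integral_div]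
  have hsum : ∀ t, ∑ k ∈ Finset.range κ, t ^ k / (k.factorial : ℝ) * θ ^ k
      = ∑ k ∈ Finset.range κ, (θ * t) ^ k / k.factorial := fun t =>
    Finset.sum_congr rfl fun k _ => by rw [mul_pow]; ring
  have hpt : ∀ t, |(Iic y).indicator (fun t => Real.exp (θ * t)) t
          - ∑ k ∈ Finset.range κ, t ^ k / k.factorial * θ ^ k|
        ≤ θ ^ κ * Real.exp A * |t| ^ κ + θ ^ κ * W t + κ / y * W t := by
    intro t
    rw [hsum]
    have hW0 := hWnn t
    rcases le_or_gt t y with hty | hty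
    · rw [indicator_of_mem (mem_Iic.2 hty)]
      refine (abs_exp_sub_sum_le κ (θ * t)).trans ?_
      rw [abs_mul, abs_of_nonneg hθ0, mul_pow]
      rcases le_or_gt t A with htA | htA
      · have h2 : max (θ * t) 0 ≤ A := by
          refine max_le ?_ (by linarith)
          rcases le_total 0 t with ht | ht
          · exact (mul_le_of_le_one_left ht hθ1).trans htA
          · exact (mul_nonpos_of_nonneg_of_nonpos hθ0 ht).trans (by linarith)
        calc θ ^ κ * |t| ^ κ * Real.exp (max (θ * t) 0) ≤ θ ^ κ * |t| ^ κ * Real.exp A := by gcongr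
          _ = θ ^ κ * Real.exp A * |t| ^ κ + 0 + 0 := by ring
          _ ≤ _ := by gcongr <;> positivity
      · have ht0 : 0 ≤ t := by linarith
        have h2 : max (θ * t) 0 ≤ ϑ * R t :=
          max_le (hθR t htA hty) (mul_nonneg h0.le (h.R_nonneg t (hA.trans htA)))
        have h3 : |t| ^ κ ≤ (1 + t) ^ (κ + 1) := by
          rw [abs_of_nonneg ht0]
          calc t ^ κ ≤ (1 + t) ^ κ := by gcongr; linarith
            _ ≤ _ := pow_le_pow_right₀ (by linarith) (Nat.le_succ κ)
        have h4 : W t = (1 + t) ^ (κ + 1) * Real.exp (ϑ * R t) := indicator_of_mem htA _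
        calc θ ^ κ * |t| ^ κ * Real.exp (max (θ * t) 0)
            ≤ θ ^ κ * (1 + t) ^ (κ + 1) * Real.exp (ϑ * R t) := by gcongr
          _ = 0 + θ ^ κ * W t + 0 := by rw [h4]; ring
          _ ≤ _ := by gcongr <;> positivity
    · rw [indicator_of_notMem (by simpa using hty), zero_sub, abs_neg]
      have htA : A < t := hy.trans_lt hty
      have ht0 : 0 ≤ t := by linarith
      have h4 : W t = (1 + t) ^ (κ + 1) * Real.exp (ϑ * R t) := indicator_of_mem htA _
      have h5 : y * (1 + t) ^ κ ≤ W t := by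
        rw [h4, pow_succ]
        calc y * (1 + t) ^ κ = (1 + t) ^ κ * y * 1 := by ring
          _ ≤ (1 + t) ^ κ * (1 + t) * Real.exp (ϑ * R t) := by
            gcongr
            · linarith
            · exact Real.one_le_exp (mul_nonneg h0.le (h.R_nonneg t (hA.trans htA)))
      have h6 : ∀ k ∈ Finset.range κ, |(θ * t) ^ k / (k.factorial : ℝ)| ≤ (1 + t) ^ κ := by
        intro k hk
        rw [abs_of_nonneg (by positivity)]
        calc (θ * t) ^ k / (k.factorial : ℝ) ≤ (θ * t) ^ k :=
              div_le_self (by positivity) (by exact_mod_cast k.factorial_pos)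
          _ ≤ (1 + t) ^ k := by
            gcongr
            calc θ * t ≤ 1 * t := by gcongr
              _ ≤ 1 + t := by linarith
          _ ≤ _ := pow_le_pow_right₀ (by linarith) (Finset.mem_range.1 hk).le
      calc |∑ k ∈ Finset.range κ, (θ * t) ^ k / (k.factorial : ℝ)|
          ≤ ∑ k ∈ Finset.range κ, (1 + t) ^ κ :=
            (Finset.abs_sum_le_sum_abs _ _).trans (Finset.sum_le_sum h6)
        _ = κ / y * (y * (1 + t) ^ κ) := by
          rw [Finset.sum_const, Finset.card_range, nsmul_eq_mul]; field_simp
        _ ≤ 0 + 0 + κ / y * W t := by rw [zero_add, zero_add]; gcongr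
        _ ≤ _ := by gcongr <;> positivity
  have hi₁ : Integrable (fun t => θ ^ κ * Real.exp A * |t| ^ κ) ν := (hpow κ le_rfl).const_mul _
  have hi₂ : Integrable (fun t => θ ^ κ * W t) ν := hWint.const_mul _
  have hi₃ : Integrable (fun t => κ / y * W t) ν := hWint.const_mul _
  have hi₁₂ : Integrable (fun t => θ ^ κ * Real.exp A * |t| ^ κ + θ ^ κ * W t) ν := hi₁.add hi₂
  rw [heq, ← Real.norm_eq_abs]
  calc _ ≤ ∫ t, (θ ^ κ * Real.exp A * |t| ^ κ + θ ^ κ * W t + κ / y * W t) ∂ν :=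
        norm_integral_le_of_norm_le (hi₁₂.add hi₃) (ae_of_all _ hpt)
    _ = θ ^ κ * Real.exp A * c₁ + θ ^ κ * c₂ + κ / y * c₂ := by
        rw [integral_add hi₁₂ hi₃, integral_add hi₁ hi₂, integral_const_mul, integral_const_mul,
          integral_const_mul]
    _ ≤ _ := by
        have e1 : 0 ≤ θ ^ κ := by positivity
        have e2 : 0 ≤ 1 / y := by positivity
        have e3 : (κ : ℝ) / y = κ * (1 / y) := by ring
        rw [e3]
        have e4 : 0 ≤ Real.exp A * c₁ := by positivity
        have e5 : 0 ≤ κ * c₂ := by positivity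
        nlinarith [mul_nonneg e1 e5, mul_nonneg e2 e4, mul_nonneg e2 hc₂0]

/-- The Laplace transform of the law truncated at `x / 2`, in the range of tilts that the tail
allows. -/
theorem truncated_mgf [IsProbabilityMeasure ν] (h : HasStretchedExpTail ν id r x₀ a α R) :
    ∃ η : ℝ, 0 < η ∧ η ≤ 1 ∧ ∃ C A : ℝ, ∀ x, A ≤ x → (1 + η) * R x ≤ 2 * R (x / 2) ∧
      ∀ θ, 0 ≤ θ → θ ≤ (1 + η) * (R x / x) →
        IntegrableOn (fun t => Real.exp (θ * t)) (Iic (x / 2)) ν ∧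
        |∫ t in Iic (x / 2), Real.exp (θ * t) ∂ν - Real.exp (truncatedCGF ν id r θ)| ≤ C / x := by
  obtain ⟨b, hb, A, hA, hA1, hpos, hmono, hcmp⟩ := h.exists_comparison
  -- For `u ≤ x / 2` the comparison gives `R u ≥ (u / x) ^ b * R x ≥ 2 ^ (1 - b) * (u / x) * R x`.
  -- The gain `2 ^ (1 - b) = (1 + η) ^ 2` is shared: one factor enlarges the tilt, the other leaves
  -- `ϑ = (1 + η)⁻¹ < 1`.
  set η : ℝ := 2 ^ ((1 - b) / 2) - 1 with hη
  have hb1 : 0 < (1 - b) / 2 := by linarith [hb.2]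
  have hη0 : 0 < η := by
    have := Real.one_lt_rpow one_lt_two hb1
    rw [hη]; linarith
  have hη1 : η ≤ 1 := by
    have := Real.rpow_le_rpow_of_exponent_le one_le_two (show (1 - b) / 2 ≤ 1 by linarith [hb.1])
    rw [Real.rpow_one] at this
    rw [hη]; linarith
  have hsq : (1 + η) * (1 + η) = 2 ^ (1 - b) := by
    rw [hη, add_sub_cancel, ← Real.rpow_add two_pos]; ring_nf
  obtain ⟨C₁, hC₁, hmgf⟩ := h.abs_truncated_exp_sub_le hA hA1 hmono
    (ϑ := (1 + η)⁻¹) (by positivity) (inv_lt_one_of_one_lt₀ (by linarith))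
  obtain ⟨hκ2, hκ⟩ := truncationOrder_spec h.r_pos h.r_lt_one
  have hM1 : ∫ t : ℝ, id t ^ 1 ∂ν = 0 := by simpa using h.mean_eq
  obtain ⟨C₂, hC₂, hcum⟩ := exp_cumulant_sub_moments (M := fun i => ∫ t : ℝ, id t ^ i ∂ν)
    (by simp) (truncationOrder r)
  set κ := truncationOrder r with hκdef
  -- Half of the margin in `κ (1 - r) > 1`, so that `(x ^ (r - 1 + τ)) ^ κ` is still below `1 / x`.
  set τ := ((κ : ℝ) * (1 - r) - 1) / (2 * κ) with hτ
  have hκ0 : (0 : ℝ) < κ := by exact_mod_cast (by omega : 0 < κ)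
  have hτ0 : 0 < τ := div_pos (by linarith) (by positivity)
  have hτκ : (r - 1 + τ) * κ < -1 := by
    have : τ * κ = ((κ : ℝ) * (1 - r) - 1) / 2 := by rw [hτ]; field_simp
    nlinarith
  have hτ1 : r - 1 + τ < 0 := by
    by_contra hcon
    push Not at hcon
    have := mul_nonneg hcon hκ0.le
    linarith
  have hev : ∀ᶠ x in atTop, (1 + η) * (R x / x) ≤ 1 ∧ ((1 + η) * (R x / x)) ^ κ ≤ 1 / x := by
    filter_upwards [h.rpow_bounds (half_pos hτ0), eventually_gt_atTop 1,
      eventually_const_mul_rpow_le (1 + η) (p := r - 1 + τ / 2) (q := r - 1 + τ) (by linarith),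
      eventually_ge_atTop A]
      with x e1 e2 e3 e4
    have hx0 : 0 < x := by linarith
    have e5 : R x / x ≤ x ^ (r - 1 + τ / 2) := by
      rw [div_le_iff₀ hx0, ← Real.rpow_add_one hx0.ne']
      refine e1.2.trans (le_of_eq ?_)
      ring_nf
    have e6 : (1 + η) * (R x / x) ≤ x ^ (r - 1 + τ) :=
      (mul_le_mul_of_nonneg_left e5 (by linarith)).trans e3
    have hRx := (hpos x e4).1
    refine ⟨e6.trans (Real.rpow_le_one_of_one_le_of_nonpos e2.le hτ1.le), ?_⟩
    calc ((1 + η) * (R x / x)) ^ κ ≤ (x ^ (r - 1 + τ)) ^ κ := by gcongr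
      _ = x ^ ((r - 1 + τ) * κ) := by rw [Real.rpow_mul hx0.le, Real.rpow_natCast]
      _ ≤ x ^ (-1 : ℝ) := Real.rpow_le_rpow_of_exponent_le e2.le hτκ.le
      _ = 1 / x := by rw [Real.rpow_neg_one, one_div]
  obtain ⟨B, hB⟩ := eventually_atTop.1 hev
  refine ⟨η, hη0, hη1, C₁ * 3 + C₂, max B (2 * A), fun x hx => ?_⟩
  have hxB := (le_max_left _ _).trans hx
  have hxA := (le_max_right _ _).trans hx
  have hx0 : 0 < x := by linarith
  have hRx := (hpos x (by linarith)).1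
  have hlin : ∀ u, A ≤ u → u ≤ x / 2 → (1 + η) * (R x / x) * u ≤ (1 + η)⁻¹ * R u := by
    intro u hu hux
    have hu0 : 0 < u := by linarith
    have e1 := hcmp u x hu (by linarith)
    have e2 : u / x * 2 ^ (1 - b) ≤ (u / x) ^ b := by
      have hux0 : 0 < u / x := by positivity
      have e3 : (2 : ℝ) ^ (1 - b) ≤ (x / u) ^ (1 - b) := by
        refine Real.rpow_le_rpow two_pos.le ?_ (by linarith [hb.2])
        rw [le_div_iff₀ hu0]; linarith
      have e4 : (u / x) ^ b = u / x * (x / u) ^ (1 - b) := by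
        rw [show x / u = (u / x)⁻¹ by rw [inv_div], Real.inv_rpow hux0.le, ← Real.rpow_neg hux0.le]
        nth_rw 2 [← Real.rpow_one (u / x)]
        rw [← Real.rpow_add hux0]; ring_nf
      rw [e4]; gcongr
    rw [inv_mul_eq_div, le_div_iff₀ (by positivity)]
    calc (1 + η) * (R x / x) * u * (1 + η) = u / x * ((1 + η) * (1 + η)) * R x := by
          field_simp
      _ = u / x * 2 ^ (1 - b) * R x := by rw [hsq]
      _ ≤ (u / x) ^ b * R x := by gcongr
      _ ≤ R u := e1
  constructor
  · have := hlin (x / 2) (by linarith) le_rfl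
    have e1 : (1 + η) * (R x / x) * (x / 2) = (1 + η) * R x / 2 := by field_simp
    have e2 : (1 + η)⁻¹ * R (x / 2) ≤ R (x / 2) :=
      mul_le_of_le_one_left (hpos _ (by linarith)).1.le (inv_le_one_of_one_le₀ (by linarith))
    linarith
  · intro θ hθ0 hθ
    have hθ1 : θ ≤ 1 := hθ.trans (hB x hxB).1
    have hθκ : θ ^ κ ≤ 1 / x := (pow_le_pow_left₀ hθ0 hθ κ).trans (hB x hxB).2
    obtain ⟨e1, e2⟩ := hmgf (x / 2) θ (by linarith) hθ0 hθ1 fun u hu hux =>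
      (mul_le_mul_of_nonneg_right hθ (by linarith)).trans (hlin u hu.le hux)
    refine ⟨e1, ?_⟩
    have e3 := hcum θ ⟨hθ0, hθ1⟩
    rw [truncatedCGF_eq ν id r hM1]
    rw [abs_sub_comm] at e3
    have e4 := abs_sub_le (∫ t in Iic (x / 2), Real.exp (θ * t) ∂ν)
      (∑ k ∈ Finset.range κ, (∫ t : ℝ, id t ^ k ∂ν) / k.factorial * θ ^ k)
      (Real.exp (Polynomial.eval θ (egfPoly (cumulant fun i => ∫ t : ℝ, id t ^ i ∂ν) κ)))
    refine e4.trans ?_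
    have e5 : C₁ * (θ ^ κ + 1 / (x / 2)) ≤ C₁ * (1 / x + 1 / (x / 2)) := by gcongr
    have e6 : C₂ * θ ^ κ ≤ C₂ * (1 / x) := by gcongr
    have e7 : C₁ * (1 / x + 1 / (x / 2)) + C₂ * (1 / x) = (C₁ * 3 + C₂) / x := by
      field_simp; ring
    simp only [id] at e2 e3 ⊢
    linarith

end HasStretchedExpTail

/-! ### The critical tilt and the value of the rate -/

/-- First and second order Taylor estimates on an interval where the second derivative is small. -/
theorem taylor_bounds_of_deriv2_le {R : ℝ → ℝ} {l m q : ℝ}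
    (h1 : ∀ u ∈ Icc l m, HasDerivAt R (deriv R u) u)
    (h2 : ∀ u ∈ Icc l m, HasDerivAt (deriv R) (deriv (deriv R) u) u)
    (hq : ∀ u ∈ Icc l m, |deriv (deriv R) u| ≤ q) {u v : ℝ} (hu : u ∈ Icc l m)
    (hv : v ∈ Icc l m) :
    |deriv R v - deriv R u| ≤ q * |v - u| ∧
      |R v - R u - deriv R u * (v - u)| ≤ q * (v - u) ^ 2 := by
  have hlip : ∀ w ∈ Icc l m, |deriv R w - deriv R u| ≤ q * |w - u| := fun w hw =>
    (convex_Icc l m).norm_image_sub_le_of_norm_hasDerivWithin_le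
      (fun z hz => (h2 z hz).hasDerivWithinAt) hq hu hw
  refine ⟨hlip v hv, ?_⟩
  have hq0 : 0 ≤ q := (abs_nonneg _).trans (hq u hu)
  have hsub : uIcc u v ⊆ Icc l m := (convex_Icc l m).ordConnected.uIcc_subset hu hv
  have hd : ∀ w ∈ uIcc u v, HasDerivWithinAt (fun w => R w - deriv R u * (w - u))
      (deriv R w - deriv R u) (uIcc u v) w := by
    intro w hw
    have := (h1 w (hsub hw)).sub (((hasDerivAt_id w).sub_const u).const_mul (deriv R u))
    exact (this.congr_deriv (by simp)).hasDerivWithinAt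
  have hb : ∀ w ∈ uIcc u v, ‖deriv R w - deriv R u‖ ≤ q * |v - u| := by
    intro w hw
    refine (hlip w (hsub hw)).trans ?_
    exact mul_le_mul_of_nonneg_left (by simpa using abs_sub_left_of_mem_uIcc hw) hq0
  have := (convex_uIcc u v).norm_image_sub_le_of_norm_hasDerivWithin_le hd hb left_mem_uIcc
    right_mem_uIcc
  simp only [sub_self, mul_zero, sub_zero, Real.norm_eq_abs] at this
  rw [mul_assoc, ← sq, sq_abs] at this
  convert this using 2
  ring

/-- The rate is attained at a critical tilt `s = R' (x - n K' s)`. -/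
theorem rate_eq_of_critical {R K : ℝ → ℝ} {δ s₀ x q c B g : ℝ} {n : ℕ} (hK : IsNearSquare K δ)
    (hδ : δ ≤ s₀) (hx : 0 < x)
    (h1 : ∀ u ∈ Icc (x / 2) (2 * x), HasDerivAt R (deriv R u) u)
    (h2 : ∀ u ∈ Icc (x / 2) (2 * x), HasDerivAt (deriv R) (deriv (deriv R) u) u)
    (hg : ∀ u ∈ Icc (x / 2) (2 * x), 0 < deriv R u ∧ deriv R u ≤ g)
    (hq : ∀ u ∈ Icc (x / 2) (2 * x), |deriv (deriv R) u| ≤ q)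
    (hB : ∀ s ∈ Icc 0 s₀, |deriv K s| ≤ B) (hc : ∀ s ∈ Icc δ s₀, c ≤ s * deriv K s - K s)
    (hnB : n * B ≤ x / 4) (hgδ : g < δ) (hqn : 4 * q * n ≤ 1) (hcB : B * g ≤ c) :
    ∃ s ∈ Ioo 0 δ, s = deriv R (x - n * deriv K s) ∧
      rate R K s₀ n x = R (x - n * deriv K s) + n * (s * deriv K s - K s) ∧
      rate R K s₀ n x ≤ R x := by
  have hδ0 := hK.δ_pos
  have hmem : ∀ s ∈ Icc 0 s₀, x - n * deriv K s ∈ Icc (x / 2) (2 * x) := by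
    intro s hs
    have e1 : |n * deriv K s| ≤ x / 4 := by
      rw [abs_mul, Nat.abs_cast]
      exact (mul_le_mul_of_nonneg_left (hB s hs) (Nat.cast_nonneg n)).trans hnB
    rw [abs_le] at e1
    constructor <;> linarith [e1.1, e1.2]
  have hmemδ : ∀ s ∈ Icc 0 δ, x - n * deriv K s ∈ Icc (x / 2) (2 * x) := fun s hs =>
    hmem s ⟨hs.1, hs.2.trans hδ⟩
  have hxmem : x ∈ Icc (x / 2) (2 * x) := ⟨by linarith, by linarith⟩
  have hKc : Continuous (deriv K) := hK.contDiff_deriv.continuous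
  have hDc : ContinuousOn (fun s => s - deriv R (x - n * deriv K s)) (Icc 0 δ) := by
    refine continuousOn_id.sub fun s hs => ?_
    have e1 : ContinuousAt (fun s => x - n * deriv K s) s := by fun_prop
    exact (ContinuousAt.comp (f := fun s => x - n * deriv K s)
      (h2 _ (hmemδ s hs)).continuousAt e1).continuousWithinAt
  -- Intermediate values: the difference is negative at `0`, where `deriv R > 0`, and positive at
  -- `δ`, because `deriv R ≤ g < δ`.
  obtain ⟨s, hs, hs0⟩ : (0 : ℝ) ∈ (fun s => s - deriv R (x - n * deriv K s)) '' Ioo 0 δ := by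
    refine intermediate_value_Ioo hδ0.le hDc ⟨?_, ?_⟩
    · simp only [hK.deriv_zero, mul_zero, sub_zero, zero_sub, Left.neg_neg_iff]
      exact (hg x hxmem).1
    · have := (hg _ (hmemδ δ ⟨hδ0.le, le_rfl⟩)).2
      linarith
  simp only at hs0
  have hscrit : s = deriv R (x - n * deriv K s) := by linarith
  set Φ : ℝ → ℝ := fun t => R (x - n * deriv K t) + n * (t * deriv K t - K t) with hΦ
  have hΦd : ∀ t ∈ Icc 0 δ,
      HasDerivAt Φ (n * deriv (deriv K) t * (t - deriv R (x - n * deriv K t))) t := by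
    intro t ht
    have e1 := (h1 _ (hmemδ t ht)).comp t (((hK.hasDerivAt_deriv t).const_mul (n : ℝ)).const_sub x)
    have e2 := (((hasDerivAt_id t).mul (hK.hasDerivAt_deriv t)).sub
      (hK.hasDerivAt t)).const_mul (n : ℝ)
    refine (e1.add e2).congr_deriv ?_
    simp; ring
  have hΦc : ∀ S ⊆ Icc 0 δ, ContinuousOn Φ S := fun S hS t ht =>
    (hΦd t (hS ht)).continuousAt.continuousWithinAt
  -- The map `t ↦ R' (x - n K' t)` has Lipschitz constant at most `2 q n ≤ 1 / 2`. So `t - R' (x - n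
  -- K' t)` has the sign of `t - s`, and with `K'' ≥ 1 / 2` the function `Φ` decreases before `s`
  -- and increases after it.
  have hlip : ∀ t ∈ Icc 0 δ, |deriv R (x - n * deriv K t) - s| ≤ |t - s| / 2 := by
    intro t ht
    have e1 := (taylor_bounds_of_deriv2_le h1 h2 hq (hmemδ s (Ioo_subset_Icc_self hs))
      (hmemδ t ht)).1
    rw [← hscrit] at e1
    refine e1.trans ?_
    have e2 : |deriv K t - deriv K s| ≤ 2 * |t - s| := by
      rcases le_total s t with hst | hst
      · have := hK.deriv_sub hs.1.le hst ht.2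
        rw [abs_of_nonneg (sub_nonneg.2 hst), abs_of_nonneg (by linarith [this.1])]
        exact this.2
      · have := hK.deriv_sub ht.1 hst hs.2.le
        rw [abs_sub_comm, abs_sub_comm t s, abs_of_nonneg (sub_nonneg.2 hst),
          abs_of_nonneg (by linarith [this.1])]
        exact this.2
    have hq0 : 0 ≤ q := (abs_nonneg _).trans (hq x hxmem)
    rw [show x - n * deriv K t - (x - n * deriv K s) = -(n * (deriv K t - deriv K s)) by ring,
      abs_neg, abs_mul, Nat.abs_cast]
    calc q * (n * |deriv K t - deriv K s|) ≤ q * (n * (2 * |t - s|)) := by gcongr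
      _ = 4 * q * n * |t - s| / 2 := by ring
      _ ≤ 1 * |t - s| / 2 := by gcongr
      _ = _ := by ring
  have hleft : ∀ t ∈ Icc 0 s, Φ s ≤ Φ t := by
    intro t ht
    refine antitoneOn_of_deriv_nonpos (convex_Icc 0 s)
      (hΦc _ (Icc_subset_Icc_right hs.2.le)) ?_ ?_ ht ⟨hs.1.le, le_rfl⟩ ht.2
    · intro v hv
      rw [interior_Icc] at hv
      exact (hΦd v ⟨hv.1.le, hv.2.le.trans hs.2.le⟩).differentiableAt.differentiableWithinAt
    · intro v hv
      rw [interior_Icc] at hv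
      have hv' : v ∈ Icc 0 δ := ⟨hv.1.le, hv.2.le.trans hs.2.le⟩
      rw [(hΦd v hv').deriv]
      have e1 := hlip v hv'
      have e2 := (hK.deriv2 v hv').1
      rw [abs_of_nonpos (by linarith [hv.2] : v - s ≤ 0), abs_le] at e1
      exact mul_nonpos_of_nonneg_of_nonpos (by positivity) (by linarith [e1.1, hv.2])
  have hright : ∀ t ∈ Icc s δ, Φ s ≤ Φ t := by
    intro t ht
    refine monotoneOn_of_deriv_nonneg (convex_Icc s δ)
      (hΦc _ (Icc_subset_Icc_left hs.1.le)) ?_ ?_ ⟨le_rfl, hs.2.le⟩ ht ht.1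
    · intro v hv
      rw [interior_Icc] at hv
      exact (hΦd v ⟨hs.1.le.trans hv.1.le, hv.2.le⟩).differentiableAt.differentiableWithinAt
    · intro v hv
      rw [interior_Icc] at hv
      have hv' : v ∈ Icc 0 δ := ⟨hs.1.le.trans hv.1.le, hv.2.le⟩
      rw [(hΦd v hv').deriv]
      have e1 := hlip v hv'
      have e2 := (hK.deriv2 v hv').1
      rw [abs_of_nonneg (by linarith [hv.1] : 0 ≤ v - s), abs_le] at e1
      exact mul_nonneg (by positivity) (by linarith [e1.2, hv.1])
  have hΦ0 : Φ 0 = R x := by simp [hΦ, hK.deriv_zero, hK.zero]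
  -- Away from zero the Legendre cost is at least `n c`, while `R` can drop by at most `g n B ≤ n
  -- c`.
  have hfar : ∀ t ∈ Icc δ s₀, Φ 0 ≤ Φ t := by
    intro t ht
    have ht' : t ∈ Icc 0 s₀ := ⟨hδ0.le.trans ht.1, ht.2⟩
    have e1 : |R x - R (x - n * deriv K t)| ≤ g * |x - (x - n * deriv K t)| :=
      (convex_Icc (x / 2) (2 * x)).norm_image_sub_le_of_norm_hasDerivWithin_le
        (fun z hz => (h1 z hz).hasDerivWithinAt)
        (fun z hz => by rw [Real.norm_of_nonneg (hg z hz).1.le]; exact (hg z hz).2)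
        (hmem t ht') hxmem
    have hg0 : 0 < g := (hg x hxmem).1.trans_le (hg x hxmem).2
    rw [show x - (x - n * deriv K t) = n * deriv K t by ring, abs_mul, Nat.abs_cast] at e1
    have e2 : g * (n * |deriv K t|) ≤ n * (t * deriv K t - K t) := by
      calc g * (n * |deriv K t|) ≤ g * (n * B) := by gcongr; exact hB t ht'
        _ = n * (B * g) := by ring
        _ ≤ n * (t * deriv K t - K t) := by gcongr; exact hcB.trans (hc t ht)
    have e3 := le_abs_self (R x - R (x - n * deriv K t))
    rw [hΦ0]
    change R x ≤ R (x - n * deriv K t) + n * (t * deriv K t - K t)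
    linarith
  have hs0' : Φ s ≤ Φ 0 := hleft 0 ⟨le_rfl, hs.1.le⟩
  have hleast : IsLeast (Φ '' Icc 0 s₀) (Φ s) := by
    refine ⟨⟨s, ⟨hs.1.le, hs.2.le.trans hδ⟩, rfl⟩, ?_⟩
    rintro _ ⟨t, ht, rfl⟩
    rcases le_total t s with hts | hts
    · exact hleft t ⟨ht.1, hts⟩
    · rcases le_total t δ with htδ | htδ
      · exact hright t ⟨hts, htδ⟩
      · exact hs0'.trans (hfar t ⟨htδ, ht.2⟩)
  have hrate : rate R K s₀ n x = Φ s := hleast.csInf_eq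
  exact ⟨s, hs, hscrit, hrate, by rw [hrate, ← hΦ0]; exact hs0'⟩

/-! ### Concentration of the sum under exponential tilting -/

/-- The data of a tilted sum: `ϱ` has the Laplace transform `exp (M K θ)` up to a factor `exp ε₀`
for tilts `θ ≤ Θ`; it is studied near the point `y = n K' s`. The deviations `v` from `y` are
controlled with the tilts `s ± tilt v`. -/
structure TiltedSum (ϱ : Measure ℝ) (K : ℝ → ℝ) (δ Θ ε₀ η s y : ℝ) (M n J : ℕ) : Prop where
  nearSquare : IsNearSquare K δ
  Θ_le : Θ ≤ δ
  mass_le : ϱ univ ≤ 1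
  mgf : ∀ θ, 0 ≤ θ → θ ≤ Θ → Integrable (fun t => Real.exp (θ * t)) ϱ ∧
    Real.exp (M * K θ - ε₀) ≤ ∫ t, Real.exp (θ * t) ∂ϱ ∧
    ∫ t, Real.exp (θ * t) ∂ϱ ≤ Real.exp (M * K θ + ε₀)
  η_pos : 0 < η
  η_le_one : η ≤ 1
  s_pos : 0 < s
  s_le : (1 + η) * s ≤ Θ
  y_eq : y = n * deriv K s
  M_le : M ≤ n
  n_le : n ≤ M + 2 * J
  n_pos : 0 < n

namespace TiltedSum

variable {ϱ : Measure ℝ} {K : ℝ → ℝ} {δ Θ ε₀ η s y : ℝ} {M n J : ℕ}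

theorem s_mem (H : TiltedSum ϱ K δ Θ ε₀ η s y M n J) : s ∈ Icc 0 δ :=
  ⟨H.s_pos.le, by nlinarith [H.s_le, H.Θ_le, mul_pos H.η_pos H.s_pos]⟩

theorem y_nonneg (H : TiltedSum ϱ K δ Θ ε₀ η s y M n J) : 0 ≤ y := by
  rw [H.y_eq]
  have h1 := (H.nearSquare.deriv_bounds H.s_mem).1
  have h2 : 0 ≤ deriv K s := by linarith [H.s_pos]
  positivity

/-- Deviations from `y` are exponentially unlikely under the tilt. -/
theorem integral_deviation_le (H : TiltedSum ϱ K δ Θ ε₀ η s y M n J) {v l : ℝ} (hv : 0 < v)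
    (hvJ : 16 * J * s ≤ v) (hl : l = min (v / (4 * n)) (η * s)) :
    (Integrable (fun t => Real.exp ((s + l) * (t - y) - l * v)) ϱ ∧
      ∫ t, Real.exp ((s + l) * (t - y) - l * v) ∂ϱ
        ≤ Real.exp (M * K s - s * y + ε₀ - l * v / 2)) ∧
    (Integrable (fun t => Real.exp ((s - l) * (t - y) - l * v)) ϱ ∧
      ∫ t, Real.exp ((s - l) * (t - y) - l * v) ∂ϱ
        ≤ Real.exp (M * K s - s * y + ε₀ - l * v / 2)) := by
  have hn : (0 : ℝ) < n := by exact_mod_cast H.n_pos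
  have hs := H.s_pos
  have hη := H.η_pos
  have hK := H.nearSquare
  have hl0 : 0 ≤ l := by rw [hl]; positivity
  have hl1 : l ≤ v / (4 * n) := hl ▸ min_le_left _ _
  have hl2 : l ≤ η * s := hl ▸ min_le_right _ _
  have hls : l ≤ s := hl2.trans (mul_le_of_le_one_left hs.le H.η_le_one)
  -- The Markov gain is `l v`. The quadratic term of `K` costs at most `n l² ≤ l v / 4`. For the
  -- tilt `s - l`, the mean `M K' s` in place of `y = n K' s` costs at most `l * 2 J * 2 s ≤ l v /
  -- 4`, by `16 J s ≤ v`. At least `l v / 2` is left.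
  have hnl : n * l ^ 2 ≤ l * v / 4 := by
    rw [le_div_iff₀ (by positivity)] at hl1
    nlinarith
  have hM : (M : ℝ) ≤ n := by exact_mod_cast H.M_le
  have hM0 : (0 : ℝ) ≤ M := Nat.cast_nonneg M
  have hnM : (n : ℝ) ≤ M + 2 * J := by exact_mod_cast H.n_le
  have hsl : s + l ≤ Θ := le_trans (by linarith) H.s_le
  have hK' := hK.deriv_bounds H.s_mem
  have hK'0 : 0 ≤ deriv K s := by linarith [hK'.1]
  have hrw : ∀ c : ℝ, (fun t => Real.exp (c * (t - y) - l * v))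
      = fun t => Real.exp (-c * y - l * v) * Real.exp (c * t) := by
    intro c; ext t; rw [← Real.exp_add]; ring_nf
  have hsl' := hsl.trans H.Θ_le
  have hlv : 0 ≤ l * v := mul_nonneg hl0 hv.le
  have hMl : (M : ℝ) * l ^ 2 ≤ n * l ^ 2 := by gcongr
  constructor
  · obtain ⟨i1, -, i2⟩ := H.mgf (s + l) (by linarith) hsl
    rw [hrw]
    refine ⟨i1.const_mul _, ?_⟩
    rw [integral_const_mul]
    refine (mul_le_mul_of_nonneg_left i2 (Real.exp_pos _).le).trans ?_
    rw [← Real.exp_add, Real.exp_le_exp]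
    have e1 := (hK.tangent H.s_mem ⟨by linarith, hsl'⟩ (t := s + l)).2
    rw [add_sub_cancel_left] at e1
    have e2 : M * K (s + l) ≤ M * (K s + deriv K s * l + l ^ 2) := by gcongr; linarith
    have e3 : (M : ℝ) * (deriv K s * l) ≤ l * y := by
      rw [H.y_eq]
      calc (M : ℝ) * (deriv K s * l) ≤ n * (deriv K s * l) := by gcongr
        _ = _ := by ring
    linarith
  · obtain ⟨i1, -, i2⟩ := H.mgf (s - l) (by linarith) (by linarith)
    rw [hrw]
    refine ⟨i1.const_mul _, ?_⟩
    rw [integral_const_mul]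
    refine (mul_le_mul_of_nonneg_left i2 (Real.exp_pos _).le).trans ?_
    rw [← Real.exp_add, Real.exp_le_exp]
    have e1 := (hK.tangent H.s_mem ⟨by linarith, by linarith⟩ (t := s - l)).2
    rw [show s - l - s = -l by ring, neg_sq] at e1
    have e2 : M * K (s - l) ≤ M * (K s - deriv K s * l + l ^ 2) := by gcongr; linarith
    have e3 : l * y - M * (deriv K s * l) ≤ l * v / 4 := by
      rw [H.y_eq]
      calc l * (n * deriv K s) - M * (deriv K s * l) = l * ((n - M) * deriv K s) := by ring
        _ ≤ l * ((2 * J) * (2 * s)) := by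
          have : (n : ℝ) - M ≤ 2 * J := by linarith
          gcongr
          exact hK'.2
        _ = l * (16 * J * s) / 4 := by ring
        _ ≤ _ := by gcongr
    linarith

theorem integral_tilt (H : TiltedSum ϱ K δ Θ ε₀ η s y M n J) :
    Integrable (fun t => Real.exp (s * (t - y))) ϱ ∧
      Real.exp (M * K s - s * y - ε₀) ≤ ∫ t, Real.exp (s * (t - y)) ∂ϱ ∧
      ∫ t, Real.exp (s * (t - y)) ∂ϱ ≤ Real.exp (M * K s - s * y + ε₀) := by
  have hs := H.s_pos
  have hη := H.η_pos
  obtain ⟨i1, i2, i3⟩ := H.mgf s hs.le (le_trans (by nlinarith) H.s_le)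
  have hrw : (fun t => Real.exp (s * (t - y))) = fun t => Real.exp (-s * y) * Real.exp (s * t) := by
    ext t; rw [← Real.exp_add]; ring_nf
  rw [hrw]
  refine ⟨i1.const_mul _, ?_, ?_⟩
  · rw [integral_const_mul, show M * K s - s * y - ε₀ = -s * y + (M * K s - ε₀) by ring,
      Real.exp_add]
    gcongr
  · rw [integral_const_mul, show M * K s - s * y + ε₀ = -s * y + (M * K s + ε₀) by ring,
      Real.exp_add]
    gcongr

/-- The window `|t - y| ≤ w` carries nearly all of the tilted mass. Subtracting from `exp (s (t -
y))` the two exponentials with tilts `s ± l` gives a minorant that is nonpositive outside the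
window, so the integral over the window never has to be isolated. -/
theorem le_integral (H : TiltedSum ϱ K δ Θ ε₀ η s y M n J) {w q B Λ : ℝ} {F : ℝ → ℝ}
    (hw : 0 < w) (hwJ : 16 * J * s ≤ w) (hq : 0 ≤ q) (hB : 0 ≤ B)
    (hΛ1 : Λ ≤ w ^ 2 / (16 * n)) (hΛ2 : Λ ≤ η * s * w / 4)
    (hF : Integrable F ϱ) (hF0 : ∀ t, 0 ≤ F t)
    (hFlow : ∀ t, |t - y| ≤ w → B * Real.exp (s * (t - y) - q * (t - y) ^ 2) ≤ F t) :
    B * Real.exp (-(q * w ^ 2)) * Real.exp (M * K s - s * y)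
      * (Real.exp (-ε₀) - 2 * Real.exp (ε₀ - Λ)) ≤ ∫ t, F t ∂ϱ := by
  have hn : (0 : ℝ) < n := by exact_mod_cast H.n_pos
  have hs := H.s_pos
  have hη := H.η_pos
  set l := min (w / (4 * n)) (η * s) with hl
  obtain ⟨⟨i1, i2⟩, i3, i4⟩ := H.integral_deviation_le hw hwJ hl
  obtain ⟨i5, i6, -⟩ := H.integral_tilt
  have hl0 : 0 ≤ l := by rw [hl]; positivity
  have hΛl : Λ ≤ l * w / 2 := by
    rcases min_cases (w / (4 * n)) (η * s) with ⟨h, _⟩ | ⟨h, _⟩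
    · have : l * w / 2 = w ^ 2 / (16 * n) * 2 := by rw [hl, h]; field_simp; ring
      have : 0 ≤ w ^ 2 / (16 * n) := by positivity
      linarith
    · have : l * w / 2 = η * s * w / 4 * 2 := by rw [hl, h]; ring
      have : 0 ≤ η * s * w / 4 := by positivity
      linarith
  set G : ℝ → ℝ := fun t => B * Real.exp (-(q * w ^ 2)) * (Real.exp (s * (t - y))
    - Real.exp ((s + l) * (t - y) - l * w) - Real.exp ((s - l) * (t - y) - l * w)) with hG
  have hGint : Integrable G ϱ := ((i5.sub i1).sub i3).const_mul _
  have hGF : ∀ t, G t ≤ F t := by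
    intro t
    rcases le_or_gt |t - y| w with h | h
    · refine le_trans ?_ (hFlow t h)
      rw [sub_eq_add_neg (s * (t - y)), Real.exp_add]
      simp only [hG]
      have e1 : (t - y) ^ 2 ≤ w ^ 2 := sq_le_sq' (abs_le.1 h).1 (abs_le.1 h).2
      calc _ ≤ B * Real.exp (-(q * w ^ 2)) * Real.exp (s * (t - y)) := by
            gcongr
            linarith [Real.exp_pos ((s + l) * (t - y) - l * w),
              Real.exp_pos ((s - l) * (t - y) - l * w)]
        _ ≤ B * Real.exp (-(q * (t - y) ^ 2)) * Real.exp (s * (t - y)) := by gcongr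
        _ = _ := by ring
    · refine le_trans ?_ (hF0 t)
      refine mul_nonpos_of_nonneg_of_nonpos (by positivity) ?_
      rcases lt_abs.1 h with h | h
      · have : Real.exp (s * (t - y)) ≤ Real.exp ((s + l) * (t - y) - l * w) := by
          rw [Real.exp_le_exp]; nlinarith
        linarith [Real.exp_pos ((s - l) * (t - y) - l * w)]
      · have : Real.exp (s * (t - y)) ≤ Real.exp ((s - l) * (t - y) - l * w) := by
          rw [Real.exp_le_exp]; nlinarith
        linarith [Real.exp_pos ((s + l) * (t - y) - l * w)]
  refine le_trans ?_ (integral_mono hGint hF hGF)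
  have hGval : ∫ t, G t ∂ϱ = B * Real.exp (-(q * w ^ 2)) * (∫ t, Real.exp (s * (t - y)) ∂ϱ
      - ∫ t, Real.exp ((s + l) * (t - y) - l * w) ∂ϱ
      - ∫ t, Real.exp ((s - l) * (t - y) - l * w) ∂ϱ) := by
    have i51 : Integrable (fun t => Real.exp (s * (t - y))
        - Real.exp ((s + l) * (t - y) - l * w)) ϱ := i5.sub i1
    rw [hG, integral_const_mul, integral_sub i51 i3, integral_sub i5 i1]
  rw [hGval, mul_assoc]
  gcongr
  have e1 : Real.exp (M * K s - s * y + ε₀ - l * w / 2)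
      ≤ Real.exp (M * K s - s * y) * Real.exp (ε₀ - Λ) := by
    rw [← Real.exp_add, Real.exp_le_exp]; linarith
  have e2 : Real.exp (M * K s - s * y - ε₀) = Real.exp (M * K s - s * y) * Real.exp (-ε₀) := by
    rw [← Real.exp_add]; ring_nf
  have e3 : Real.exp (M * K s - s * y) * (Real.exp (-ε₀) - 2 * Real.exp (ε₀ - Λ))
      = Real.exp (M * K s - s * y) * Real.exp (-ε₀)
        - 2 * (Real.exp (M * K s - s * y) * Real.exp (ε₀ - Λ)) := by ring
  linarith

/-- The contribution of the deviations between `v` and `2 v`. -/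
theorem integral_block_le (H : TiltedSum ϱ K δ Θ ε₀ η s y M n J) {v l q Λ : ℝ} (hv : 0 < v)
    (hvJ : 16 * J * s ≤ v) (hl : l = min (v / (4 * n)) (η * s))
    (hΛ1 : Λ ≤ v ^ 2 / (16 * n)) (hΛ2 : Λ ≤ η * s * v / 4)
    (hqn : 64 * q * n ≤ 1) (hqv : 16 * q * v ≤ η * s) :
    Integrable (fun t => Real.exp (4 * q * v ^ 2) * (Real.exp ((s + l) * (t - y) - l * v)
      + Real.exp ((s - l) * (t - y) - l * v))) ϱ ∧
    ∫ t, Real.exp (4 * q * v ^ 2) * (Real.exp ((s + l) * (t - y) - l * v)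
      + Real.exp ((s - l) * (t - y) - l * v)) ∂ϱ
      ≤ 2 * Real.exp (M * K s - s * y + ε₀ - Λ) := by
  have hn : (0 : ℝ) < n := by exact_mod_cast H.n_pos
  obtain ⟨⟨i1, i2⟩, i3, i4⟩ := H.integral_deviation_le hv hvJ hl
  -- Of the gain `l v / 2`, one half pays for the parabola, as `q (t - y)² ≤ 4 q v²` for `|t - y| ≤
  -- 2 v`; the other half is at least `Λ`.
  have hcost : 4 * q * v ^ 2 ≤ l * v / 4 ∧ Λ ≤ l * v / 4 := by
    rcases min_cases (v / (4 * n)) (η * s) with ⟨h, _⟩ | ⟨h, _⟩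
    · have e4 : l * v / 4 = v ^ 2 / (16 * n) := by
        rw [hl, h]; field_simp; ring
      rw [e4]
      refine ⟨?_, hΛ1⟩
      rw [le_div_iff₀ (by positivity)]
      nlinarith [sq_nonneg v]
    · have e4 : l * v / 4 = η * s * v / 4 := by rw [hl, h]
      rw [e4]
      exact ⟨by nlinarith, hΛ2⟩
  refine ⟨(i1.add i3).const_mul _, ?_⟩
  rw [integral_const_mul, integral_add i1 i3]
  calc _ ≤ Real.exp (4 * q * v ^ 2) * (Real.exp (M * K s - s * y + ε₀ - l * v / 2)
        + Real.exp (M * K s - s * y + ε₀ - l * v / 2)) := by gcongr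
    _ = 2 * Real.exp (4 * q * v ^ 2 + (M * K s - s * y + ε₀ - l * v / 2)) := by
        rw [Real.exp_add]; ring
    _ ≤ _ := by
        gcongr
        linarith [hcost.1, hcost.2]

/-- Four ranges of `t` are majorised separately. For `|t - y| ≤ w` the parabola costs at most `q
w²`. For `w < |t - y| < U` blocks starting at multiples of `w` are summed, each contributing a
factor `exp (-Λ)`. For `t ≤ y - U` a constant suffices. For `t ≥ y + U` the integrand has tilt `σ`,
and raising it to `(1 + η) σ` gains `exp (-η σ U)`. -/
theorem integral_le (H : TiltedSum ϱ K δ Θ ε₀ η s y M n J) {w q B B' Λ U σ : ℝ} {F : ℝ → ℝ}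
    (hw : 0 < w) (hwJ : 16 * J * s ≤ w) (hq : 0 ≤ q) (hB : 0 ≤ B) (hB' : 0 ≤ B') (hU : 0 ≤ U)
    (hΛ1 : Λ ≤ w ^ 2 / (16 * n)) (hΛ2 : Λ ≤ η * s * w / 4)
    (hqn : 64 * q * n ≤ 1) (hqU : 16 * q * U ≤ η * s) (hσ0 : 0 ≤ σ) (hσ : (1 + η) * σ ≤ Θ)
    (hF0 : ∀ t, 0 ≤ F t)
    (hmid : ∀ t, |t - y| ≤ U → F t ≤ B * Real.exp (s * (t - y) + q * (t - y) ^ 2))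
    (hleft : ∀ t, t - y ≤ -U → F t ≤ B * Real.exp (-(s * U) + q * U ^ 2))
    (hright : ∀ t, U ≤ t - y → F t ≤ B' * Real.exp (σ * t)) :
    ∫ t, F t ∂ϱ ≤ B * (Real.exp (q * w ^ 2 + (M * K s - s * y + ε₀))
        + 2 * (U / w + 1) * Real.exp (M * K s - s * y + ε₀ - Λ)
        + Real.exp (-(s * U) + q * U ^ 2))
      + B' * Real.exp (-(η * σ * U) + M * K ((1 + η) * σ) + ε₀) := by
  have hn : (0 : ℝ) < n := by exact_mod_cast H.n_pos
  have hs := H.s_pos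
  have hη := H.η_pos
  have hy := H.y_nonneg
  have : IsFiniteMeasure ϱ := ⟨H.mass_le.trans_lt (by simp)⟩
  set l : ℕ → ℝ := fun k => min ((k + 1 : ℕ) * w / (4 * n)) (η * s) with hl
  set v : ℕ → ℝ := fun k => (k + 1 : ℕ) * w with hv
  have hv0 : ∀ k, 0 < v k := fun k => by simp only [hv]; positivity
  have hvw : ∀ k, w ≤ v k := fun k => by
    simp only [hv]; push_cast; nlinarith [(Nat.cast_nonneg k : (0 : ℝ) ≤ k)]
  obtain ⟨i5, -, i6⟩ := H.integral_tilt
  have hl0 : ∀ k, 0 ≤ l k := fun k => by simp only [hl]; positivity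
  set m := ⌊U / w⌋₊ with hm
  -- the blocks that are needed end before `2 U`
  have hvU : ∀ k ∈ Finset.range m, v k ≤ U := by
    intro k hk
    have e1 : ((k + 1 : ℕ) : ℝ) ≤ U / w :=
      (Nat.cast_le.2 (Nat.succ_le_of_lt (Finset.mem_range.1 hk))).trans
        (Nat.floor_le (by positivity))
    rwa [le_div_iff₀ hw] at e1
  set g : ℕ → ℝ → ℝ := fun k t => Real.exp (4 * q * v k ^ 2)
    * (Real.exp ((s + l k) * (t - y) - l k * v k)
    + Real.exp ((s - l k) * (t - y) - l k * v k)) with hgdef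
  have hg0 : ∀ k t, 0 ≤ g k t := fun k t => by simp only [hgdef]; positivity
  have hblock : ∀ k ∈ Finset.range m, Integrable (g k) ϱ ∧
      ∫ t, g k t ∂ϱ ≤ 2 * Real.exp (M * K s - s * y + ε₀ - Λ) := fun k hk =>
    H.integral_block_le (hv0 k) (hwJ.trans (hvw k)) (l := l k) rfl
      (hΛ1.trans (by have := hvw k; gcongr)) (hΛ2.trans (by have := hvw k; gcongr)) hqn
      (le_trans (by have := hvU k hk; gcongr) hqU)
  set G₁ : ℝ → ℝ := fun t => Real.exp (q * w ^ 2) * Real.exp (s * (t - y)) with hG₁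
  set G₂ : ℝ → ℝ := fun t => ∑ k ∈ Finset.range m, g k t with hG₂
  set G₃ : ℝ → ℝ := fun _ => Real.exp (-(s * U) + q * U ^ 2) with hG₃
  set G₄ : ℝ → ℝ := fun t => Real.exp (-(η * σ * U)) * Real.exp ((1 + η) * σ * t) with hG₄
  have hG₁int : Integrable G₁ ϱ := i5.const_mul _
  have hG₂int : Integrable G₂ ϱ := integrable_finsetSum _ fun k hk => (hblock k hk).1
  have hG₃int : Integrable G₃ ϱ := integrable_const _
  obtain ⟨j1, -, j2⟩ := H.mgf ((1 + η) * σ) (by positivity) hσ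
  have hG₄int : Integrable G₄ ϱ := j1.const_mul _
  have hG₁0 : ∀ t, 0 ≤ G₁ t := fun t => by simp only [hG₁]; positivity
  have hG₂0 : ∀ t, 0 ≤ G₂ t := fun t => Finset.sum_nonneg fun k _ => hg0 k t
  have hG₃0 : ∀ t, 0 ≤ G₃ t := fun t => by simp only [hG₃]; positivity
  have hG₄0 : ∀ t, 0 ≤ G₄ t := fun t => by simp only [hG₄]; positivity
  have hpt : ∀ t, F t ≤ B * (G₁ t + G₂ t + G₃ t) + B' * G₄ t := by
    intro t
    rcases le_or_gt (t - y) (-U) with h1 | h1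
    · calc F t ≤ B * G₃ t := hleft t h1
        _ = B * (0 + 0 + G₃ t) + 0 := by ring
        _ ≤ _ := by
          gcongr
          · exact hG₁0 t
          · exact hG₂0 t
          · exact mul_nonneg hB' (hG₄0 t)
    rcases le_or_gt U (t - y) with h2 | h2
    · calc F t ≤ B' * Real.exp (σ * t) := hright t h2
        _ ≤ 0 + B' * G₄ t := by
          rw [zero_add]
          simp only [hG₄]
          gcongr
          rw [← Real.exp_add, Real.exp_le_exp]
          have : η * σ * U ≤ η * σ * t := by gcongr; linarith
          linarith
        _ ≤ _ := by
          gcongr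
          exact mul_nonneg hB (by linarith [hG₁0 t, hG₂0 t, hG₃0 t])
    have habs : |t - y| < U := abs_lt.2 ⟨h1, h2⟩
    refine (hmid t habs.le).trans (le_trans ?_ (le_add_of_nonneg_right
      (mul_nonneg hB' (hG₄0 t))))
    gcongr
    rcases le_or_gt |t - y| w with h3 | h3
    · have e1 : (t - y) ^ 2 ≤ w ^ 2 := sq_le_sq' (abs_le.1 h3).1 (abs_le.1 h3).2
      calc Real.exp (s * (t - y) + q * (t - y) ^ 2) ≤ G₁ t := by
            simp only [hG₁]
            rw [← Real.exp_add, Real.exp_le_exp]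
            have : q * (t - y) ^ 2 ≤ q * w ^ 2 := by gcongr
            linarith
        _ ≤ _ := by linarith [hG₂0 t, hG₃0 t]
    · -- the block of `t`
      -- The shift by one matches `v k = (k + 1) * w`; since `w ≤ v k`, the block `[v k, v k + w]`
      -- lies in `[v k, 2 v k]`.
      set k := ⌊|t - y| / w⌋₊ - 1 with hk
      have e1 : 1 ≤ ⌊|t - y| / w⌋₊ := Nat.le_floor (by
        rw [le_div_iff₀ hw]; push_cast; linarith)
      have e2 : k + 1 = ⌊|t - y| / w⌋₊ := by omega
      have e3 : k ∈ Finset.range m := by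
        have : ⌊|t - y| / w⌋₊ ≤ m := Nat.floor_le_floor (by gcongr)
        rw [Finset.mem_range]; omega
      have e4 : v k ≤ |t - y| := by
        have := Nat.floor_le (show 0 ≤ |t - y| / w by positivity)
        rw [← e2, le_div_iff₀ hw] at this
        exact this
      have e5 : |t - y| ≤ 2 * v k := by
        have := Nat.lt_floor_add_one (|t - y| / w)
        rw [← e2, div_lt_iff₀ hw] at this
        have h6 := hvw k
        have h7 : (((k + 1 : ℕ) : ℝ) + 1) * w = v k + w := by simp only [hv]; ring
        linarith
      have e6 : (t - y) ^ 2 ≤ 4 * v k ^ 2 := by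
        rw [← sq_abs]
        calc |t - y| ^ 2 ≤ (2 * v k) ^ 2 := by gcongr
          _ = _ := by ring
      have e7 : Real.exp (s * (t - y) + q * (t - y) ^ 2) ≤ g k t := by
        have e8 : q * (t - y) ^ 2 ≤ 4 * q * v k ^ 2 := by nlinarith
        have e9 := hl0 k
        simp only [hgdef, mul_add, ← Real.exp_add]
        rcases le_total 0 (t - y) with h | h
        · rw [abs_of_nonneg h] at e4
          refine le_add_of_le_of_nonneg ?_ (Real.exp_pos _).le
          rw [Real.exp_le_exp]
          nlinarith
        · rw [abs_of_nonpos h] at e4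
          refine le_add_of_nonneg_of_le (Real.exp_pos _).le ?_
          rw [Real.exp_le_exp]
          nlinarith
      calc Real.exp (s * (t - y) + q * (t - y) ^ 2) ≤ _ := e7
        _ ≤ G₂ t := Finset.single_le_sum (f := fun k => g k t) (fun k _ => hg0 k t) e3
        _ ≤ _ := by linarith [hG₁0 t, hG₃0 t]
  have hG₁₂ : Integrable (fun t => G₁ t + G₂ t) ϱ := hG₁int.add hG₂int
  have hG₁₂₃ : Integrable (fun t => G₁ t + G₂ t + G₃ t) ϱ := hG₁₂.add hG₃int
  have hI : ∫ t, (B * (G₁ t + G₂ t + G₃ t) + B' * G₄ t) ∂ϱ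
      = B * (∫ t, G₁ t ∂ϱ + ∫ t, G₂ t ∂ϱ + ∫ t, G₃ t ∂ϱ) + B' * ∫ t, G₄ t ∂ϱ := by
    rw [integral_add (hG₁₂₃.const_mul B) (hG₄int.const_mul B'), integral_const_mul,
      integral_const_mul, integral_add hG₁₂ hG₃int, integral_add hG₁int hG₂int]
  refine (integral_mono_of_nonneg (ae_of_all _ hF0)
    ((hG₁₂₃.const_mul B).add (hG₄int.const_mul B')) (ae_of_all _ hpt)).trans ?_
  change ∫ t, (B * (G₁ t + G₂ t + G₃ t) + B' * G₄ t) ∂ϱ ≤ _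
  rw [hI]
  have b1 : ∫ t, G₁ t ∂ϱ ≤ Real.exp (q * w ^ 2 + (M * K s - s * y + ε₀)) := by
    rw [hG₁, integral_const_mul, Real.exp_add]
    gcongr
  have b2 : ∫ t, G₂ t ∂ϱ ≤ 2 * (U / w + 1) * Real.exp (M * K s - s * y + ε₀ - Λ) := by
    rw [hG₂, integral_finsetSum _ fun k hk => (hblock k hk).1]
    refine (Finset.sum_le_sum fun k hk => (hblock k hk).2).trans ?_
    rw [Finset.sum_const, Finset.card_range, nsmul_eq_mul]
    have : (m : ℝ) ≤ U / w + 1 := (Nat.floor_le (by positivity)).trans (by linarith)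
    calc (m : ℝ) * (2 * Real.exp (M * K s - s * y + ε₀ - Λ))
        ≤ (U / w + 1) * (2 * Real.exp (M * K s - s * y + ε₀ - Λ)) := by gcongr
      _ = _ := by ring
  have b3 : ∫ t, G₃ t ∂ϱ ≤ Real.exp (-(s * U) + q * U ^ 2) := by
    rw [hG₃, integral_const, smul_eq_mul]
    refine mul_le_of_le_one_left (Real.exp_pos _).le ?_
    rw [measureReal_def]
    exact ENNReal.toReal_le_of_le_ofReal zero_le_one (by simpa using H.mass_le)
  have b4 : ∫ t, G₄ t ∂ϱ ≤ Real.exp (-(η * σ * U) + M * K ((1 + η) * σ) + ε₀) := by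
    rw [hG₄, integral_const_mul, add_assoc, Real.exp_add]
    gcongr
  gcongr

end TiltedSum

/-! ### Bounds for the probability at a fixed level -/

/-- The estimates at a level `x` from which the asymptotics of `P[S > x]` follow, for sums of at
most `nb` terms. The derivative of `R` lies between `sl` and `sh` near `x`. -/
structure LevelEstimates (ν : Measure ℝ) (K R α : ℝ → ℝ)
    (a δ s₀ η ε B c x sl sh q nb w₀ U Λ : ℝ) : Prop where
  x_pos : 0 < x
  η_pos : 0 < η
  η_le_one : η ≤ 1
  ε_pos : 0 < ε
  ε_le : ε ≤ 1 / 4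
  ε_le_a : ε ≤ a
  nearSquare : IsNearSquare K δ
  δ_le : δ ≤ s₀
  hasDerivAt : ∀ u ∈ Icc (x / 2) (2 * x), HasDerivAt R (deriv R u) u
  hasDerivAt_deriv : ∀ u ∈ Icc (x / 2) (2 * x), HasDerivAt (deriv R) (deriv (deriv R) u) u
  sl_pos : 0 < sl
  deriv_bounds : ∀ u ∈ Icc (x / 2) (2 * x), sl ≤ deriv R u ∧ deriv R u ≤ sh
  deriv_le_div : ∀ u ∈ Icc (x / 2) (2 * x), deriv R u ≤ R u / u
  deriv2_le : ∀ u ∈ Icc (x / 2) (2 * x), |deriv (deriv R) u| ≤ q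
  le_R : ∀ z ∈ Icc (x / 2) x, z / x * R x ≤ R z
  R_pos : 0 < R x
  le_ratio : sl ≤ R x / x
  ratio_le : R x / x ≤ sh
  half : (1 + η) * R x ≤ 2 * R (x / 2)
  tail : ∀ z, x / 2 ≤ z → ν.real (Ioi z) = α z * Real.exp (-R z) ∧ |α z - a| ≤ ε
  deriv_K_le : ∀ s ∈ Icc 0 s₀, |deriv K s| ≤ B
  le_legendre : ∀ s ∈ Icc δ s₀, c ≤ s * deriv K s - K s
  nb_mul_B : nb * B ≤ η / 4 * x
  two_sh : 2 * sh ≤ δ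
  B_mul_sh : B * sh ≤ c
  mgf : ∀ N : ℕ, N ≤ nb → ∀ θ, 0 ≤ θ → θ ≤ (1 + η) * (R x / x) →
    Integrable (fun t => Real.exp (θ * t)) (convPow (ν.restrict (Iic (x / 2))) N) ∧
    Real.exp (N * K θ - ε) ≤ ∫ t, Real.exp (θ * t) ∂(convPow (ν.restrict (Iic (x / 2))) N) ∧
    ∫ t, Real.exp (θ * t) ∂(convPow (ν.restrict (Iic (x / 2))) N) ≤ Real.exp (N * K θ + ε)
  -- Three scales govern the deviations from `y`: within `w₀` the parabola `q v²` is negligible;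
  -- beyond `w₀` the tilts `s ± l` gain at least `Λ`; beyond `U` cruder bounds suffice, while up to
  -- `U` the parabola is dominated by the gain of these tilts.
  q_mul_nb : 512 * q * nb ≤ 1
  q_mul_sq : 2 * q * w₀ ^ 2 ≤ ε
  q_mul_U : 64 * q * U ≤ η * sl
  U_exp : (U + 1) * Real.exp (1 - Λ) ≤ ε
  Λ_nb : 16 * Λ * nb ≤ w₀ ^ 2
  Λ_sl : 16 * Λ ≤ η * sl * w₀
  Λ_nonneg : 0 ≤ Λ
  one_le_w₀ : 1 ≤ w₀
  U_nonneg : 0 ≤ U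
  U_le : U ≤ x / 4
  w_le : w₀ + 16 * nb * sh ≤ x / 4
  exp_U : Real.exp (-(η / 8 * sl * U) + 4 * nb * sh ^ 2 + 1) ≤ ε
  exp_R : Real.exp (-(η * R x) + 4 * nb * sh ^ 2 + 1) ≤ ε
  nb_exp_R : nb * (a + 1) ^ 2 * Real.exp (-(η * R x)) ≤ ε

namespace LevelEstimates

variable {ν : Measure ℝ} {K R α : ℝ → ℝ} {a δ s₀ η ε B c x sl sh q nb w₀ U Λ : ℝ}

theorem x_mem (H : LevelEstimates ν K R α a δ s₀ η ε B c x sl sh q nb w₀ U Λ) :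
    x ∈ Icc (x / 2) (2 * x) := ⟨by linarith [H.x_pos], by linarith [H.x_pos]⟩

theorem q_nonneg (H : LevelEstimates ν K R α a δ s₀ η ε B c x sl sh q nb w₀ U Λ) : 0 ≤ q :=
  (abs_nonneg _).trans (H.deriv2_le x H.x_mem)

theorem R_mono (H : LevelEstimates ν K R α a δ s₀ η ε B c x sl sh q nb w₀ U Λ) :
    MonotoneOn R (Icc (x / 2) (2 * x)) :=
  monotoneOn_of_deriv_nonneg (convex_Icc _ _)
    (fun u hu => (H.hasDerivAt u hu).continuousAt.continuousWithinAt)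
    (fun u hu => (H.hasDerivAt u (interior_subset hu)).differentiableAt.differentiableWithinAt)
    (fun u hu => H.sl_pos.le.trans (H.deriv_bounds u (interior_subset hu)).1)

theorem tail_le (H : LevelEstimates ν K R α a δ s₀ η ε B c x sl sh q nb w₀ U Λ) {z : ℝ}
    (hz : x / 2 ≤ z) : ν.real (Ioi z) ≤ (a + ε) * Real.exp (-R z) := by
  obtain ⟨e1, e2⟩ := H.tail z hz
  rw [e1]
  gcongr
  linarith [(abs_le.1 e2).2]

theorem le_tail (H : LevelEstimates ν K R α a δ s₀ η ε B c x sl sh q nb w₀ U Λ) {z : ℝ}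
    (hz : x / 2 ≤ z) : (a - ε) * Real.exp (-R z) ≤ ν.real (Ioi z) := by
  obtain ⟨e1, e2⟩ := H.tail z hz
  rw [e1]
  gcongr
  linarith [(abs_le.1 e2).1]

/-- Everything that is needed about the critical tilt. -/
theorem exists_tilt [IsProbabilityMeasure ν]
    (H : LevelEstimates ν K R α a δ s₀ η ε B c x sl sh q nb w₀ U Λ) {n M J : ℕ}
    (hn : n ≤ nb) (hM : M < n) (hJ : n ≤ M + 2 * J) :
    ∃ s y : ℝ, sl ≤ s ∧ s ≤ sh ∧ s ≤ 2 * deriv R x ∧ s = deriv R (x - y) ∧ 0 ≤ y ∧ y ≤ x / 4 ∧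
      rate R K s₀ n x = R (x - y) + s * y - n * K s ∧ rate R K s₀ n x ≤ R x ∧
      s * y - n * K s ≤ n * s ^ 2 ∧ 0 ≤ K s ∧ K s ≤ s ^ 2 ∧
      TiltedSum (convPow (ν.restrict (Iic (x / 2))) M) K δ ((1 + η) * (R x / x)) ε (η / 4) s y
        M n J := by
  have hx := H.x_pos
  have hη := H.η_pos
  have hη1 := H.η_le_one
  have hq := H.q_nonneg
  have hsh : 0 < sh := H.sl_pos.trans_le ((H.deriv_bounds x H.x_mem).1.trans
    (H.deriv_bounds x H.x_mem).2)
  have hB0 : 0 ≤ B := (abs_nonneg _).trans (H.deriv_K_le 0 ⟨le_rfl,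
    H.nearSquare.δ_pos.le.trans H.δ_le⟩)
  have hn0 : (0 : ℝ) ≤ n := Nat.cast_nonneg n
  have hnB : n * B ≤ η / 4 * x := (mul_le_mul_of_nonneg_right hn hB0).trans H.nb_mul_B
  have hnB4 : n * B ≤ x / 4 := hnB.trans (by nlinarith)
  have hqn : 512 * q * n ≤ 1 := le_trans (by gcongr) H.q_mul_nb
  obtain ⟨s, hs, hscrit, hrate, hrate'⟩ := rate_eq_of_critical (n := n) H.nearSquare H.δ_le hx
    H.hasDerivAt H.hasDerivAt_deriv
    (fun u hu => ⟨H.sl_pos.trans_le (H.deriv_bounds u hu).1, (H.deriv_bounds u hu).2⟩)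
    H.deriv2_le H.deriv_K_le H.le_legendre hnB4
    (by linarith [H.two_sh]) (by nlinarith) H.B_mul_sh
  have hsδ : s ∈ Icc 0 δ := Ioo_subset_Icc_self hs
  set y := n * deriv K s with hy
  have hK' := H.nearSquare.deriv_bounds hsδ
  have hK'0 : 0 ≤ deriv K s := by linarith [hK'.1, hs.1]
  have hy0 : 0 ≤ y := by positivity
  have hyη : y ≤ η / 4 * x := le_trans (mul_le_mul_of_nonneg_left
    ((le_abs_self _).trans (H.deriv_K_le s ⟨hs.1.le, hs.2.le.trans H.δ_le⟩)) hn0) hnB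
  have hy4 : y ≤ x / 4 := hyη.trans (by nlinarith)
  have hxy : x - y ∈ Icc (x / 2) (2 * x) := ⟨by linarith, by linarith⟩
  have hsb := H.deriv_bounds _ hxy
  rw [← hscrit] at hsb
  have hKb := H.nearSquare.bounds hsδ
  have hL := H.nearSquare.legendre_bounds hsδ
  -- From `s = R' (x - y) ≤ R (x - y) / (x - y) ≤ R x / ((1 - η / 4) x)` and `(1 + η) (1 - η / 4) ≥
  -- 1 + η / 4`. This is the room for the tilts `s ± l`.
  have hsσ : (1 + η / 4) * s ≤ (1 + η) * (R x / x) := by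
    have e1 := H.deriv_le_div _ hxy
    rw [← hscrit, le_div_iff₀ (by linarith)] at e1
    have e2 : R (x - y) ≤ R x := H.R_mono hxy H.x_mem (by linarith)
    have e3 : s * ((1 - η / 4) * x) ≤ R x :=
      le_trans (mul_le_mul_of_nonneg_left (by linarith) hs.1.le) (e1.trans e2)
    rw [← mul_div_assoc, le_div_iff₀ hx]
    have e4 : (1 + η / 4) * s * x ≤ (1 + η) * (s * ((1 - η / 4) * x)) := by
      have : 0 ≤ s * x := mul_nonneg hs.1.le hx.le
      nlinarith [mul_nonneg this hη.le]
    exact e4.trans (by gcongr)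
  refine ⟨s, y, hsb.1, hsb.2, ?_, hscrit, hy0, hy4, ?_, hrate', ?_, by nlinarith [sq_nonneg s],
    hKb.2, ?_⟩
  · have e1 := (taylor_bounds_of_deriv2_le H.hasDerivAt H.hasDerivAt_deriv H.deriv2_le hxy
      H.x_mem).1
    rw [← hscrit, sub_sub_cancel, abs_of_nonneg hy0] at e1
    have e2 : q * y ≤ s / 2 := by
      calc q * y ≤ q * (n * (2 * s)) := by rw [hy]; gcongr; exact hK'.2
        _ = (512 * q * n) * s / 256 := by ring
        _ ≤ 1 * s / 256 := by have := hs.1; gcongr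
        _ ≤ s / 2 := by linarith [hs.1]
    linarith [(abs_le.1 (e1.trans e2)).1]
  · rw [hrate, hy]; ring
  · rw [hy]
    calc s * (n * deriv K s) - n * K s = n * (s * deriv K s - K s) := by ring
      _ ≤ n * s ^ 2 := by gcongr; exact hL.2
  · have hMnb : (M : ℝ) ≤ nb := le_trans (by exact_mod_cast hM.le) hn
    refine ⟨H.nearSquare, ?_, ?_, H.mgf M hMnb, by positivity, by linarith, hs.1, hsσ, hy,
      hM.le, hJ, by omega⟩
    · calc (1 + η) * (R x / x) ≤ 2 * sh := by
            have := H.ratio_le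
            have : 0 ≤ R x / x := H.sl_pos.le.trans H.le_ratio
            gcongr
            linarith
        _ ≤ δ := H.two_sh
    · rw [convPow_univ]
      refine pow_le_one₀ zero_le ?_
      rw [Measure.restrict_apply .univ, univ_inter]
      exact prob_le_one

/-- Only the one-jump term is kept, and in it only the deviations up to `w = w₀ + 16 J s`, where the
tangent parabola bounds `R` from above. The shift `16 J s` covers the displacement of the mean
caused by `M < n`. -/
theorem lower_bound [IsProbabilityMeasure ν]
    (H : LevelEstimates ν K R α a δ s₀ η ε B c x sl sh q nb w₀ U Λ) {n M J : ℕ}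
    (hn : n ≤ nb) (hM : M < n) (hJ : n ≤ M + 2 * J) (hJn : J ≤ n) (hMε : (1 - ε) * n ≤ M + 1) :
    (1 - ε) * (a - ε) * Real.exp (-ε) * (Real.exp (-ε) - 2 * ε)
      * (n * Real.exp (-rate R K s₀ n x - 12 * J * deriv R x ^ 2))
      ≤ (convPow ν (M + 1)).real (Ioi x) := by
  obtain ⟨s, y, hsl, hsh, hsx, hscrit, hy0, hy4, hrate, -, -, hK0, hK2, hT⟩ := H.exists_tilt hn hM hJ
  have hx := H.x_pos
  have hη := H.η_pos
  have hq := H.q_nonneg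
  have hs0 : 0 < s := H.sl_pos.trans_le hsl
  have hn0 : (0 : ℝ) < n := by exact_mod_cast (by omega : 0 < n)
  have hJn' : (J : ℝ) ≤ n := by exact_mod_cast hJn
  have hJ0 : (0 : ℝ) ≤ J := Nat.cast_nonneg J
  have hw₀ := H.one_le_w₀
  set w := w₀ + 16 * J * s with hw
  have hww : w₀ ≤ w := by rw [hw]; have : 0 ≤ 16 * J * s := by positivity
                          linarith
  have hwx : w ≤ x / 4 := by
    refine le_trans ?_ H.w_le
    rw [hw]
    have h1 : (J : ℝ) ≤ nb := hJn'.trans hn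
    have h2 : 0 ≤ nb := hJ0.trans h1
    gcongr
  have hqw : q * w ^ 2 ≤ ε + J * s ^ 2 := by
    have e1 : w ^ 2 ≤ 2 * w₀ ^ 2 + 512 * J ^ 2 * s ^ 2 := by
      rw [hw]; nlinarith [sq_nonneg (w₀ - 16 * J * s)]
    have e2 : 512 * q * J ≤ 1 := le_trans (by have := hJn'.trans hn; gcongr) H.q_mul_nb
    calc q * w ^ 2 ≤ q * (2 * w₀ ^ 2 + 512 * J ^ 2 * s ^ 2) := by gcongr
      _ = 2 * q * w₀ ^ 2 + (512 * q * J) * (J * s ^ 2) := by ring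
      _ ≤ ε + 1 * (J * s ^ 2) := by gcongr; exact H.q_mul_sq
      _ = _ := by ring
  set F : ℝ → ℝ := fun t => ν.real (Ioi (max (x / 2) (x - t))) with hF
  have hF0 : ∀ t, 0 ≤ F t := fun t => measureReal_nonneg
  have hFm : Measurable F := by
    have : Antitone fun v : ℝ => ν.real (Ioi v) := fun a b hab =>
      measureReal_mono (Ioi_subset_Ioi hab)
    exact this.measurable.comp (measurable_const.max (measurable_const.sub measurable_id))
  have hFint : Integrable F (convPow (ν.restrict (Iic (x / 2))) M) :=
    Integrable.of_bound hFm.aestronglyMeasurable 1 (ae_of_all _ fun t => by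
      rw [Real.norm_of_nonneg (hF0 t)]; exact measureReal_le_one)
  have hxy : x - y ∈ Icc (x / 2) (2 * x) := ⟨by linarith, by linarith⟩
  have hFlow : ∀ t, |t - y| ≤ w → ((a - ε) * Real.exp (-R (x - y)))
      * Real.exp (s * (t - y) - q * (t - y) ^ 2) ≤ F t := by
    intro t ht
    have h1 := (abs_le.1 ht).1
    have h2 := (abs_le.1 ht).2
    have hmem : x - t ∈ Icc (x / 2) (2 * x) := ⟨by linarith, by linarith⟩
    have e1 := (taylor_bounds_of_deriv2_le H.hasDerivAt H.hasDerivAt_deriv H.deriv2_le hxy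
      hmem).2
    rw [← hscrit, show x - t - (x - y) = -(t - y) by ring, neg_sq] at e1
    have e2 : F t = ν.real (Ioi (x - t)) := by simp only [hF]; rw [max_eq_right hmem.1]
    rw [e2]
    refine le_trans ?_ (H.le_tail hmem.1)
    rw [mul_assoc, ← Real.exp_add]
    have := H.ε_le_a
    gcongr
    linarith [(abs_le.1 e1).2]
  have hΛ1 : Λ ≤ w ^ 2 / (16 * n) := by
    rw [le_div_iff₀ (by positivity)]
    calc Λ * (16 * n) = 16 * Λ * n := by ring
      _ ≤ 16 * Λ * nb := by have := H.Λ_nonneg; gcongr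
      _ ≤ w₀ ^ 2 := H.Λ_nb
      _ ≤ w ^ 2 := by gcongr
  have hΛ2 : Λ ≤ η / 4 * s * w / 4 := by
    have : η * sl * w₀ ≤ η * s * w := by gcongr
    linarith [H.Λ_sl]
  have key := hT.le_integral (w := w) (q := q) (Λ := Λ) (by linarith)
    (by rw [hw]; linarith) hq (mul_nonneg (by linarith [H.ε_le_a]) (Real.exp_pos _).le)
    hΛ1 hΛ2 hFint hF0 hFlow
  refine le_trans ?_ (convPow_Ioi_bounds ν (x / 2) x M).1
  have hεb : (0 : ℝ) ≤ Real.exp (-ε) - 2 * ε := by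
    have := Real.add_one_le_exp (-ε)
    linarith [H.ε_le]
  have hexpΛ : Real.exp (ε - Λ) ≤ ε := by
    calc Real.exp (ε - Λ) ≤ Real.exp (1 - Λ) := by gcongr; linarith [H.ε_le]
      _ ≤ (U + 1) * Real.exp (1 - Λ) := le_mul_of_one_le_left (Real.exp_pos _).le
        (by linarith [H.U_nonneg])
      _ ≤ ε := H.U_exp
  -- The constant `12`: replacing `n K s` by `M K s` costs `2 J s²`, the parabola costs another `J
  -- s²`, and `s ≤ 2 R' x` turns `3 J s²` into `12 J (R' x)²`.
  have hexp : Real.exp (-rate R K s₀ n x - 12 * J * deriv R x ^ 2) * Real.exp (-ε)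
      ≤ Real.exp (-R (x - y)) * Real.exp (-(q * w ^ 2)) * Real.exp (M * K s - s * y) := by
    rw [← Real.exp_add, ← Real.exp_add, ← Real.exp_add, Real.exp_le_exp, hrate]
    have e1 : (n : ℝ) * K s ≤ M * K s + 2 * (J * s ^ 2) := by
      have : (n : ℝ) ≤ M + 2 * J := by exact_mod_cast hJ
      calc (n : ℝ) * K s ≤ (M + 2 * J) * K s := by gcongr
        _ = M * K s + 2 * (J * K s) := by ring
        _ ≤ _ := by gcongr
    have e2 : J * s ^ 2 ≤ J * (2 * deriv R x) ^ 2 := by gcongr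
    have e3 : J * (2 * deriv R x) ^ 2 = 4 * J * deriv R x ^ 2 := by ring
    linarith
  have ha : 0 ≤ a - ε := by linarith [H.ε_le_a]
  calc (1 - ε) * (a - ε) * Real.exp (-ε) * (Real.exp (-ε) - 2 * ε)
        * (n * Real.exp (-rate R K s₀ n x - 12 * J * deriv R x ^ 2))
      = ((1 - ε) * n) * ((a - ε) * (Real.exp (-rate R K s₀ n x - 12 * J * deriv R x ^ 2)
          * Real.exp (-ε)) * (Real.exp (-ε) - 2 * ε)) := by ring
    _ ≤ (M + 1) * ((a - ε) * (Real.exp (-R (x - y)) * Real.exp (-(q * w ^ 2))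
          * Real.exp (M * K s - s * y)) * (Real.exp (-ε) - 2 * Real.exp (ε - Λ))) := by
        gcongr
    _ = (M + 1) * ((a - ε) * Real.exp (-R (x - y)) * Real.exp (-(q * w ^ 2))
          * Real.exp (M * K s - s * y) * (Real.exp (-ε) - 2 * Real.exp (ε - Λ))) := by ring
    _ ≤ _ := by gcongr

/-- Markov's inequality at the largest admissible tilt `θ = (1 + η) R x / x`: then `θ x = (1 + η) R
x`, and the surplus `η R x` exceeds `N K θ ≤ 4 nb sh²` by enough. -/
theorem no_jump_le [IsProbabilityMeasure ν]
    (H : LevelEstimates ν K R α a δ s₀ η ε B c x sl sh q nb w₀ U Λ) {N : ℕ} (hN : N ≤ nb) :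
    (convPow (ν.restrict (Iic (x / 2))) N).real (Ioi x) ≤ ε * Real.exp (-R x) := by
  set θ := (1 + η) * (R x / x) with hθ
  have hx := H.x_pos
  have hη := H.η_pos
  have hσ0 : 0 < R x / x := H.sl_pos.trans_le H.le_ratio
  have hθ0 : 0 ≤ θ := by positivity
  obtain ⟨i1, -, i2⟩ := H.mgf N hN θ hθ0 le_rfl
  have hθsh : θ ≤ 2 * sh := by
    rw [hθ]
    have := H.ratio_le
    gcongr
    linarith [H.η_le_one]
  have hKθ : K θ ≤ 4 * sh ^ 2 := by
    refine (H.nearSquare.bounds ⟨hθ0, hθsh.trans H.two_sh⟩).2.trans ?_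
    calc θ ^ 2 ≤ (2 * sh) ^ 2 := by gcongr
      _ = _ := by ring
  have e1 := ProbabilityTheory.measure_ge_le_exp_mul_mgf (X := id) x hθ0 i1
  have e2 : (convPow (ν.restrict (Iic (x / 2))) N).real (Ioi x)
      ≤ (convPow (ν.restrict (Iic (x / 2))) N).real {t | x ≤ id t} :=
    measureReal_mono fun t (ht : x < t) => ht.le
  refine e2.trans (e1.trans ?_)
  rw [ProbabilityTheory.mgf]
  simp only [id]
  have e3 : (N : ℝ) * K θ ≤ 4 * nb * sh ^ 2 := by
    calc (N : ℝ) * K θ ≤ N * (4 * sh ^ 2) := by gcongr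
      _ ≤ nb * (4 * sh ^ 2) := by gcongr
      _ = _ := by ring
  have e4 : θ * x = (1 + η) * R x := by rw [hθ]; field_simp
  calc Real.exp (-θ * x) * ∫ t, Real.exp (θ * t) ∂(convPow (ν.restrict (Iic (x / 2))) N)
      ≤ Real.exp (-θ * x) * Real.exp (N * K θ + ε) := by gcongr
    _ ≤ Real.exp (-(η * R x) + 4 * nb * sh ^ 2 + 1) * Real.exp (-R x) := by
        rw [← Real.exp_add, ← Real.exp_add, Real.exp_le_exp]
        linarith [H.ε_le]
    _ ≤ _ := by gcongr; exact H.exp_R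

-- In the one-jump integral only the central window contributes at the order `exp (-I)`; the other
-- three ranges, no jump and two jumps each add at most a small multiple of the main term. Far to
-- the left `s y - n K s ≤ n s²` converts `R (x - y)` into the rate; far to the right `I ≤ R x`
-- does.
set_option maxHeartbeats 1000000 in
theorem upper_bound [IsProbabilityMeasure ν]
    (H : LevelEstimates ν K R α a δ s₀ η ε B c x sl sh q nb w₀ U Λ) {n M J : ℕ}
    (hn : n ≤ nb) (hM : M < n) (hJ : n ≤ M + 2 * J) (hJn : J ≤ n) :
    (convPow ν (M + 1)).real (Ioi x) ≤
    ((a + ε) * (Real.exp (2 * ε) + 4 * ε) + 2 * ε)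
      * (n * Real.exp (-rate R K s₀ n x + 12 * J * deriv R x ^ 2)) := by
  obtain ⟨s, y, hsl, hsh, hsx, hscrit, hy0, hy4, hrate, hrateR, hL, hK0, hK2, hT⟩ :=
    H.exists_tilt hn hM hJ
  have hx := H.x_pos
  have hη := H.η_pos
  have hq := H.q_nonneg
  have hε := H.ε_pos
  have hs0 : 0 < s := H.sl_pos.trans_le hsl
  have hn1 : (1 : ℝ) ≤ n := by exact_mod_cast (by omega : 1 ≤ n)
  have hMn : (M : ℝ) + 1 ≤ n := by exact_mod_cast hM
  have hJn' : (J : ℝ) ≤ n := by exact_mod_cast hJn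
  have hJ0 : (0 : ℝ) ≤ J := Nat.cast_nonneg J
  have hw₀ := H.one_le_w₀
  have hU := H.U_nonneg
  have ha : 0 ≤ a + ε := by linarith [H.ε_le_a]
  have hσ0 : 0 < R x / x := H.sl_pos.trans_le H.le_ratio
  set w := w₀ + 16 * J * s with hw
  have hww : w₀ ≤ w := by rw [hw]; have : 0 ≤ 16 * J * s := by positivity
                          linarith
  have hqw : q * w ^ 2 ≤ ε + J * s ^ 2 := by
    have e1 : w ^ 2 ≤ 2 * w₀ ^ 2 + 512 * J ^ 2 * s ^ 2 := by
      rw [hw]; nlinarith [sq_nonneg (w₀ - 16 * J * s)]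
    have e2 : 512 * q * J ≤ 1 := le_trans (by have := hJn'.trans hn; gcongr) H.q_mul_nb
    calc q * w ^ 2 ≤ q * (2 * w₀ ^ 2 + 512 * J ^ 2 * s ^ 2) := by gcongr
      _ = 2 * q * w₀ ^ 2 + (512 * q * J) * (J * s ^ 2) := by ring
      _ ≤ ε + 1 * (J * s ^ 2) := by gcongr; exact H.q_mul_sq
      _ = _ := by ring
  set F : ℝ → ℝ := fun t => ν.real (Ioi (max (x / 2) (x - t))) with hF
  have hF0 : ∀ t, 0 ≤ F t := fun t => measureReal_nonneg
  have hxy : x - y ∈ Icc (x / 2) (2 * x) := ⟨by linarith, by linarith⟩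
  have htay : ∀ v, |v| ≤ x / 4 → -R (x - y - v) ≤ -R (x - y) + (s * v + q * v ^ 2) := by
    intro v hv
    have h1 := abs_le.1 hv
    have hmem : x - y - v ∈ Icc (x / 2) (2 * x) := ⟨by linarith, by linarith⟩
    have e1 := (taylor_bounds_of_deriv2_le H.hasDerivAt H.hasDerivAt_deriv H.deriv2_le hxy
      hmem).2
    rw [← hscrit, show x - y - v - (x - y) = -v by ring, neg_sq] at e1
    linarith [(abs_le.1 e1).1]
  have hUx := H.U_le
  have hmid : ∀ t, |t - y| ≤ U → F t ≤ ((a + ε) * Real.exp (-R (x - y)))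
      * Real.exp (s * (t - y) + q * (t - y) ^ 2) := by
    intro t ht
    have h1 := abs_le.1 (ht.trans hUx)
    have e2 : F t = ν.real (Ioi (x - t)) := by
      simp only [hF]; rw [max_eq_right (by linarith)]
    rw [e2, mul_assoc, ← Real.exp_add]
    refine (H.tail_le (by linarith)).trans ?_
    gcongr
    have := htay (t - y) (ht.trans hUx)
    rwa [show x - y - (t - y) = x - t by ring] at this
  have hleft : ∀ t, t - y ≤ -U → F t ≤ ((a + ε) * Real.exp (-R (x - y)))
      * Real.exp (-(s * U) + q * U ^ 2) := by
    intro t ht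
    have e2 : F t ≤ ν.real (Ioi (x - y - -U)) :=
      measureReal_mono (Ioi_subset_Ioi (le_max_of_le_right (by linarith)))
    refine e2.trans ((H.tail_le (by linarith)).trans ?_)
    rw [mul_assoc, ← Real.exp_add]
    gcongr
    have := htay (-U) (by rwa [abs_neg, abs_of_nonneg hU])
    rw [mul_neg, neg_sq] at this
    exact this
  have hright : ∀ t, U ≤ t - y → F t ≤ ((a + ε) * Real.exp (-R x))
      * Real.exp (R x / x * t) := by
    intro t ht
    refine (H.tail_le (le_max_left _ _)).trans ?_
    rw [mul_assoc, ← Real.exp_add]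
    gcongr
    -- Far to the right the tangent parabola is replaced by the chord from the origin: `R z ≥ (z /
    -- x) R x`, which gives the tilt `σ = R x / x`.
    have e1 := H.le_R (max (x / 2) (x - t)) ⟨le_max_left _ _, max_le (by linarith) (by linarith)⟩
    have e2 : (x - t) / x * R x ≤ max (x / 2) (x - t) / x * R x := by
      have := H.R_pos
      gcongr
      exact le_max_right _ _
    have e3 : (x - t) / x * R x = R x - R x / x * t := by field_simp
    linarith
  have hΛ1 : Λ ≤ w ^ 2 / (16 * n) := by
    rw [le_div_iff₀ (by positivity)]
    calc Λ * (16 * n) = 16 * Λ * n := by ring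
      _ ≤ 16 * Λ * nb := by have := H.Λ_nonneg; gcongr
      _ ≤ w₀ ^ 2 := H.Λ_nb
      _ ≤ w ^ 2 := by gcongr
  have hΛ2 : Λ ≤ η / 4 * s * w / 4 := by
    have : η * sl * w₀ ≤ η * s * w := by have := H.sl_pos; gcongr
    linarith [H.Λ_sl]
  have hqU : 64 * q * U ≤ η * s := H.q_mul_U.trans (by gcongr)
  have key := hT.integral_le (w := w) (q := q) (Λ := Λ) (U := U) (σ := R x / x) (by linarith)
    (by rw [hw]; linarith) hq (mul_nonneg ha (Real.exp_pos _).le)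
    (mul_nonneg ha (Real.exp_pos _).le) hU hΛ1 hΛ2
    (by have : 512 * q * n ≤ 1 := le_trans (by gcongr) H.q_mul_nb
        have : 0 ≤ q * n := by positivity
        linarith) (by linarith) hσ0.le
    (by gcongr; linarith) hF0 hmid hleft hright
  clear hmid hleft hright htay hΛ1 hΛ2 hxy hUx hT
  set I := rate R K s₀ n x with hI
  have hJx : J * s ^ 2 ≤ 12 * J * deriv R x ^ 2 := by
    have e2 : J * s ^ 2 ≤ J * (2 * deriv R x) ^ 2 := by gcongr
    have e3 : J * (2 * deriv R x) ^ 2 = 4 * (J * deriv R x ^ 2) := by ring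
    have e4 : 0 ≤ J * deriv R x ^ 2 := by positivity
    linarith
  have hJx0 : 0 ≤ 12 * J * deriv R x ^ 2 := by positivity
  have hMK : M * K s ≤ n * K s := by
    have : (M : ℝ) ≤ n := by linarith
    gcongr
  set E := Real.exp (-I + 12 * J * deriv R x ^ 2) with hE
  have hnb : 0 ≤ nb := by linarith
  have hnbs : n * s ^ 2 ≤ nb * sh ^ 2 := by gcongr
  have hnb0 : 0 ≤ nb * sh ^ 2 := le_trans (by positivity) hnbs
  have p1 : Real.exp (-R (x - y)) * Real.exp (q * w ^ 2 + (M * K s - s * y + ε))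
      ≤ Real.exp (2 * ε) * E := by
    rw [hE, ← Real.exp_add, ← Real.exp_add, Real.exp_le_exp, hrate]
    linarith
  have p2 : Real.exp (-R (x - y)) * (2 * (U / w + 1) * Real.exp (M * K s - s * y + ε - Λ))
      ≤ 2 * ε * E := by
    have e1 : U / w + 1 ≤ U + 1 := by
      gcongr
      exact div_le_self hU (hw₀.trans hww)
    have e2 : Real.exp (-R (x - y)) * Real.exp (M * K s - s * y + ε - Λ)
        ≤ Real.exp (1 - Λ) * E := by
      rw [hE, ← Real.exp_add, ← Real.exp_add, Real.exp_le_exp, hrate]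
      linarith [H.ε_le]
    calc _ = 2 * (U / w + 1) * (Real.exp (-R (x - y))
            * Real.exp (M * K s - s * y + ε - Λ)) := by ring
      _ ≤ 2 * (U + 1) * (Real.exp (1 - Λ) * E) := by gcongr
      _ = 2 * ((U + 1) * Real.exp (1 - Λ)) * E := by ring
      _ ≤ _ := by gcongr; exact H.U_exp
  have hslU : η / 8 * sl * U ≤ η / 8 * s * U := by gcongr
  have p3 : Real.exp (-R (x - y)) * Real.exp (-(s * U) + q * U ^ 2) ≤ ε * E := by
    have e1 : q * U ^ 2 ≤ η * s * U / 64 := by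
      calc q * U ^ 2 = (64 * q * U) * U / 64 := by ring
        _ ≤ (η * s) * U / 64 := by
          have := mul_le_mul_of_nonneg_right hqU hU
          linarith
    have e2 : η / 8 * s * U + η * s * U / 64 ≤ s * U := by
      have e3 : η * (s * U) ≤ 1 * (s * U) := mul_le_mul_of_nonneg_right H.η_le_one (by positivity)
      have e4 : 0 ≤ s * U := by positivity
      linarith
    calc _ ≤ Real.exp (-(η / 8 * sl * U) + 4 * nb * sh ^ 2 + 1) * E := by
          rw [hE, ← Real.exp_add, ← Real.exp_add, Real.exp_le_exp, hrate]
          linarith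
      _ ≤ _ := by gcongr; exact H.exp_U
  have hRE : Real.exp (-R x) ≤ E := by
    rw [hE, Real.exp_le_exp]; linarith
  have p4 : Real.exp (-R x) * Real.exp (-(η / 4 * (R x / x) * U)
      + M * K ((1 + η / 4) * (R x / x)) + ε) ≤ ε * E := by
    have e0 : (1 + η / 4) * (R x / x) ≤ 2 * sh := by
      have := H.ratio_le
      gcongr
      linarith [H.η_le_one]
    have e1 : K ((1 + η / 4) * (R x / x)) ≤ 4 * sh ^ 2 := by
      refine (H.nearSquare.bounds ⟨by positivity, e0.trans H.two_sh⟩).2.trans ?_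
      calc ((1 + η / 4) * (R x / x)) ^ 2 ≤ (2 * sh) ^ 2 := by gcongr
        _ = _ := by ring
    have e2 : M * K ((1 + η / 4) * (R x / x)) ≤ 4 * nb * sh ^ 2 := by
      have : (M : ℝ) ≤ nb := by linarith
      calc M * K ((1 + η / 4) * (R x / x)) ≤ M * (4 * sh ^ 2) := by gcongr
        _ ≤ nb * (4 * sh ^ 2) := by gcongr
        _ = _ := by ring
    have e3 : η / 8 * sl * U ≤ η / 4 * (R x / x) * U := by
      have := H.le_ratio
      have := H.sl_pos
      gcongr
      linarith
    calc _ ≤ E * Real.exp (-(η / 8 * sl * U) + 4 * nb * sh ^ 2 + 1) := by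
          gcongr
          linarith [H.ε_le]
      _ ≤ E * ε := by gcongr; exact H.exp_U
      _ = _ := mul_comm _ _
  have hint : ∫ t, F t ∂(convPow (ν.restrict (Iic (x / 2))) M)
      ≤ (a + ε) * (Real.exp (2 * ε) + 4 * ε) * E := by
    refine key.trans ?_
    calc _ = (a + ε) * (Real.exp (-R (x - y)) * Real.exp (q * w ^ 2 + (M * K s - s * y + ε))
          + Real.exp (-R (x - y)) * (2 * (U / w + 1) * Real.exp (M * K s - s * y + ε - Λ))
          + Real.exp (-R (x - y)) * Real.exp (-(s * U) + q * U ^ 2)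
          + Real.exp (-R x) * Real.exp (-(η / 4 * (R x / x) * U)
            + M * K ((1 + η / 4) * (R x / x)) + ε)) := by ring
      _ ≤ (a + ε) * (Real.exp (2 * ε) * E + 2 * ε * E + ε * E + ε * E) := by gcongr
      _ = _ := by ring
  have hN : ((M + 1 : ℕ) : ℝ) ≤ nb := by push_cast; linarith
  have hjump0 : (convPow (ν.restrict (Iic (x / 2))) (M + 1)).real (Ioi x) ≤ ε * (n * E) := by
    refine (H.no_jump_le hN).trans ?_
    gcongr
    calc Real.exp (-R x) ≤ E := hRE
      _ = 1 * E := (one_mul _).symm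
      _ ≤ n * E := by gcongr
  -- Two jumps above `x / 2` cost `2 R (x / 2) ≥ (1 + η) R x`; the surplus `η R x` beats the extra
  -- factor `n`.
  have hjump2 : ((M : ℝ) + 1) ^ 2 * ν.real (Ioi (x / 2)) ^ 2 ≤ ε * (n * E) := by
    have e1 := H.tail_le (z := x / 2) le_rfl
    have e2 : Real.exp (-R (x / 2)) ^ 2 ≤ Real.exp (-(η * R x)) * Real.exp (-R x) := by
      rw [← Real.exp_nat_mul, ← Real.exp_add, Real.exp_le_exp]
      push_cast
      linarith [H.half]
    calc ((M : ℝ) + 1) ^ 2 * ν.real (Ioi (x / 2)) ^ 2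
        ≤ n ^ 2 * ((a + ε) * Real.exp (-R (x / 2))) ^ 2 := by gcongr
      _ = n * (n * (a + ε) ^ 2 * Real.exp (-R (x / 2)) ^ 2) := by ring
      _ ≤ n * (nb * (a + 1) ^ 2 * (Real.exp (-(η * R x)) * Real.exp (-R x))) := by
          gcongr
          linarith [H.ε_le]
      _ = n * ((nb * (a + 1) ^ 2 * Real.exp (-(η * R x))) * Real.exp (-R x)) := by ring
      _ ≤ n * (ε * E) := by
          gcongr
          exact H.nb_exp_R
      _ = _ := by ring
  have := (convPow_Ioi_bounds ν (x / 2) x M).2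
  have hmain : ((M : ℝ) + 1) * ∫ t, F t ∂(convPow (ν.restrict (Iic (x / 2))) M)
      ≤ n * ((a + ε) * (Real.exp (2 * ε) + 4 * ε) * E) := by
    gcongr
  calc (convPow ν (M + 1)).real (Ioi x) ≤ _ := this
    _ ≤ n * ((a + ε) * (Real.exp (2 * ε) + 4 * ε) * E) + ε * (n * E) + ε * (n * E) := by gcongr
    _ = _ := by ring

end LevelEstimates

/-! ### Choice of the scales and validity of the estimates at high levels -/

theorem pow_bounds_of_abs_sub_exp_le {m k d ε : ℝ} {N : ℕ} (hk : 0 ≤ k) (hm : |m - Real.exp k| ≤ d)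
    (hd : d ≤ 1 / 2) (hN : N * (2 * d) ≤ ε) :
    Real.exp (N * k - ε) ≤ m ^ N ∧ m ^ N ≤ Real.exp (N * k + ε) := by
  have hd0 : 0 ≤ d := (abs_nonneg _).trans hm
  have h1 : 1 ≤ Real.exp k := Real.one_le_exp hk
  obtain ⟨h2, h3⟩ := abs_le.1 hm
  have hN0 : (0 : ℝ) ≤ N := Nat.cast_nonneg N
  have hlow : Real.exp (k - 2 * d) ≤ m := by
    have e1 : Real.exp (-(2 * d)) ≤ 1 - d := by
      rw [Real.exp_neg, inv_le_comm₀ (Real.exp_pos _) (by linarith)]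
      have e2 := Real.add_one_le_exp (2 * d)
      refine le_trans ?_ e2
      rw [inv_le_iff_one_le_mul₀ (by linarith)]
      nlinarith
    calc Real.exp (k - 2 * d) = Real.exp k * Real.exp (-(2 * d)) := by
          rw [← Real.exp_add]; ring_nf
      _ ≤ Real.exp k * (1 - d) := by gcongr
      _ ≤ m := by nlinarith
  have hup : m ≤ Real.exp (k + 2 * d) := by
    have e2 := Real.add_one_le_exp (2 * d)
    calc m ≤ Real.exp k * (2 * d + 1) := by nlinarith
      _ ≤ Real.exp k * Real.exp (2 * d) := by gcongr
      _ = _ := by rw [← Real.exp_add]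
  constructor
  · calc Real.exp (N * k - ε) ≤ Real.exp (N * (k - 2 * d)) := by gcongr; linarith
      _ = Real.exp (k - 2 * d) ^ N := Real.exp_nat_mul _ _
      _ ≤ m ^ N := by gcongr
  · calc m ^ N ≤ Real.exp (k + 2 * d) ^ N :=
          pow_le_pow_left₀ ((Real.exp_pos _).le.trans hlow) hup N
      _ = Real.exp (N * (k + 2 * d)) := (Real.exp_nat_mul _ _).symm
      _ ≤ _ := by gcongr; linarith

theorem exists_isNearSquare_truncatedCGF {Ω : Type*} [MeasurableSpace Ω] {μ : Measure Ω}
    {X : Ω → ℝ} {r x₀ a : ℝ} {α R : ℝ → ℝ} (h : HasStretchedExpTail μ X r x₀ a α R) :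
    ∃ δ, IsNearSquare (truncatedCGF μ X r) δ := by
  rw [truncatedCGF_eq μ X r (by simpa using h.mean_eq)]
  exact egfPoly_cumulant_isNearSquare (by simpa using h.mean_eq) h.second_moment_eq
    (truncationOrder_spec h.r_pos h.r_lt_one).1

theorem eventually_const_mul_rpow_le_one (c : ℝ) {p : ℝ} (h : p < 0) :
    ∀ᶠ x : ℝ in atTop, c * x ^ p ≤ 1 := by
  filter_upwards [eventually_const_mul_rpow_le c h] with x hx
  rwa [Real.rpow_zero] at hx

namespace HasStretchedExpTail

variable {ν : Measure ℝ} {r x₀ a : ℝ} {α R : ℝ → ℝ}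

/-- At high levels all estimates hold, for sums of at most `x ^ (r + τ)` terms. -/
theorem eventually_levelEstimates [IsProbabilityMeasure ν]
    (h : HasStretchedExpTail ν id r x₀ a α R) {s₀ : ℝ}
    (hs₀ : IsTiltRange (truncatedCGF ν id r) s₀) :
    ∃ τ : ℝ, 0 < τ ∧ ∀ ε : ℝ, 0 < ε → ε ≤ 1 / 4 → ε ≤ a → ∀ᶠ x in atTop,
      ∃ δ η B c sl sh q w₀ U Λ : ℝ, LevelEstimates ν (truncatedCGF ν id r) R α
        a δ s₀ η ε B c x sl sh q (x ^ (r + τ)) w₀ U Λ := by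
  have hr0 := h.r_pos
  have hr1 := h.r_lt_one
  have ha := h.a_pos
  set K := truncatedCGF ν id r with hKdef
  obtain ⟨δ₀, hK₀⟩ := exists_isNearSquare_truncatedCGF h
  set δ := min δ₀ s₀ with hδ
  have hK : IsNearSquare K δ := hK₀.mono (lt_min hK₀.δ_pos hs₀.1) (min_le_left _ _)
  have hδs₀ : δ ≤ s₀ := min_le_right _ _
  have hK'c : Continuous (deriv K) := hK.contDiff_deriv.continuous
  have hKc : Continuous K := hK.contDiff.continuous
  obtain ⟨B, hB⟩ := (isCompact_Icc (a := (0 : ℝ)) (b := s₀)).exists_bound_of_continuousOn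
    hK'c.continuousOn
  obtain ⟨t, ht, htmin⟩ := (isCompact_Icc (a := δ) (b := s₀)).exists_isMinOn
    ⟨δ, le_rfl, hδs₀⟩ (f := fun s => s * deriv K s - K s) (by fun_prop)
  set c := t * deriv K t - K t with hc
  have hc0 : 0 < c := hs₀.2.2 t ⟨hK.δ_pos.trans_le ht.1, ht.2⟩
  obtain ⟨η, hη0, hη1, C, A₁, hmgf⟩ := h.truncated_mgf
  obtain ⟨b, hb, A₂, hA₂, hA₂1, hRpos, -, hcmp⟩ := h.exists_comparison
  set m := min r (1 - r) with hm
  have hm0 : 0 < m := lt_min hr0 (by linarith)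
  have hmr : m ≤ r := min_le_left _ _
  have hmr' : m ≤ 1 - r := min_le_right _ _
  set τ := m / 20 with hτ
  have hτ0 : 0 < τ := by positivity
  have hτr : 20 * τ ≤ r := by rw [hτ]; linarith
  have hτr' : 20 * τ ≤ 1 - r := by rw [hτ]; linarith
  -- The exponent of `w₀`. Its lower bounds make `w₀²` exceed `Λ n` and `sl * w₀` exceed `Λ`; its
  -- upper bound makes `q w₀²` vanish. They are compatible because `r < 2 - r` and `2 (1 - r) < 2 -
  -- r`, with `τ` small.
  obtain ⟨ω, hω1, hω2, hω3⟩ : ∃ ω : ℝ, r / 2 + 2 * τ ≤ ω ∧ 1 - r + 2 * τ ≤ ω ∧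
      (2 * ω < 2 - r - τ) := by
    refine ⟨max (r / 2) (1 - r) + 2 * τ, ?_, ?_, ?_⟩
    · linarith [le_max_left (r / 2) (1 - r)]
    · linarith [le_max_right (r / 2) (1 - r)]
    · rcases max_cases (r / 2) (1 - r) with ⟨e, -⟩ | ⟨e, -⟩ <;> rw [e] <;> linarith
  -- The exponent of `U`. Its lower bounds make `sl * U` exceed `nb * sh²` and tend to infinity; its
  -- upper bound keeps `q U` below `sl`.
  obtain ⟨υ, hυ1, hυ2, hυ3⟩ : ∃ υ : ℝ, 2 * r - 1 + 5 * τ ≤ υ ∧ 1 - r + 5 * τ ≤ υ ∧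
      (υ < 1 - 2 * τ) := by
    refine ⟨max (2 * r - 1) (1 - r) + 5 * τ, ?_, ?_, ?_⟩
    · linarith [le_max_left (2 * r - 1) (1 - r)]
    · linarith [le_max_right (2 * r - 1) (1 - r)]
    · rcases max_cases (2 * r - 1) (1 - r) with ⟨e, -⟩ | ⟨e, -⟩ <;> rw [e] <;> linarith
  refine ⟨τ, hτ0, fun ε hε0 hε4 hεa => ?_⟩
  obtain ⟨Z, hZ⟩ := eventually_atTop.1
    (h.α_tendsto.eventually (Metric.closedBall_mem_nhds a hε0))
  filter_upwards [eventually_ge_atTop A₁, eventually_ge_atTop (2 * A₂), eventually_ge_atTop (2 * Z),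
    eventually_ge_atTop 1, h.deriv_bounds hτ0, h.deriv2_bounds hτ0, h.rpow_bounds hτ0,
    eventually_const_mul_rpow_le (4 * B / η) (show r + τ < 1 by linarith),
    eventually_const_mul_rpow_le_one (2 / δ) (show r - 1 + τ < 0 by linarith),
    eventually_const_mul_rpow_le_one (B / c) (show r - 1 + τ < 0 by linarith),
    eventually_const_mul_rpow_le_one 512 (show (r - 2 + τ) + (r + τ) < 0 by linarith),
    eventually_const_mul_rpow_le_one (2 / ε) (show (r - 2 + τ) + (ω + ω) < 0 by linarith),
    eventually_const_mul_rpow_le (64 / η) (show (r - 2 + τ) + υ < r - 1 - τ by linarith),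
    eventually_rpow_mul_exp_neg_le 1 (c := η / 16) (ε := τ) (δ := ε / (2 * Real.exp 1))
      (by positivity) hτ0 (by positivity),
    eventually_const_mul_rpow_le η (show τ + (r + τ) < ω + ω by linarith),
    eventually_const_mul_rpow_le 4 (show υ < 1 by linarith),
    eventually_const_mul_rpow_le 8 (show ω < 1 by linarith),
    eventually_const_mul_rpow_le 128 (show (r + τ) + (r - 1 + τ) < 1 by linarith),
    eventually_const_mul_rpow_le (64 / η) (show (r + τ) + ((r - 1 + τ) + (r - 1 + τ))
      < (r - 1 - τ) + υ by linarith),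
    eventually_const_le_rpow (16 / η * (1 - Real.log ε)) (show 0 < (r - 1 - τ) + υ by linarith),
    eventually_const_mul_rpow_le (8 / η) (show (r + τ) + ((r - 1 + τ) + (r - 1 + τ))
      < r - τ by linarith),
    eventually_const_le_rpow (2 / η * (1 - Real.log ε)) (show 0 < r - τ by linarith),
    eventually_rpow_mul_exp_neg_le (r + τ) (c := η) (ε := r - τ) (δ := ε / (a + 1) ^ 2)
      hη0 (by linarith) (by positivity),
    eventually_const_mul_rpow_le (2 * C / ε) (show r + τ < 1 by linarith),
    eventually_ge_atTop (2 * C)]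
    with x g1 g2 g3 g4 g5 g6 g7 f1 f2 f3 f4 f5 f6 f7 f8 f9 f10 f11 f12 f13 f14 f15 f16 f17 f18
  have hx0 : 0 < x := by linarith
  have hmemA : ∀ u ∈ Icc (x / 2) (2 * x), A₂ ≤ u := fun u hu => by linarith [hu.1]
  have hxmem : x ∈ Icc (x / 2) (2 * x) := ⟨by linarith, by linarith⟩
  have hRx := (hRpos x (hmemA x hxmem)).1
  have hdiv : ∀ p : ℝ, x ^ (p - 1) * x = x ^ p := fun p => by
    rw [← Real.rpow_add_one hx0.ne', sub_add_cancel]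
  have hσl : x ^ (r - 1 - τ) ≤ R x / x := by
    rw [le_div_iff₀ hx0, show r - 1 - τ = r - τ - 1 by ring, hdiv]; exact g7.1
  have hσr : R x / x ≤ x ^ (r - 1 + τ) := by
    rw [div_le_iff₀ hx0, show r - 1 + τ = r + τ - 1 by ring, hdiv]; exact g7.2
  have hσ0 : 0 < R x / x := by positivity
  rw [Real.rpow_one] at f1 f9 f10 f11 f17
  have h2sh : 2 * x ^ (r - 1 + τ) ≤ δ := by
    rw [div_mul_eq_mul_div, div_le_one hK.δ_pos] at f2; exact f2
  have hlog : Real.exp (Real.log ε) = ε := Real.exp_log hε0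
  have hnbsh : 4 * x ^ (r + τ) * (x ^ (r - 1 + τ)) ^ 2
      = 4 * x ^ ((r + τ) + ((r - 1 + τ) + (r - 1 + τ))) := by
    rw [sq, Real.rpow_add hx0 (r + τ), Real.rpow_add hx0 (r - 1 + τ)]; ring
  refine ⟨δ, η, B, c, x ^ (r - 1 - τ), x ^ (r - 1 + τ), x ^ (r - 2 + τ), x ^ ω, x ^ υ,
    η / 16 * x ^ τ, ?_⟩
  refine
    { x_pos := hx0
      η_pos := hη0
      η_le_one := hη1
      ε_pos := hε0
      ε_le := hε4
      ε_le_a := hεa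
      nearSquare := hK
      δ_le := hδs₀
      hasDerivAt := fun u hu => h.hasDerivAt (hA₂.trans_le (hmemA u hu))
      hasDerivAt_deriv := fun u hu => h.hasDerivAt_deriv (hA₂.trans_le (hmemA u hu))
      sl_pos := by positivity
      deriv_bounds := g5
      deriv_le_div := fun u hu => (hRpos u (hmemA u hu)).2.2
      deriv2_le := g6
      le_R := ?_
      R_pos := hRx
      le_ratio := hσl
      ratio_le := hσr
      half := (hmgf x g1).1
      tail := ?_
      deriv_K_le := hB
      le_legendre := fun s hs => htmin hs
      nb_mul_B := ?_
      two_sh := h2sh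
      B_mul_sh := ?_
      mgf := ?_
      q_mul_nb := ?_
      q_mul_sq := ?_
      q_mul_U := ?_
      U_exp := ?_
      Λ_nb := ?_
      Λ_sl := ?_
      Λ_nonneg := by positivity
      one_le_w₀ := Real.one_le_rpow g4 (by linarith)
      U_nonneg := by positivity
      U_le := by linarith
      w_le := ?_
      exp_U := ?_
      exp_R := ?_
      nb_exp_R := ?_ }
  · intro z hz
    have hz0 : 0 < z := by linarith [hz.1]
    refine le_trans ?_ (hcmp z x (by linarith [hz.1]) hz.2)
    gcongr
    have := Real.rpow_le_rpow_of_exponent_ge (x := z / x) (by positivity)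
      ((div_le_one hx0).2 hz.2) hb.2.le
    simpa using this
  · intro z hz
    refine ⟨h.tail_real (by linarith), ?_⟩
    have := hZ z (by linarith)
    rwa [Real.dist_eq] at this
  · rw [div_mul_eq_mul_div, div_le_iff₀ hη0] at f1
    linarith
  · rw [div_mul_eq_mul_div, div_le_one hc0] at f3
    exact f3
  · intro N hN θ hθ0 hθ
    obtain ⟨e1, e2⟩ := (hmgf x g1).2 θ hθ0 hθ
    obtain ⟨e3, e4⟩ := integral_exp_convPow (ν.restrict (Iic (x / 2))) (s := θ) e1 N
    have hθδ : θ ∈ Icc 0 δ := by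
      refine ⟨hθ0, hθ.trans (le_trans ?_ h2sh)⟩
      gcongr
      linarith
    have hKθ : 0 ≤ K θ := le_trans (by positivity) (hK.bounds hθδ).1
    rw [e4]
    refine ⟨e3, pow_bounds_of_abs_sub_exp_le hKθ e2 ?_ ?_⟩
    · rw [div_le_iff₀ hx0]; linarith
    · rcases le_total 0 C with hC | hC
      · rw [div_mul_eq_mul_div, div_le_iff₀ hε0] at f17
        calc (N : ℝ) * (2 * (C / x)) = 2 * C * N / x := by ring
          _ ≤ 2 * C * x ^ (r + τ) / x := by gcongr
          _ ≤ ε := by rw [div_le_iff₀ hx0]; linarith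
      · have : 2 * (C / x) ≤ 0 := by
          have := div_nonpos_of_nonpos_of_nonneg hC hx0.le
          linarith
        exact (mul_nonpos_of_nonneg_of_nonpos (Nat.cast_nonneg N) this).trans hε0.le
  · rw [Real.rpow_add hx0 (r - 2 + τ)] at f4
    linarith
  · rw [Real.rpow_add hx0 (r - 2 + τ), Real.rpow_add hx0 ω, div_mul_eq_mul_div,
      div_le_one hε0] at f5
    linarith
  · rw [Real.rpow_add hx0 (r - 2 + τ), div_mul_eq_mul_div, div_le_iff₀ hη0] at f6
    linarith
  · have e1 : x ^ υ ≤ x := by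
      have : 0 < x ^ υ := by positivity
      linarith
    rw [Real.rpow_one, le_div_iff₀ (by positivity)] at f7
    calc (x ^ υ + 1) * Real.exp (1 - η / 16 * x ^ τ)
        ≤ (2 * x) * Real.exp (1 - η / 16 * x ^ τ) := by gcongr; linarith
      _ = x * Real.exp (-(η / 16) * x ^ τ) * (2 * Real.exp 1) := by
          rw [show 1 - η / 16 * x ^ τ = 1 + -(η / 16) * x ^ τ by ring, Real.exp_add]; ring
      _ ≤ ε := f7
  · rw [Real.rpow_add hx0 τ, Real.rpow_add hx0 ω] at f8
    linarith
  · have e1 : x ^ τ ≤ x ^ (r - 1 - τ) * x ^ ω := by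
      rw [← Real.rpow_add hx0]
      exact Real.rpow_le_rpow_of_exponent_le g4 (by linarith)
    have := mul_le_mul_of_nonneg_left e1 hη0.le
    linarith
  · rw [Real.rpow_add hx0 (r + τ)] at f11
    linarith
  · rw [hnbsh]
    refine le_trans (Real.exp_le_exp.2 ?_) hlog.le
    rw [mul_assoc, ← Real.rpow_add hx0]
    rw [div_mul_eq_mul_div, div_le_iff₀ hη0] at f12 f13
    linarith
  · rw [hnbsh]
    refine le_trans (Real.exp_le_exp.2 ?_) hlog.le
    rw [div_mul_eq_mul_div, div_le_iff₀ hη0] at f14 f15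
    have := mul_le_mul_of_nonneg_left g7.1 hη0.le
    linarith
  · rw [le_div_iff₀ (by positivity)] at f16
    calc x ^ (r + τ) * (a + 1) ^ 2 * Real.exp (-(η * R x))
        ≤ x ^ (r + τ) * (a + 1) ^ 2 * Real.exp (-η * x ^ (r - τ)) := by
          gcongr
          have := mul_le_mul_of_nonneg_left g7.1 hη0.le
          linarith
      _ = x ^ (r + τ) * Real.exp (-η * x ^ (r - τ)) * (a + 1) ^ 2 := by ring
      _ ≤ ε := f16

end HasStretchedExpTail

/-! ### Lower bounds for the points of the deviation window -/

section DeviationWindow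

variable {ν : Measure ℝ} {r x₀ a : ℝ} {α R : ℝ → ℝ} {d : ℕ → ℝ}

theorem tendsto_natCast_rpow_atTop {p : ℝ} (hp : 0 < p) :
    Tendsto (fun n : ℕ => (n : ℝ) ^ p) atTop atTop :=
  (tendsto_rpow_atTop hp).comp tendsto_natCast_atTop_atTop

theorem HasStretchedExpTail.bddAbove_image (h : HasStretchedExpTail ν id r x₀ a α R)
    (hb : BddAbove (R '' Ioc x₀ (x₀ + 1))) (A : ℝ) : BddAbove (R '' Ioc x₀ A) := by
  have hc : BddAbove (R '' Icc (x₀ + 1) A) :=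
    isCompact_Icc.bddAbove_image (h.contDiffOn.continuousOn.mono fun y hy =>
      lt_of_lt_of_le (lt_add_one x₀) hy.1)
  refine (hb.union hc).mono ?_
  rintro _ ⟨y, hy, rfl⟩
  rcases le_total y (x₀ + 1) with h1 | h1
  · exact Or.inl ⟨y, ⟨hy.1, h1⟩, rfl⟩
  · exact Or.inr ⟨y, ⟨h1, hy.2⟩, rfl⟩

/-- Every admissible scale is `n ^ (1 / r + o(1))`, from below. -/
theorem IsDeviationScale.rpow_le (h : HasStretchedExpTail ν id r x₀ a α R)
    (hd : IsDeviationScale R r x₀ d) {ε : ℝ} (hε : 0 < ε) :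
    ∀ᶠ n : ℕ in atTop, (n : ℝ) ^ (1 / r - ε) ≤ d n := by
  have hr0 := h.r_pos
  rcases hd with hd | ⟨hb, m, hm, hd⟩
  · exact (hd.rpow_bounds hε).mono fun n hn => hn.1
  have hL : 0 < Real.log m := Real.log_pos hm
  have hcast := tendsto_natCast_atTop_atTop (R := ℝ)
  -- The exponent is chosen so that `(1 / r - ε) (r + r² ε / 2) ≤ 1 - r ε / 2`: a point below `n ^
  -- (1 / r - ε)` then has `R x` of smaller order than `n`. Boundedness of `R` on `(x₀, A]` excludes
  -- the points where the power bound is not available.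
  obtain ⟨A, hA⟩ := eventually_atTop.1 (h.rpow_bounds (ε := r ^ 2 * ε / 2) (by positivity))
  obtain ⟨M, hM⟩ := h.bddAbove_image hb A
  have hne : ∀ n : ℕ, {x : ℝ | x₀ < x ∧ n * Real.log m < R x}.Nonempty := by
    intro n
    have h1 : Tendsto R atTop atTop := h.R_tendsto
    obtain ⟨x, hx1, hx2⟩ :=
      ((eventually_gt_atTop x₀).and (h1.eventually_gt_atTop (n * Real.log m))).exists
    exact ⟨x, hx1, hx2⟩
  have e1 := hcast.eventually (eventually_const_mul_rpow_le (1 / Real.log m)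
    (p := 1 - r * ε / 2) (q := 1) (by nlinarith))
  have e2 : ∀ᶠ n : ℕ in atTop, M < n * Real.log m :=
    (hcast.atTop_mul_const hL).eventually_gt_atTop M
  filter_upwards [e1, e2, eventually_ge_atTop 1] with n e1 e2 e3
  rw [hd n]
  refine le_csInf (hne n) ?_
  rintro x ⟨hx0, hx⟩
  have hn1 : (1 : ℝ) ≤ n := by exact_mod_cast e3
  by_contra! hlt
  have hxA : A < x := by
    by_contra! hle
    have : R x ≤ M := hM ⟨x, ⟨hx0, hle⟩, rfl⟩
    linarith
  have h1 := (hA x hxA.le).2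
  have h2 : x ^ (r + r ^ 2 * ε / 2) ≤ (n : ℝ) ^ (1 - r * ε / 2) := by
    calc x ^ (r + r ^ 2 * ε / 2) ≤ ((n : ℝ) ^ (1 / r - ε)) ^ (r + r ^ 2 * ε / 2) := by
          have := h.x₀_pos
          exact Real.rpow_le_rpow (by linarith) hlt.le (by positivity)
      _ = (n : ℝ) ^ ((1 / r - ε) * (r + r ^ 2 * ε / 2)) := (Real.rpow_mul (by positivity) _ _).symm
      _ ≤ (n : ℝ) ^ (1 - r * ε / 2) := by
          apply Real.rpow_le_rpow_of_exponent_le hn1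
          have : (1 / r - ε) * (r + r ^ 2 * ε / 2) = 1 - r * ε / 2 - r ^ 2 * ε ^ 2 / 2 := by
            field_simp
            ring
          rw [this]
          have : 0 ≤ r ^ 2 * ε ^ 2 / 2 := by positivity
          linarith
  rw [Real.rpow_one, one_div_mul_eq_div, div_le_iff₀ hL] at e1
  linarith

/-- The scale `d n` dominates the half-width `z n`, whose index is below `1 / r`, and the shift `n
R' (d n) / 2` is nonnegative. -/
theorem eventually_rpow_le_of_mem_deviationWindow (h : HasStretchedExpTail ν id r x₀ a α R)
    (hd : IsDeviationScale R r x₀ d) {z : ℕ → ℝ} {ρ : ℝ} (hz : IsRegularlyVaryingSeq z ρ)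
    (hρ : ρ < 1 / r) {p : ℝ} (hp0 : 0 < p) (hp : p < 1 / r) :
    ∀ᶠ n : ℕ in atTop, ∀ x ∈ deviationWindow R d z n, (n : ℝ) ^ p ≤ x := by
  obtain ⟨q, hq1, hq2⟩ := exists_between (max_lt hρ hp)
  obtain ⟨p', hp1, hp2⟩ := exists_between hq2
  have hqρ : ρ < q := (le_max_left _ _).trans_lt hq1
  have hqp : p < q := (le_max_right _ _).trans_lt hq1
  have e1 := hd.rpow_le h (sub_pos.2 hp2)
  simp only [sub_sub_cancel] at e1
  have hdt : Tendsto d atTop atTop :=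
    tendsto_atTop_mono' _ e1 (tendsto_natCast_rpow_atTop (by linarith))
  have e2 := hdt.eventually h.deriv_regularlyVarying.2.1
  have e3 := hz.rpow_bounds (sub_pos.2 hqρ)
  have e4 := (tendsto_natCast_atTop_atTop (R := ℝ)).eventually
    (eventually_const_mul_rpow_le 2 hp1)
  filter_upwards [e1, e2, e3, e4, eventually_ge_atTop 1] with n e1 e2 e3 e4 e5 x hx
  have hn1 : (1 : ℝ) ≤ n := by exact_mod_cast e5
  have h1 : (n : ℝ) ^ p ≤ (n : ℝ) ^ q := Real.rpow_le_rpow_of_exponent_le hn1 hqp.le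
  have h2 : 0 ≤ n * deriv R (d n) / 2 := by positivity
  have h3 := e3.2
  rw [add_sub_cancel] at h3
  linarith [hx.1]

end DeviationWindow

/-! ### From level estimates to the uniform asymptotics -/

/-- The exponent `θ` clipped to `[-E, E]` absorbs a discrepancy between the lower and the upper
bound. -/
theorem abs_div_exp_clip_sub_one_le {p g I E ε : ℝ} (hg : 0 < g) (hE : 0 ≤ E) (hε0 : 0 ≤ ε)
    (hε1 : ε < 1) (h1 : (1 - ε) * (g * Real.exp (-I - E)) ≤ p)
    (h2 : p ≤ (1 + ε) * (g * Real.exp (-I + E))) :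
    |p / (g * Real.exp (-I + max (-E) (min E (Real.log (p / (g * Real.exp (-I))))))) - 1| ≤ ε := by
  have hp : 0 < p := lt_of_lt_of_le (by have := sub_pos.2 hε1; positivity) h1
  set l := Real.log (p / (g * Real.exp (-I))) with hl
  have hpl : p = g * Real.exp (-I + l) := by
    rw [Real.exp_add, hl, Real.exp_log (by positivity)]
    field_simp
  have key : ∀ t : ℝ, p / (g * Real.exp (-I + t)) = Real.exp (l - t) := by
    intro t
    rw [hpl, mul_div_mul_left _ _ hg.ne', ← Real.exp_sub]
    congr 1; ring
  rcases le_total l E with hlE | hlE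
  · rcases le_total (-E) l with hEl | hEl
    · rw [min_eq_right hlE, max_eq_right hEl, key]
      simpa using hε0
    · rw [min_eq_right hlE, max_eq_left hEl]
      have h3 : p / (g * Real.exp (-I + -E)) ≤ 1 := by
        rw [key]; exact Real.exp_le_one_iff.2 (by linarith)
      have h4 : 1 - ε ≤ p / (g * Real.exp (-I + -E)) := by
        rw [le_div_iff₀ (by positivity)]; exact h1
      rw [abs_le]; constructor <;> linarith
  · rw [min_eq_left hlE, max_eq_right (by linarith)]
    have h3 : 1 ≤ p / (g * Real.exp (-I + E)) := by
      rw [key]; exact Real.one_le_exp (by linarith)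
    have h4 : p / (g * Real.exp (-I + E)) ≤ 1 + ε := by
      rw [div_le_iff₀ (by positivity)]; exact h2
    rw [abs_le]; constructor <;> linarith

/-- Both expressions are continuous in `e` and equal `a` at `e = 0`. -/
theorem exists_level_constants {a ε : ℝ} (ha : 0 < a) (hε : 0 < ε) :
    ∃ e : ℝ, 0 < e ∧ e ≤ 1 / 4 ∧ e ≤ a ∧
      (1 - ε) * a ≤ (1 - e) * (a - e) * Real.exp (-e) * (Real.exp (-e) - 2 * e) ∧
      (a + e) * (Real.exp (2 * e) + 4 * e) + 2 * e ≤ (1 + ε) * a := by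
  have c1 : ContinuousAt
      (fun e : ℝ => (1 - e) * (a - e) * Real.exp (-e) * (Real.exp (-e) - 2 * e)) 0 := by fun_prop
  have c2 : ContinuousAt
      (fun e : ℝ => (a + e) * (Real.exp (2 * e) + 4 * e) + 2 * e) 0 := by fun_prop
  have h1 := c1.eventually_const_le (u := (1 - ε) * a) (by simp; nlinarith)
  have h2 := c2.eventually_le_const (u := (1 + ε) * a) (by simp; nlinarith)
  have h3 : ∀ᶠ e : ℝ in 𝓝[>] 0, 0 < e := self_mem_nhdsWithin
  have h4 : ∀ᶠ e : ℝ in 𝓝 0, e ≤ 1 / 4 := eventually_le_nhds (by norm_num)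
  have h5 : ∀ᶠ e : ℝ in 𝓝 0, e ≤ a := eventually_le_nhds ha
  obtain ⟨e, he⟩ := (h3.and ((h4.and (h5.and (h1.and h2))).filter_mono nhdsWithin_le_nhds)).exists
  exact ⟨e, he.1, he.2.1, he.2.2.1, he.2.2.2.1, he.2.2.2.2⟩

theorem HasStretchedExpTail.uniformExpEquiv_convPow {ν : Measure ℝ} [IsProbabilityMeasure ν]
    {r x₀ a : ℝ} {α R : ℝ → ℝ} (h : HasStretchedExpTail ν id r x₀ a α R)
    {d : ℕ → ℝ} (hd : IsDeviationScale R r x₀ d) {z : ℕ → ℝ} {ρz : ℝ}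
    (hz : IsRegularlyVaryingSeq z ρz) (hρz : ρz < 1 / r) {jmax : ℕ → ℕ} {ρj : ℝ}
    (hj : IsRegularlyVaryingSeq (fun n => (jmax n : ℝ)) ρj) (hρj : ρj < 1)
    {s₀ : ℝ} (hs₀ : IsTiltRange (truncatedCGF ν id r) s₀) :
    UniformExpEquiv (fun n j x => (convPow ν (n - j)).real (Ioi x)) (fun n => a * n)
      (rate R (truncatedCGF ν id r) s₀) (fun n x => jmax n * deriv R x ^ 2) jmax
      (deviationWindow R d z) := by
  have hr0 := h.r_pos
  have ha := h.a_pos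
  have hcast := tendsto_natCast_atTop_atTop (R := ℝ)
  obtain ⟨τ, hτ, hlev⟩ := h.eventually_levelEstimates hs₀
  -- The error term is the exact logarithm of the ratio, clipped to the permitted range. The two
  -- bounds then force the clipped quotient to be near one.
  refine ⟨12, fun n j x => max (-(12 * (jmax n * deriv R x ^ 2))) (min (12 * (jmax n * deriv R x ^ 2))
    (Real.log ((convPow ν (n - j)).real (Ioi x)
      / (a * n * Real.exp (-rate R (truncatedCGF ν id r) s₀ n x))))), ?_, ?_⟩
  · refine Eventually.of_forall fun n j _ x _ => ?_
    have hE : 0 ≤ 12 * (jmax n * deriv R x ^ 2) := by positivity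
    rw [abs_le]
    exact ⟨le_max_left _ _, max_le (by linarith) (min_le_left _ _)⟩
  intro ε hε
  obtain ⟨e, he0, he4, hea, hlow, hup⟩ :=
    exists_level_constants ha (show 0 < min ε (1 / 2) by positivity)
  obtain ⟨A, hA⟩ := eventually_atTop.1 (hlev e he0 he4 hea)
  have hp : 1 / (r + τ) < 1 / r := one_div_lt_one_div_of_lt hr0 (by linarith)
  have w1 := eventually_rpow_le_of_mem_deviationWindow h hd hz hρz (by positivity) hp
  have w2 := (tendsto_natCast_rpow_atTop (p := 1 / (r + τ)) (by positivity)).eventually_ge_atTop A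
  obtain ⟨ρ', hρ1, hρ2⟩ := exists_between hρj
  have j1 := hj.rpow_bounds (sub_pos.2 hρ1)
  have j2 := hcast.eventually (eventually_const_mul_rpow_le (1 / e) hρ2)
  filter_upwards [w1, w2, j1, j2, eventually_ge_atTop 1] with n w1 w2 j1 j2 n1 j hjn x hx
  have hn1 : (1 : ℝ) ≤ n := by exact_mod_cast n1
  have hxn := w1 x hx
  have hxA : A ≤ x := w2.trans hxn
  have hnx : (n : ℝ) ≤ x ^ (r + τ) := by
    calc (n : ℝ) = ((n : ℝ) ^ (1 / (r + τ))) ^ (r + τ) := by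
          rw [← Real.rpow_mul (by positivity), one_div_mul_cancel (by positivity), Real.rpow_one]
      _ ≤ x ^ (r + τ) := Real.rpow_le_rpow (by positivity) hxn (by positivity)
  -- Positivity absorbs the summand reserved for the jump: `n = M + 1 + j ≤ M + 2 * jmax n`.
  have hJ0 : 1 ≤ jmax n := by
    have : (0 : ℝ) < jmax n := lt_of_lt_of_le (by positivity) j1.1
    exact_mod_cast this
  have hJe : (jmax n : ℝ) ≤ e * n := by
    have := j1.2
    rw [add_sub_cancel] at this
    rw [Real.rpow_one, one_div_mul_eq_div, div_le_iff₀ he0] at j2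
    linarith
  have hJn' : (4 : ℝ) * jmax n ≤ n := by nlinarith
  have hJn : 4 * jmax n ≤ n := by exact_mod_cast hJn'
  obtain ⟨M, rfl⟩ : ∃ M, n = M + 1 + j := ⟨n - j - 1, by omega⟩
  have hMe : (1 - e) * ((M + 1 + j : ℕ) : ℝ) ≤ M + 1 := by
    have : (j : ℝ) ≤ jmax (M + 1 + j) := by exact_mod_cast hjn
    have e1 : ((M + 1 + j : ℕ) : ℝ) = M + 1 + j := by push_cast; ring
    rw [sub_mul, one_mul]
    linarith
  obtain ⟨δ, η, B, c, sl, sh, q, w₀, U, Λ, H⟩ := hA x hxA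
  have L := H.lower_bound (n := M + 1 + j) (M := M) (J := jmax (M + 1 + j)) hnx (by omega)
    (by omega) (by omega) hMe
  have V := H.upper_bound (n := M + 1 + j) (M := M) (J := jmax (M + 1 + j)) hnx (by omega)
    (by omega) (by omega)
  rw [mul_assoc 12 (jmax (M + 1 + j) : ℝ)] at L V
  simp only [Nat.add_sub_cancel]
  refine (abs_div_exp_clip_sub_one_le (ε := min ε (1 / 2)) (by positivity) (by positivity)
    (by positivity) ((min_le_right _ _).trans_lt (by norm_num)) ?_ ?_).trans (min_le_left _ _)
  · refine le_trans ?_ L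
    rw [mul_assoc a, ← mul_assoc _ a]
    gcongr
  · refine V.trans ?_
    rw [mul_assoc a, ← mul_assoc _ a]
    gcongr

theorem exists_isTiltRange_truncatedCGF {Ω : Type*} [MeasurableSpace Ω] {μ : Measure Ω}
    {X : Ω → ℝ} {r x₀ a : ℝ} {α R : ℝ → ℝ} (h : HasStretchedExpTail μ X r x₀ a α R) :
    ∃ s₀ : ℝ, IsTiltRange (truncatedCGF μ X r) s₀ := by
  obtain ⟨δ, hδ⟩ := exists_isNearSquare_truncatedCGF h
  refine ⟨δ, hδ.δ_pos, hδ.δ_le_one, fun s hs => ?_⟩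
  have := (hδ.legendre_bounds ⟨hs.1.le, hs.2⟩).1
  have := hs.1
  nlinarith [sq_pos_of_pos hs.1]

theorem truncatedCGF_map {Ω : Type*} [MeasurableSpace Ω] {μ : Measure Ω} {X : Ω → ℝ}
    (hX : AEMeasurable X μ) (r : ℝ) : truncatedCGF (μ.map X) id r = truncatedCGF μ X r := by
  have : ∀ i : ℕ, ∫ t, id t ^ i ∂(μ.map X) = ∫ ω, X ω ^ i ∂μ := fun i =>
    integral_map hX (by fun_prop)
  unfold truncatedCGF
  simp only [this]

theorem theorem5p1 {Ω : Type*} [MeasurableSpace Ω] (μ : Measure Ω) [IsProbabilityMeasure μ]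
    (X : ℕ → Ω → ℝ) (h_indep : iIndepFun X μ) (h_ident : ∀ i, IdentDistrib (X i) (X 0) μ μ)
    (r x₀ a : ℝ) (α R : ℝ → ℝ) (h_tail : HasStretchedExpTail μ (X 0) r x₀ a α R)
    (d : ℕ → ℝ) (h_scale : IsDeviationScale R r x₀ d)
    (z : ℕ → ℝ) (ρz : ℝ) (hz : IsRegularlyVaryingSeq z ρz)
    (hρz : 2 / 3 < r → ρz < 2 - 1 / r) (hρz' : r ≤ 2 / 3 → ρz < 1 / r - 1 / 2)
    (jmax : ℕ → ℕ) (ρj : ℝ) (hj : IsRegularlyVaryingSeq (fun n => (jmax n : ℝ)) ρj)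
    (hρj : ρj < min 1 (3 / r - 3)) :
    (∃ s₀ : ℝ, IsTiltRange (truncatedCGF μ (X 0) r) s₀) ∧
    ∀ s₀ : ℝ, IsTiltRange (truncatedCGF μ (X 0) r) s₀ →
      UniformExpEquiv
        (fun n j x => μ.real {ω | x < ∑ i ∈ Finset.range (n - j), X i ω})
        (fun n => a * n)
        (rate R (truncatedCGF μ (X 0) r) s₀)
        (fun n x => jmax n * deriv R x ^ 2)
        jmax
        (deviationWindow R d z) := by
  refine ⟨exists_isTiltRange_truncatedCGF h_tail, fun s₀ hs₀ => ?_⟩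
  have hX : ∀ i, AEMeasurable (X i) μ := fun i => (h_ident i).aemeasurable_fst
  have : IsProbabilityMeasure (μ.map (X 0)) := Measure.isProbabilityMeasure_map (hX 0)
  have hr1 : 1 < 1 / r := by
    rw [lt_div_iff₀ h_tail.r_pos, one_mul]; exact h_tail.r_lt_one
  have hρ : ρz < 1 / r := by
    rcases lt_or_ge (2 / 3) r with hr | hr
    · linarith [hρz hr]
    · linarith [hρz' hr]
  have hP : (fun n j x => μ.real {ω | x < ∑ i ∈ Finset.range (n - j), X i ω}) =
      fun n j x => (convPow (μ.map (X 0)) (n - j)).real (Ioi x) := by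
    funext n j x
    rw [← convPow_map_sum h_indep h_ident, map_measureReal_apply_of_aemeasurable
      (Finset.aemeasurable_fun_sum _ fun i _ => hX i) measurableSet_Ioi]
    rfl
  rw [hP, ← truncatedCGF_map (hX 0)]
  rw [← truncatedCGF_map (hX 0)] at hs₀
  exact (h_tail.map (hX 0)).uniformExpEquiv_convPow h_scale hz hρ hj
    (hρj.trans_le (min_le_left _ _)) hs₀
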